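/- Let $M$ be a compact connected $C^\infty$ manifold (without boundary), $\phi:M\to M$ a homeomorphism (for example a diffeomorphism), and $$X=M\times[0,1]\big/\,(x,0)\sim(\phi(x),1)$$ its mapping torus, with $M\subset X$ via $x\mapsto[(x,0)]$. Let $x_0\in M$, $H=\pi_1(M,x_0)$, $G=\pi_1(X,x_0)$ (a product $gh$ of loops runs first through $g$), and let $\xi:G\to\mathbb Z=\pi_1(S^1)$ be the homomorphism induced by the fibration $X\to S^1=\mathbb R/\mathbb Z$, $[(x,s)]\mapsto s$. Let $V$ be a finite-dimensional complex vector space and $\rho:G\to GL(V)$ a representation. Put $L=\mathbb C[t,t^{-1}]$. * Let $\bar\rho:G\to GL(V\otimes_{\mathbb C}L)$, $\bar\rho(g)=t^{\xi(g)}\rho(g)$. Let $H^*(X,\bar\rho)$ be the twisted cohomology, that is, the cohomology of the complex of $L$-modules $\mathrm{Hom}_{\bar\rho}(C_*(\widetilde X),V\otimes_{\mathbb C} L)$ of $G$-equivariant singular cochains of the universal covering $\widetilde X$. * Let $\rho^*$ be the right action of $G$ on $V^*=\mathrm{Hom}(V,\mathbb C)$ by transposes, $v\cdot g=v\circ\rho(g)$,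 and $\rho_0^*$ its restriction to $H$. Let $H_*(M,\rho_0^*)$ be the twisted homology, that is, the homology of $V^*\otimes_{\rho_0^*}C_*(\widetilde M)$, where $\widetilde M$ is the universal covering of $M$. * Let $\tau$ be a path in $M$ from $x_0$ to $\phi(x_0)$, let $u\in G$ be the class of $\tau$ followed by the image in $X$ of $\{\phi(x_0)\}\times[0,1]$, and let $\tilde\phi:\widetilde M\to\widetilde M$ be the lift $[\gamma]\mapsto[\tau\cdot\phi(\gamma)]$ of $\phi$. The twisted monodromy homomorphism $\phi_*:H_*(M,\rho_0^*)\to H_*(M,\rho_0^*)$ is the automorphism induced by the chain map $v\otimes\sigma\mapsto v u^{-1}\otimes\tilde\phi(\sigma)$. Regard $H_{j}(M,\rho_0^*)$ as an $L$-module on which $t$ acts by $\phi_*$. Then, for every choice of $\tau$ and every $k\ge0$, there is an isomorphism of $L$-modules $$H^k(X,\bar\rho)\;\cong\;H_{k-1}(M,\rho_0^*),$$ where $H_{-1}(M,\rho_0^*)=0$. -/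

import Mathlib

open scoped Manifold ContDiff

noncomputable section

open scoped TensorProduct
open CategoryTheory

namespace TwistedMonodromy

universe u v w

/-! ### The fundamental group -/

section PiOne

variable {Y : Type*} [TopologicalSpace Y]

/-- The fundamental group `π₁(Y, y₀)`: homotopy classes of loops at `y₀`, where `g * h` is the class
of the loop that runs first through `g` and then through `h`. (Mathlib's `FundamentalGroup Y y₀`
is the same set with the opposite multiplication.) -/
def PiOne (Y : Type*) [TopologicalSpace Y] (y₀ : Y) : Type _ := Path.Homotopic.Quotient y₀ y₀

theorem trans_assoc' {a b c d : Y} (p : Path.Homotopic.Quotient a b)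
    (q : Path.Homotopic.Quotient b c) (r : Path.Homotopic.Quotient c d) :
    (p.trans q).trans r = p.trans (q.trans r) :=
  Category.assoc (obj := FundamentalGroupoid Y) (W := ⟨a⟩) (X := ⟨b⟩) (Y := ⟨c⟩) (Z := ⟨d⟩) p q r

theorem refl_trans' {a b : Y} (p : Path.Homotopic.Quotient a b) :
    (Path.Homotopic.Quotient.refl a).trans p = p :=
  Category.id_comp (obj := FundamentalGroupoid Y) (X := ⟨a⟩) (Y := ⟨b⟩) p

theorem trans_refl' {a b : Y} (p : Path.Homotopic.Quotient a b) :
    p.trans (Path.Homotopic.Quotient.refl b) = p :=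
  Category.comp_id (obj := FundamentalGroupoid Y) (X := ⟨a⟩) (Y := ⟨b⟩) p

theorem symm_trans' {a b : Y} (p : Path.Homotopic.Quotient a b) :
    p.symm.trans p = Path.Homotopic.Quotient.refl b :=
  Groupoid.inv_comp (obj := FundamentalGroupoid Y) (X := ⟨a⟩) (Y := ⟨b⟩) p

theorem trans_symm' {a b : Y} (p : Path.Homotopic.Quotient a b) :
    p.trans p.symm = Path.Homotopic.Quotient.refl a :=
  Groupoid.comp_inv (obj := FundamentalGroupoid Y) (X := ⟨a⟩) (Y := ⟨b⟩) p

theorem map_trans' {Z : Type*} [TopologicalSpace Z] (f : C(Y, Z)) {a b c : Y}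
    (p : Path.Homotopic.Quotient a b) (q : Path.Homotopic.Quotient b c) :
    (p.trans q).map f = (p.map f).trans (q.map f) :=
  (FundamentalGroupoid.map f).map_comp (X := ⟨a⟩) (Y := ⟨b⟩) (Z := ⟨c⟩) p q

theorem map_symm' {Z : Type*} [TopologicalSpace Z] (f : C(Y, Z)) {a b : Y}
    (p : Path.Homotopic.Quotient a b) : p.symm.map f = (p.map f).symm := by
  induction p using Path.Homotopic.Quotient.ind with | mk p => rfl

instance (y₀ : Y) : Group (PiOne Y y₀) where
  mul g h := Path.Homotopic.Quotient.trans g h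
  one := Path.Homotopic.Quotient.refl y₀
  inv g := Path.Homotopic.Quotient.symm g
  mul_assoc g h k := trans_assoc' g h k
  one_mul g := refl_trans' g
  mul_one g := trans_refl' g
  inv_mul_cancel g := symm_trans' g

theorem PiOne.mul_def {y₀ : Y} (g h : PiOne Y y₀) :
    g * h = Path.Homotopic.Quotient.trans g h := rfl

/-- The homomorphism `π₁(Y, y₀) → π₁(Z, f y₀)` induced by a continuous map. -/
def PiOne.map {Z : Type*} [TopologicalSpace Z] (f : C(Y, Z)) (y₀ : Y) :
    PiOne Y y₀ →* PiOne Z (f y₀) where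
  toFun g := Path.Homotopic.Quotient.map g f
  map_one' := rfl
  map_mul' g h := map_trans' f g h

end PiOne

/-! ### The universal covering -/

section UniversalCover

/-- The universal covering `Ỹ` of `(Y, y₀)`, as the set of homotopy classes (rel endpoints) of
paths that start at `y₀`. -/
@[ext]
structure UniversalCover (Y : Type u) [TopologicalSpace Y] (y₀ : Y) : Type u where
  /-- the endpoint of the path, that is, the projection to `Y` -/
  proj : Y
  /-- the class of the path -/
  cls : Path.Homotopic.Quotient y₀ proj

namespace UniversalCover

variable {Y : Type u} [TopologicalSpace Y] {y₀ : Y}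

/-- The classes obtained from that of `x` by appending a path inside `U`. -/
def sheet (x : UniversalCover Y y₀) (U : Set Y) : Set (UniversalCover Y y₀) :=
  {z | ∃ γ : Path x.proj z.proj, (∀ t, γ t ∈ U) ∧
    z.cls = x.cls.trans (Path.Homotopic.Quotient.mk γ)}

/-- The usual topology of the universal covering: it is generated by the sets
`{[γ · η] | η a path in U that starts at the endpoint of γ}`, for `U` open in `Y`. -/
instance : TopologicalSpace (UniversalCover Y y₀) :=
  TopologicalSpace.generateFrom {S | ∃ x : UniversalCover Y y₀, ∃ U : Set Y, IsOpen U ∧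
    S = x.sheet U}

theorem isOpen_sheet (x : UniversalCover Y y₀) {U : Set Y} (hU : IsOpen U) :
    IsOpen (x.sheet U) :=
  TopologicalSpace.isOpen_generateFrom_of_mem ⟨x, U, hU, rfl⟩

theorem mem_sheet_self (x : UniversalCover Y y₀) {U : Set Y} (h : x.proj ∈ U) :
    x ∈ x.sheet U :=
  ⟨Path.refl _, fun _ => h, (trans_refl' x.cls).symm⟩

theorem sheet_subset {x z : UniversalCover Y y₀} {U : Set Y} (h : z ∈ x.sheet U) :
    z.sheet U ⊆ x.sheet U := by
  obtain ⟨γ, hγ, e⟩ := h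
  rintro w ⟨δ, hδ, e'⟩
  refine ⟨γ.trans δ, fun t => ?_, ?_⟩
  · have : (γ.trans δ) t ∈ Set.range γ ∪ Set.range δ := by
      rw [← Path.trans_range]; exact ⟨t, rfl⟩
    rcases this with ⟨s, hs⟩ | ⟨s, hs⟩
    · rw [← hs]; exact hγ s
    · rw [← hs]; exact hδ s
  · rw [e', e, trans_assoc', Path.Homotopic.Quotient.mk_trans]

theorem mem_of_mem_sheet {x z : UniversalCover Y y₀} {U : Set Y} (h : z ∈ x.sheet U) :
    z.proj ∈ U := by
  obtain ⟨γ, hγ, -⟩ := h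
  simpa using hγ 1

/-- The map of universal coverings over `f : Y → Z` that is determined by the class of a path `τ`
from `z₀` to `f y₀`: it sends the class of `γ` to that of `τ · f(γ)`. -/
def lift {Z : Type v} [TopologicalSpace Z] {z₀ : Z} (f : C(Y, Z))
    (τ : Path.Homotopic.Quotient z₀ (f y₀)) : C(UniversalCover Y y₀, UniversalCover Z z₀) where
  toFun x := ⟨f x.proj, τ.trans (x.cls.map f)⟩
  continuous_toFun := by
    refine continuous_generateFrom_iff.2 ?_
    rintro _ ⟨z, U, hU, rfl⟩
    rw [isOpen_iff_forall_mem_open]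
    intro x hx
    refine ⟨x.sheet (f ⁻¹' U), ?_, x.isOpen_sheet (hU.preimage f.continuous),
      x.mem_sheet_self (by simpa using mem_of_mem_sheet (Set.mem_preimage.1 hx))⟩
    rintro w ⟨γ, hγ, e⟩
    refine sheet_subset hx ⟨γ.map f.continuous, hγ, ?_⟩
    change τ.trans (w.cls.map f) = (τ.trans (x.cls.map f)).trans _
    rw [e, map_trans', trans_assoc']
    rfl

/-- The left action of `π₁(Y, y₀)` on the universal covering: `g • [γ] = [g · γ]`. -/
instance : MulAction (PiOne Y y₀) (UniversalCover Y y₀) where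
  smul g x := ⟨x.proj, Path.Homotopic.Quotient.trans g x.cls⟩
  one_smul x := UniversalCover.ext rfl (heq_of_eq (refl_trans' x.cls))
  mul_smul g h x := UniversalCover.ext rfl
    (heq_of_eq (trans_assoc' (g : Path.Homotopic.Quotient y₀ y₀)
      (h : Path.Homotopic.Quotient y₀ y₀) x.cls))

theorem smul_def (g : PiOne Y y₀) (x : UniversalCover Y y₀) :
    g • x = ⟨x.proj, Path.Homotopic.Quotient.trans g x.cls⟩ := rfl

theorem map_id' {a b : Y} (p : Path.Homotopic.Quotient a b) :
    p.map (ContinuousMap.id Y) = p := by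
  induction p using Path.Homotopic.Quotient.ind with | mk p => rfl

instance : ContinuousConstSMul (PiOne Y y₀) (UniversalCover Y y₀) where
  continuous_const_smul g := by
    convert (lift (y₀ := y₀) (ContinuousMap.id Y)
      (g : Path.Homotopic.Quotient y₀ y₀)).continuous using 2 with x
    exact UniversalCover.ext rfl (heq_of_eq (by
      change _ = Path.Homotopic.Quotient.trans _ (x.cls.map (ContinuousMap.id Y))
      rw [map_id']; rfl))

/-- The action of a group element, as a continuous map. -/
def act (g : PiOne Y y₀) : C(UniversalCover Y y₀, UniversalCover Y y₀) :=
  ⟨fun x => g • x, continuous_const_smul g⟩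

end UniversalCover

end UniversalCover

/-! ### Singular chains of a universal covering; twisted homology and cohomology -/

section Twisted

/-- The singular chain complex `C_*(E)` of a space, with integral coefficients. -/
abbrev singularChains (E : Type u) [TopologicalSpace E] : ChainComplex (ModuleCat.{u} ℤ) ℕ :=
  ((AlgebraicTopology.singularChainComplexFunctor (ModuleCat.{u} ℤ)).obj
    (ModuleCat.of ℤ (ULift.{u} ℤ))).obj (TopCat.of E)

/-- The chain map `C_*(E) → C_*(F)` induced by a continuous map. -/
abbrev singularChainsMap {E F : Type u} [TopologicalSpace E] [TopologicalSpace F] (f : C(E, F)) :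
    singularChains E ⟶ singularChains F :=
  ((AlgebraicTopology.singularChainComplexFunctor (ModuleCat.{u} ℤ)).obj
    (ModuleCat.of ℤ (ULift.{u} ℤ))).map (TopCat.ofHom f)

/-- Its component in degree `n`, as a linear map. -/
def chainsMap {E F : Type u} [TopologicalSpace E] [TopologicalSpace F] (f : C(E, F)) (n : ℕ) :
    (singularChains E).X n →ₗ[ℤ] (singularChains F).X n :=
  ((singularChainsMap f).f n).hom

/-- The boundary map, as a linear map. -/
def boundary (E : Type u) [TopologicalSpace E] (i j : ℕ) :
    (singularChains E).X i →ₗ[ℤ] (singularChains E).X j :=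
  ((singularChains E).d i j).hom

theorem chainsMap_comp {E F D : Type u} [TopologicalSpace E] [TopologicalSpace F]
    [TopologicalSpace D] (f : C(E, F)) (g : C(F, D)) (n : ℕ) :
    chainsMap (g.comp f) n = chainsMap g n ∘ₗ chainsMap f n := by
  unfold chainsMap singularChainsMap
  rw [TopCat.ofHom_comp, Functor.map_comp]
  rfl

theorem chainsMap_id (E : Type u) [TopologicalSpace E] (n : ℕ) :
    chainsMap (ContinuousMap.id E) n = LinearMap.id := by
  unfold chainsMap singularChainsMap
  rw [TopCat.ofHom_id, CategoryTheory.Functor.map_id]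
  rfl

theorem boundary_chainsMap {E F : Type u} [TopologicalSpace E] [TopologicalSpace F] (f : C(E, F))
    (i j : ℕ) : boundary F i j ∘ₗ chainsMap f i = chainsMap f j ∘ₗ boundary E i j := by
  have h := (singularChainsMap f).comm i j
  exact congrArg ModuleCat.Hom.hom h

theorem boundary_comp (E : Type u) [TopologicalSpace E] (i j k : ℕ) :
    boundary E j k ∘ₗ boundary E i j = 0 := by
  have h := (singularChains E).d_comp_d i j k
  exact congrArg ModuleCat.Hom.hom h

theorem boundary_shape (E : Type u) [TopologicalSpace E] (i j : ℕ)
    (h : ¬ (ComplexShape.down ℕ).Rel i j) : boundary E i j = 0 :=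
  congrArg ModuleCat.Hom.hom ((singularChains E).shape i j h)

variable {Y : Type u} [TopologicalSpace Y] {y₀ : Y}
variable {R : Type v} [CommRing R] {K : Type w} [AddCommGroup K] [Module R K]

/-- The twisted cochains `Hom_ρ(C_n(Ỹ), K)`, for a representation `ρ` of `π₁(Y, y₀)` on `K`:
the additive maps `f : C_n(Ỹ) → K` with `f (g c) = ρ(g) (f c)`. -/
def twistedCochains (ρ : Representation R (PiOne Y y₀) K) (n : ℕ) :
    Submodule R ((singularChains (UniversalCover Y y₀)).X n →ₗ[ℤ] K) where
  carrier := {f | ∀ (g : PiOne Y y₀) (c : (singularChains (UniversalCover Y y₀)).X n),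
    f (chainsMap (UniversalCover.act g) n c) = ρ g (f c)}
  add_mem' {f f'} hf hf' g c := by
    simp only [LinearMap.add_apply, hf g c, hf' g c, map_add]
  zero_mem' g c := by simp
  smul_mem' r f hf g c := by
    simp only [LinearMap.smul_apply, hf g c, map_smul]

/-- The coboundary `f ↦ f ∘ ∂`. -/
def coboundary (ρ : Representation R (PiOne Y y₀) K) (i j : ℕ) :
    twistedCochains ρ i →ₗ[R] twistedCochains ρ j where
  toFun f := ⟨f.1 ∘ₗ boundary (UniversalCover Y y₀) j i, fun g c => by
    have h := LinearMap.congr_fun (boundary_chainsMap (UniversalCover.act g) j i) c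
    simp only [LinearMap.comp_apply] at h ⊢
    rw [h, f.2 g]⟩
  map_add' f f' := Subtype.ext (LinearMap.add_comp _ _ _)
  map_smul' r f := Subtype.ext (LinearMap.smul_comp _ _ _)

/-- The complex of twisted cochains `C^*(Y, ρ)`. -/
def twistedCochainComplex (ρ : Representation R (PiOne Y y₀) K) :
    CochainComplex (ModuleCat.{max u w} R) ℕ where
  X n := ModuleCat.of R (twistedCochains ρ n)
  d i j := ModuleCat.ofHom (coboundary ρ i j)
  shape i j h := by
    refine ModuleCat.hom_ext (LinearMap.ext fun f => Subtype.ext ?_)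
    change f.1 ∘ₗ boundary (UniversalCover Y y₀) j i = 0
    rw [boundary_shape _ _ _ h, LinearMap.comp_zero]
  d_comp_d' i j k _ _ := by
    refine ModuleCat.hom_ext (LinearMap.ext fun f => Subtype.ext ?_)
    change (f.1 ∘ₗ boundary (UniversalCover Y y₀) j i) ∘ₗ boundary (UniversalCover Y y₀) k j = 0
    rw [LinearMap.comp_assoc, boundary_comp, LinearMap.comp_zero]

/-- The twisted cohomology `H^k(Y, ρ)`, an `R`-module. -/
abbrev twistedCohomology (ρ : Representation R (PiOne Y y₀) K) (k : ℕ) : ModuleCat.{max u w} R :=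
  (twistedCochainComplex ρ).homology k

/-- The relations `k g ⊗ c = k ⊗ g c` of the tensor product over `ℤ[π₁(Y, y₀)]`. Here `β` is an
antirepresentation of `π₁(Y, y₀)` on `K` and `k g` stands for `β(g) k`. -/
def tensorRelations (β : Representation R (PiOne Y y₀)ᵐᵒᵖ K) (n : ℕ) :
    Submodule R (K ⊗[ℤ] (singularChains (UniversalCover Y y₀)).X n) :=
  Submodule.span R {z | ∃ (x : K) (g : PiOne Y y₀)
    (c : (singularChains (UniversalCover Y y₀)).X n),
    z = (β (MulOpposite.op g) x) ⊗ₜ[ℤ] c - x ⊗ₜ[ℤ] (chainsMap (UniversalCover.act g) n c)}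

/-- The twisted chains `K ⊗_β C_n(Ỹ)`, for an antirepresentation `β` of `π₁(Y, y₀)` on `K`. -/
abbrev twistedChains (β : Representation R (PiOne Y y₀)ᵐᵒᵖ K) (n : ℕ) : Type (max u w) :=
  (K ⊗[ℤ] (singularChains (UniversalCover Y y₀)).X n) ⧸ tensorRelations β n

theorem boundary_relations (β : Representation R (PiOne Y y₀)ᵐᵒᵖ K) (i j : ℕ) :
    tensorRelations β i ≤ (tensorRelations β j).comap
      (TensorProduct.AlgebraTensorModule.map (LinearMap.id : K →ₗ[R] K)
        (boundary (UniversalCover Y y₀) i j)) := by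
  refine Submodule.span_le.2 ?_
  rintro _ ⟨x, g, c, rfl⟩
  refine Submodule.subset_span ⟨x, g, boundary (UniversalCover Y y₀) i j c, ?_⟩
  have h := LinearMap.congr_fun (boundary_chainsMap (UniversalCover.act g) i j) c
  simp only [LinearMap.comp_apply] at h
  simp only [map_sub, TensorProduct.AlgebraTensorModule.map_tmul, LinearMap.id_apply, h]

/-- The boundary `x ⊗ c ↦ x ⊗ ∂c`. -/
def twistedBoundary (β : Representation R (PiOne Y y₀)ᵐᵒᵖ K) (i j : ℕ) :
    twistedChains β i →ₗ[R] twistedChains β j :=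
  Submodule.mapQ _ _ _ (boundary_relations β i j)

theorem twistedChains_ext {β : Representation R (PiOne Y y₀)ᵐᵒᵖ K} {n : ℕ} {N : Type*}
    [AddCommGroup N] [Module R N] {f g : twistedChains β n →ₗ[R] N}
    (h : ∀ x c, f (Submodule.Quotient.mk (x ⊗ₜ[ℤ] c)) = g (Submodule.Quotient.mk (x ⊗ₜ[ℤ] c))) :
    f = g := by
  refine Submodule.linearMap_qext _ (TensorProduct.AlgebraTensorModule.ext fun x c => h x c)

theorem twistedBoundary_mk (β : Representation R (PiOne Y y₀)ᵐᵒᵖ K) (i j : ℕ) (x : K)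
    (c : (singularChains (UniversalCover Y y₀)).X i) :
    twistedBoundary β i j (Submodule.Quotient.mk (x ⊗ₜ[ℤ] c)) =
      Submodule.Quotient.mk (x ⊗ₜ[ℤ] boundary (UniversalCover Y y₀) i j c) := rfl

/-- The complex of twisted chains `C_*(Y, β) = K ⊗_β C_*(Ỹ)`. -/
def twistedChainComplex (β : Representation R (PiOne Y y₀)ᵐᵒᵖ K) :
    ChainComplex (ModuleCat.{max u w} R) ℕ where
  X n := ModuleCat.of R (twistedChains β n)
  d i j := ModuleCat.ofHom (twistedBoundary β i j)
  shape i j h := by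
    refine ModuleCat.hom_ext (twistedChains_ext fun x c => ?_)
    change twistedBoundary β i j (Submodule.Quotient.mk (x ⊗ₜ[ℤ] c)) = 0
    rw [twistedBoundary_mk, boundary_shape _ _ _ h]
    simp
  d_comp_d' i j k _ _ := by
    refine ModuleCat.hom_ext (twistedChains_ext fun x c => ?_)
    change twistedBoundary β j k (twistedBoundary β i j (Submodule.Quotient.mk (x ⊗ₜ[ℤ] c))) = 0
    rw [twistedBoundary_mk, twistedBoundary_mk]
    have h := LinearMap.congr_fun (boundary_comp (UniversalCover Y y₀) i j k) c
    simp only [LinearMap.comp_apply, LinearMap.zero_apply] at h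
    rw [h]
    simp

/-- The twisted homology `H_k(Y, β)`, an `R`-module. -/
abbrev twistedHomology (β : Representation R (PiOne Y y₀)ᵐᵒᵖ K) (k : ℕ) : ModuleCat.{max u w} R :=
  (twistedChainComplex β).homology k

/-- `ψ : Ỹ → Ỹ` and `B : K → K` are compatible, that is, both are equivariant along some map
`κ` of `π₁(Y, y₀)` to itself. -/
def Compatible (β : Representation R (PiOne Y y₀)ᵐᵒᵖ K)
    (B : K →ₗ[R] K) (ψ : C(UniversalCover Y y₀, UniversalCover Y y₀)) : Prop :=
  ∃ κ : PiOne Y y₀ → PiOne Y y₀, (∀ g x, ψ (g • x) = κ g • ψ x) ∧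
    ∀ g x, B (β (MulOpposite.op g) x) = β (MulOpposite.op (κ g)) (B x)

theorem map_relations {β : Representation R (PiOne Y y₀)ᵐᵒᵖ K} {B : K →ₗ[R] K}
    {ψ : C(UniversalCover Y y₀, UniversalCover Y y₀)} (h : Compatible β B ψ) (n : ℕ) :
    tensorRelations β n ≤ (tensorRelations β n).comap
      (TensorProduct.AlgebraTensorModule.map B (chainsMap ψ n)) := by
  obtain ⟨κ, hψ, hB⟩ := h
  refine Submodule.span_le.2 ?_
  rintro _ ⟨x, g, c, rfl⟩
  refine Submodule.subset_span ⟨B x, κ g, chainsMap ψ n c, ?_⟩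
  have e : ψ.comp (UniversalCover.act g) = (UniversalCover.act (κ g)).comp ψ :=
    ContinuousMap.ext fun x => hψ g x
  have e' := LinearMap.congr_fun (congrArg (fun f => chainsMap f n) e) c
  simp only [chainsMap_comp, LinearMap.comp_apply] at e'
  simp only [map_sub, TensorProduct.AlgebraTensorModule.map_tmul, hB, e']

/-- The endomorphism `x ⊗ c ↦ B x ⊗ ψ(c)` of the twisted chains. -/
def twistedChainsMap {β : Representation R (PiOne Y y₀)ᵐᵒᵖ K} {B : K →ₗ[R] K}
    {ψ : C(UniversalCover Y y₀, UniversalCover Y y₀)} (h : Compatible β B ψ) :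
    twistedChainComplex β ⟶ twistedChainComplex β where
  f n := ModuleCat.ofHom (Submodule.mapQ _ _ _ (map_relations h n))
  comm' i j _ := by
    refine ModuleCat.hom_ext (twistedChains_ext fun x c => ?_)
    have e := LinearMap.congr_fun (boundary_chainsMap ψ i j) c
    exact congrArg (fun z => Submodule.Quotient.mk (p := tensorRelations β j) (B x ⊗ₜ[ℤ] z)) e

theorem twistedChainsMap_comp_eq_id {β : Representation R (PiOne Y y₀)ᵐᵒᵖ K} {B B' : K →ₗ[R] K}
    {ψ ψ' : C(UniversalCover Y y₀, UniversalCover Y y₀)} (h : Compatible β B ψ)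
    (h' : Compatible β B' ψ') (hB : ∀ x, B' (B x) = x) (hψ : ∀ x, ψ' (ψ x) = x) :
    twistedChainsMap h ≫ twistedChainsMap h' = 𝟙 _ := by
  ext n : 1
  refine ModuleCat.hom_ext (twistedChains_ext fun x c => ?_)
  have e : ψ'.comp ψ = ContinuousMap.id _ := ContinuousMap.ext hψ
  have e' := LinearMap.congr_fun (congrArg (fun f => chainsMap f n) e) c
  simp only [chainsMap_comp, chainsMap_id, LinearMap.comp_apply, LinearMap.id_apply] at e'
  change Submodule.Quotient.mk (p := tensorRelations β n)
    (B' (B x) ⊗ₜ[ℤ] chainsMap ψ' n (chainsMap ψ n c)) = Submodule.Quotient.mk (x ⊗ₜ[ℤ] c)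
  rw [hB, e']

end Twisted

/-! ### The mapping torus -/

section MappingTorus

variable {M : Type u} [TopologicalSpace M]

/-- The mapping torus `M × [0,1] / (x, 0) ∼ (φ x, 1)`. -/
def MappingTorus (φ : M ≃ₜ M) : Type u :=
  Quot fun a b : M × unitInterval => a.2 = 0 ∧ b = (φ a.1, 1)

namespace MappingTorus

variable (φ : M ≃ₜ M)

instance : TopologicalSpace (MappingTorus φ) :=
  inferInstanceAs (TopologicalSpace (Quot _))

/-- The class of a point of `M × [0,1]`. -/
def mk : C(M × unitInterval, MappingTorus φ) := ⟨Quot.mk _, continuous_quot_mk⟩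

theorem mk_zero (x : M) : mk φ (x, 0) = mk φ (φ x, 1) := Quot.sound ⟨rfl, rfl⟩

/-- The inclusion `M → X`, `x ↦ [(x, 0)]`. -/
def incl : C(M, MappingTorus φ) := ⟨fun x => mk φ (x, 0), by fun_prop⟩

/-- The homotopy `s ↦ (x ↦ [(φ x, s)])` from `incl ∘ φ` to `incl`. -/
def flow : ((incl φ).comp (φ : C(M, M))).Homotopy (incl φ) where
  toFun p := mk φ (φ p.2, p.1)
  continuous_toFun := by fun_prop
  map_zero_left _ := rfl
  map_one_left x := (mk_zero φ x).symm

/-- The element `u` of `π₁(X, x₀)`: the path `τ` in `M` from `x₀` to `φ x₀`, followed by the image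
of `{φ x₀} × [0,1]`. -/
def uElt {x₀ : M} (τ : Path x₀ (φ x₀)) : PiOne (MappingTorus φ) (incl φ x₀) :=
  Path.Homotopic.Quotient.trans ((Path.Homotopic.Quotient.mk τ).map (incl φ))
    (Path.Homotopic.Quotient.mk ((flow φ).evalAt x₀))

/-- The fibration `X → S¹ = ℝ/ℤ`, `[(x, s)] ↦ s`. -/
def toCircle : C(MappingTorus φ, UnitAddCircle) where
  toFun := Quot.lift (fun a => ((a.2 : ℝ) : UnitAddCircle)) (by
    rintro ⟨x, s⟩ b ⟨hs, rfl⟩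
    obtain rfl : s = 0 := hs
    simp only [Set.Icc.coe_zero, Set.Icc.coe_one]
    exact (AddCircle.coe_period (1 : ℝ)).symm)
  continuous_toFun := continuous_quot_lift _ (by fun_prop)

end MappingTorus

/-- The winding number of a loop in `S¹ = ℝ/ℤ` based at the class of `e`: the difference between
the end point and the starting point `e` of its lift to `ℝ`. -/
def windingNumber (e : ℝ) (γ : PiOne UnitAddCircle (e : UnitAddCircle)) : ℤ :=
  ⌊((AddCircle.isCoveringMap_coe (1 : ℝ)).monodromy
    (γ : Path.Homotopic.Quotient (e : UnitAddCircle) e) ⟨e, rfl⟩ : ℝ) - e⌋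

theorem coe_windingNumber (e : ℝ) (γ : PiOne UnitAddCircle (e : UnitAddCircle)) :
    (windingNumber e γ : ℝ) = ((AddCircle.isCoveringMap_coe (1 : ℝ)).monodromy
      (γ : Path.Homotopic.Quotient (e : UnitAddCircle) e) ⟨e, rfl⟩ : ℝ) - e := by
  unfold windingNumber
  obtain ⟨r, hr⟩ := (AddCircle.isCoveringMap_coe (1 : ℝ)).monodromy
    (γ : Path.Homotopic.Quotient (e : UnitAddCircle) e) ⟨e, rfl⟩
  have h : ((r - e : ℝ) : UnitAddCircle) = 0 := by
    rw [AddCircle.coe_sub, sub_eq_zero]; exact hr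
  obtain ⟨n, hn⟩ := (AddCircle.coe_eq_zero_iff (1 : ℝ)).1 h
  have hn' : r - e = n := by rw [← hn]; simp
  simp [hn']

/-- The lift that starts at another point `e'` of the fibre is the translate of the lift that
starts at `e`. -/
theorem monodromy_translate (e : ℝ) (γ : PiOne UnitAddCircle (e : UnitAddCircle))
    (e' : ((↑) : ℝ → UnitAddCircle) ⁻¹' {(e : UnitAddCircle)}) :
    ((AddCircle.isCoveringMap_coe (1 : ℝ)).monodromy
      (γ : Path.Homotopic.Quotient (e : UnitAddCircle) e) e' : ℝ) = e' + windingNumber e γ := by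
  rw [coe_windingNumber]
  set cov := AddCircle.isCoveringMap_coe (1 : ℝ)
  obtain ⟨e', he'⟩ := e'
  change Path.Homotopic.Quotient (e : UnitAddCircle) e at γ
  induction γ using Path.Homotopic.Quotient.ind with
  | mk γ =>
    change cov.liftPath γ e' _ 1 = e' + (cov.liftPath γ e _ 1 - e)
    have h0 : γ 0 = ((e : ℝ) : UnitAddCircle) := γ.source
    have key : (fun t => cov.liftPath γ e h0 t + (e' - e)) =
        cov.liftPath γ e' (h0.trans he'.symm) := by
      refine (cov.eq_liftPath_iff _).2 ⟨by fun_prop, ?_, ?_⟩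
      · funext t
        have h1 := congrFun (cov.liftPath_lifts γ e h0) t
        have h2 : ((e' : ℝ) : UnitAddCircle) = e := he'
        simp only [Function.comp_apply, AddCircle.coe_add, AddCircle.coe_sub, h2, sub_self,
          add_zero] at h1 ⊢
        exact h1
      · rw [cov.liftPath_zero]; ring
    have := congrFun key 1
    rw [← this]
    ring

/-- The isomorphism `π₁(S¹) → ℤ`, as a homomorphism. -/
def windingHom (e : ℝ) : PiOne UnitAddCircle (e : UnitAddCircle) →* Multiplicative ℤ where
  toFun γ := Multiplicative.ofAdd (windingNumber e γ)
  map_one' := by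
    refine congrArg Multiplicative.ofAdd (?_ : windingNumber e 1 = 0)
    have h := coe_windingNumber e 1
    have h1 := congrFun ((AddCircle.isCoveringMap_coe (1 : ℝ)).monodromy_refl
      (x := (e : UnitAddCircle))) ⟨e, rfl⟩
    have h2 : (windingNumber e 1 : ℝ) = e - e :=
      h.trans (congrArg (fun z => (z : ℝ) - e) (congrArg Subtype.val h1))
    exact_mod_cast h2.trans (sub_self e)
  map_mul' γ γ' := by
    refine congrArg Multiplicative.ofAdd
      (?_ : windingNumber e (γ * γ') = windingNumber e γ + windingNumber e γ')
    have h := coe_windingNumber e (γ * γ')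
    have h1 := (AddCircle.isCoveringMap_coe (1 : ℝ)).monodromy_trans_apply
      (γ : Path.Homotopic.Quotient (e : UnitAddCircle) e)
      (γ' : Path.Homotopic.Quotient (e : UnitAddCircle) e) ⟨e, rfl⟩
    have h2 := congrArg Subtype.val h1
    rw [monodromy_translate] at h2
    have h3 := coe_windingNumber e γ
    have h4 : (windingNumber e (γ * γ') : ℝ) = windingNumber e γ + windingNumber e γ' := by
      refine h.trans ((congrArg (fun z => z - e) h2).trans ?_)
      rw [h3]
      ring
    exact_mod_cast h4

namespace MappingTorus

variable (φ : M ≃ₜ M)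

/-- The class `ξ ∈ H¹(X, ℤ)` of the fibration `X → S¹`, as the homomorphism
`π₁(X, x₀) → π₁(S¹) = ℤ`. -/
def xi (x₀ : M) : PiOne (MappingTorus φ) (incl φ x₀) →* Multiplicative ℤ :=
  (windingHom ((0 : unitInterval) : ℝ)).comp (PiOne.map (toCircle φ) (incl φ x₀))

end MappingTorus

end MappingTorus

/-! ### Representations -/

section Representations

variable {G : Type*} [Group G] {V : Type*} [AddCommGroup V] [Module ℂ V]

/-- The antirepresentation `ρ*` of `G` on `V* = Hom(V, ℂ)` conjugate to `ρ`: the element `g` acts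
by the transpose of `ρ(g)`. -/
def conjugateAntirep (ρ : Representation ℂ G V) : Representation ℂ Gᵐᵒᵖ (Module.Dual ℂ V) where
  toFun g := Module.Dual.transpose (R := ℂ) (ρ g.unop)
  map_one' := by ext; simp [Module.Dual.transpose_apply]
  map_mul' g h := by ext; simp [Module.Dual.transpose_apply]

/-- The representation `ρ̄ = ρ ⊗ [ξ]` on `V[t^±] = ℂ[t, t⁻¹] ⊗ V`: the element `g` acts by
`t^{ξ(g)} ρ(g)`. -/
def rhoBar (ρ : Representation ℂ G V) (ξ : G →* Multiplicative ℤ) :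
    Representation (LaurentPolynomial ℂ) G (LaurentPolynomial ℂ ⊗[ℂ] V) where
  toFun g := (LaurentPolynomial.T (ξ g).toAdd : LaurentPolynomial ℂ) •
    (ρ g).baseChange (LaurentPolynomial ℂ)
  map_one' := by
    simp only [map_one, toAdd_one, LaurentPolynomial.T_zero, one_smul]
    exact LinearMap.baseChange_id
  map_mul' g h := by
    simp only [map_mul, toAdd_mul, LaurentPolynomial.T_add]
    rw [smul_mul_smul_comm]
    congr 1
    exact LinearMap.baseChange_comp _ _

end Representations

/-! ### The twisted monodromy homomorphism -/

section Monodromy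

variable {M : Type u} [TopologicalSpace M] (φ : M ≃ₜ M) {x₀ : M} (τ : Path x₀ (φ x₀))

/-- The lift `φ̃ : M̃ → M̃`, `γ ↦ τ · φ(γ)`. -/
def phiLift : C(UniversalCover M x₀, UniversalCover M x₀) :=
  UniversalCover.lift (φ : C(M, M)) (Path.Homotopic.Quotient.mk τ)

/-- The map `K_τ(γ) = τ φ(γ) τ⁻¹` of `π₁(M, x₀)` to itself. -/
def kTau (h : PiOne M x₀) : PiOne M x₀ :=
  Path.Homotopic.Quotient.trans ((Path.Homotopic.Quotient.mk τ).trans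
    (Path.Homotopic.Quotient.map h (φ : C(M, M)))) (Path.Homotopic.Quotient.mk τ).symm

theorem phiLift_smul (h : PiOne M x₀) (x : UniversalCover M x₀) :
    phiLift φ τ (h • x) = kTau φ τ h • phiLift φ τ x := by
  have key (t : Path.Homotopic.Quotient x₀ (φ x₀)) (h' : Path.Homotopic.Quotient x₀ x₀) :
      t.trans ((h'.trans x.cls).map (φ : C(M, M))) =
        ((t.trans (h'.map (φ : C(M, M)))).trans t.symm).trans
          (t.trans (x.cls.map (φ : C(M, M)))) := by
    have e (q : Path.Homotopic.Quotient (φ x₀) (φ x.proj)) :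
        t.symm.trans (t.trans q) = q := by
      rw [← trans_assoc', symm_trans', refl_trans']
    rw [map_trans', trans_assoc', trans_assoc']
    exact congrArg _ (congrArg _ (e _).symm)
  exact UniversalCover.ext rfl (heq_of_eq (key (Path.Homotopic.Quotient.mk τ) h))

/-- The relation `K_τ(h) u = u h` in `π₁(X, x₀)`. -/
theorem kTau_mul_uElt (h : PiOne M x₀) :
    PiOne.map (MappingTorus.incl φ) x₀ (kTau φ τ h) * MappingTorus.uElt φ τ =
      MappingTorus.uElt φ τ * PiOne.map (MappingTorus.incl φ) x₀ h := by
  have key (h' : Path.Homotopic.Quotient x₀ x₀) :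
      ((h'.map (φ : C(M, M))).map (MappingTorus.incl φ)).trans
        (Path.Homotopic.Quotient.mk ((MappingTorus.flow φ).evalAt x₀)) =
      (Path.Homotopic.Quotient.mk ((MappingTorus.flow φ).evalAt x₀)).trans
        (h'.map (MappingTorus.incl φ)) := by
    induction h' using Path.Homotopic.Quotient.ind with
    | mk p =>
      refine Path.Homotopic.Quotient.eq.2 ?_
      exact Path.Homotopic.map_trans_evalAt (MappingTorus.flow φ) p
  have alg {Z : Type u} [TopologicalSpace Z] {a b : Z} (t : Path.Homotopic.Quotient a b)
      (g : Path.Homotopic.Quotient b b) (c : Path.Homotopic.Quotient b a)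
      (k : Path.Homotopic.Quotient a a) (hk : g.trans c = c.trans k) :
      ((t.trans g).trans t.symm).trans (t.trans c) = (t.trans c).trans k := by
    have e : t.symm.trans (t.trans c) = c := by
      rw [← trans_assoc', symm_trans', refl_trans']
    rw [trans_assoc', e, trans_assoc', trans_assoc', hk]
  have mapped (t : Path.Homotopic.Quotient x₀ (φ x₀)) (h' : Path.Homotopic.Quotient x₀ x₀) :
      ((t.trans (h'.map (φ : C(M, M)))).trans t.symm).map (MappingTorus.incl φ) =
      ((t.map (MappingTorus.incl φ)).trans ((h'.map (φ : C(M, M))).map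
        (MappingTorus.incl φ))).trans (t.map (MappingTorus.incl φ)).symm := by
    rw [map_trans', map_trans', map_symm']
  refine Eq.trans (congrArg (fun z => Path.Homotopic.Quotient.trans z (MappingTorus.uElt φ τ))
    (mapped (Path.Homotopic.Quotient.mk τ) h)) ?_
  exact alg ((Path.Homotopic.Quotient.mk τ).map (MappingTorus.incl φ)) _ _ _ (key h)

theorem map_symm_map {a b : M} (p : Path.Homotopic.Quotient (φ a) (φ b)) :
    ((p.map (φ.symm : C(M, M))).cast (φ.symm_apply_apply a).symm
      (φ.symm_apply_apply b).symm).map (φ : C(M, M)) = p := by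
  induction p using Path.Homotopic.Quotient.ind with
  | mk p =>
    refine congrArg Path.Homotopic.Quotient.mk (Path.ext ?_)
    funext t
    simp

theorem kTau_surjective : Function.Surjective (kTau φ τ) := fun h => by
  have key (t : Path.Homotopic.Quotient x₀ (φ x₀)) (h' : Path.Homotopic.Quotient x₀ x₀) :
      (t.trans (((((t.symm.trans h').trans t).map (φ.symm : C(M, M))).cast
        (φ.symm_apply_apply x₀).symm (φ.symm_apply_apply x₀).symm).map (φ : C(M, M)))).trans
          t.symm = h' := by
    rw [map_symm_map, ← trans_assoc', ← trans_assoc', trans_symm', refl_trans', trans_assoc',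
      trans_symm', trans_refl']
  exact ⟨_, key (Path.Homotopic.Quotient.mk τ) h⟩

/-- The inverse of `φ̃`: the lift of `φ⁻¹` determined by the path `φ⁻¹(τ⁻¹)` from `x₀` to
`φ⁻¹(x₀)`. -/
def phiLiftInv : C(UniversalCover M x₀, UniversalCover M x₀) :=
  UniversalCover.lift (φ.symm : C(M, M))
    (((Path.Homotopic.Quotient.mk τ).symm.map (φ.symm : C(M, M))).cast
      (φ.symm_apply_apply x₀).symm rfl)

theorem cover_ext {x y : UniversalCover M x₀} (h : x.proj = y.proj)
    (h' : x.cls = y.cls.cast rfl h) : x = y := by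
  obtain ⟨a, p⟩ := x
  obtain ⟨b, q⟩ := y
  obtain rfl : a = b := h
  exact UniversalCover.ext rfl (heq_of_eq (h'.trans (q.cast_rfl_rfl)))

theorem cast_trans' {a a' b c : M} (h : a' = a) (p : Path.Homotopic.Quotient a b)
    (q : Path.Homotopic.Quotient b c) : (p.cast h rfl).trans q = (p.trans q).cast h rfl := by
  subst h
  simp

theorem trans_cast' {a b c c' : M} (h : c' = c) (p : Path.Homotopic.Quotient a b)
    (q : Path.Homotopic.Quotient b c) : p.trans (q.cast rfl h) = (p.trans q).cast rfl h := by
  subst h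
  simp

theorem phiLiftInv_phiLift (x : UniversalCover M x₀) :
    phiLiftInv φ τ (phiLift φ τ x) = x := by
  refine cover_ext (φ.symm_apply_apply x.proj) ?_
  have key (t : Path.Homotopic.Quotient x₀ (φ x₀)) :
      ((t.symm.map (φ.symm : C(M, M))).cast (φ.symm_apply_apply x₀).symm rfl).trans
        ((t.trans (x.cls.map (φ : C(M, M)))).map (φ.symm : C(M, M))) =
      ((x.cls.map (φ : C(M, M))).map (φ.symm : C(M, M))).cast
        (φ.symm_apply_apply x₀).symm rfl := by
    rw [cast_trans', ← map_trans', ← trans_assoc', symm_trans', refl_trans']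
  refine (key (Path.Homotopic.Quotient.mk τ)).trans ?_
  generalize x.cls = c
  induction c using Path.Homotopic.Quotient.ind with
  | mk c =>
    refine congrArg Path.Homotopic.Quotient.mk (Path.ext ?_)
    funext t
    simp
    rfl

theorem phiLift_phiLiftInv (x : UniversalCover M x₀) :
    phiLift φ τ (phiLiftInv φ τ x) = x := by
  refine cover_ext (φ.apply_symm_apply x.proj) ?_
  have key (t : Path.Homotopic.Quotient x₀ (φ x₀)) (c : Path.Homotopic.Quotient x₀ x.proj) :
      t.trans ((((t.symm.map (φ.symm : C(M, M))).cast (φ.symm_apply_apply x₀).symm rfl).trans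
        (c.map (φ.symm : C(M, M)))).map (φ : C(M, M))) =
      c.cast rfl (φ.apply_symm_apply x.proj) := by
    have e : (((t.symm.map (φ.symm : C(M, M))).cast (φ.symm_apply_apply x₀).symm rfl).trans
        (c.map (φ.symm : C(M, M)))).map (φ : C(M, M)) =
        (t.symm.trans c).cast rfl (φ.apply_symm_apply x.proj) := by
      rw [cast_trans', ← map_trans']
      generalize t.symm.trans c = d
      induction d using Path.Homotopic.Quotient.ind with
      | mk d =>
        refine congrArg Path.Homotopic.Quotient.mk (Path.ext ?_)
        funext t
        simp
    rw [e, trans_cast', ← trans_assoc', trans_symm', refl_trans']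
  exact key (Path.Homotopic.Quotient.mk τ) x.cls

variable {W : Type w} [AddCommGroup W] [Module ℂ W]
  (β : Representation ℂ (PiOne (MappingTorus φ) (MappingTorus.incl φ x₀))ᵐᵒᵖ W)

/-- The restriction `β₀` of an antirepresentation `β` of `π₁(X, x₀)` to `π₁(M, x₀)`. -/
def restrictToFibre : Representation ℂ (PiOne M x₀)ᵐᵒᵖ W :=
  β.comp (PiOne.map (MappingTorus.incl φ) x₀).op

theorem phi_equivariant (h : PiOne M x₀) (x : W) :
    β (MulOpposite.op (MappingTorus.uElt φ τ)⁻¹) (restrictToFibre φ β (MulOpposite.op h) x) =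
      restrictToFibre φ β (MulOpposite.op (kTau φ τ h))
        (β (MulOpposite.op (MappingTorus.uElt φ τ)⁻¹) x) := by
  change (β _ * β (MulOpposite.op (PiOne.map (MappingTorus.incl φ) x₀ h))) x =
    (β (MulOpposite.op (PiOne.map (MappingTorus.incl φ) x₀ (kTau φ τ h))) * β _) x
  rw [← map_mul, ← map_mul, ← MulOpposite.op_mul, ← MulOpposite.op_mul]
  have e := kTau_mul_uElt φ τ h
  rw [← eq_mul_inv_iff_mul_eq] at e
  rw [e]
  group

theorem compatible_phi : Compatible (restrictToFibre φ β)
    (β (MulOpposite.op (MappingTorus.uElt φ τ)⁻¹)) (phiLift φ τ) := by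
  exact ⟨kTau φ τ, phiLift_smul φ τ, phi_equivariant φ τ β⟩

theorem compatible_phiInv : Compatible (restrictToFibre φ β)
    (β (MulOpposite.op (MappingTorus.uElt φ τ))) (phiLiftInv φ τ) := by
  have hB (x : W) : β (MulOpposite.op (MappingTorus.uElt φ τ))
      (β (MulOpposite.op (MappingTorus.uElt φ τ)⁻¹) x) = x := by
    rw [MulOpposite.op_inv, Representation.self_inv_apply]
  have hB' (x : W) : β (MulOpposite.op (MappingTorus.uElt φ τ)⁻¹)
      (β (MulOpposite.op (MappingTorus.uElt φ τ)) x) = x := by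
    rw [MulOpposite.op_inv, Representation.inv_self_apply]
  obtain ⟨s, hs⟩ := (kTau_surjective φ τ).hasRightInverse
  have hc (g : PiOne M x₀) (x : W) : β (MulOpposite.op (MappingTorus.uElt φ τ)⁻¹)
      (restrictToFibre φ β (MulOpposite.op (s g)) x) =
      restrictToFibre φ β (MulOpposite.op g) (β (MulOpposite.op (MappingTorus.uElt φ τ)⁻¹) x) := by
    rw [phi_equivariant, hs g]
  refine ⟨s, fun g x => ?_, fun g x => ?_⟩
  · conv_lhs => rw [← hs g, ← phiLift_phiLiftInv φ τ x, ← phiLift_smul, phiLiftInv_phiLift]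
  · have e := hc g (β (MulOpposite.op (MappingTorus.uElt φ τ)) x)
    rw [hB'] at e
    rw [← e, hB]

/-- The chain automorphism `A` of `W ⊗_{β₀} C_*(M̃)`, `A(v ⊗ σ) = v u⁻¹ ⊗ φ̃(σ)`. -/
def monodromyIso : twistedChainComplex (restrictToFibre φ β) ≅
    twistedChainComplex (restrictToFibre φ β) where
  hom := twistedChainsMap (compatible_phi φ τ β)
  inv := twistedChainsMap (compatible_phiInv φ τ β)
  hom_inv_id := twistedChainsMap_comp_eq_id _ _ (fun x => by
    rw [MulOpposite.op_inv, Representation.self_inv_apply]) (phiLiftInv_phiLift φ τ)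
  inv_hom_id := twistedChainsMap_comp_eq_id _ _ (fun x => by
    rw [MulOpposite.op_inv, Representation.inv_self_apply]) (phiLift_phiLiftInv φ τ)

/-- The twisted monodromy homomorphism `φ_*[β]` of `H_k(M, β₀)`. -/
def twistedMonodromy (k : ℕ) : twistedHomology (restrictToFibre φ β) k ≃ₗ[ℂ]
    twistedHomology (restrictToFibre φ β) k :=
  ((HomologicalComplex.homologyFunctor _ _ k).mapIso (monodromyIso φ τ β)).toLinearEquiv

end Monodromy

/-! ### The module structure given by an automorphism -/

section LaurentModule

variable {A : Type w} [AddCommGroup A] [Module ℂ A]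

/-- A vector space `A` with an automorphism `f`, regarded as a module over `ℂ[t, t⁻¹]` on which
`t` acts by `f`. -/
def LaurentModule (_f : A ≃ₗ[ℂ] A) : Type w := A

instance (f : A ≃ₗ[ℂ] A) : AddCommGroup (LaurentModule f) := inferInstanceAs (AddCommGroup A)

/-- The algebra homomorphism `ℂ[t, t⁻¹] → End A` with `t ↦ f`. -/
def laurentAction (f : A ≃ₗ[ℂ] A) : LaurentPolynomial ℂ →ₐ[ℂ] Module.End ℂ A :=
  AddMonoidAlgebra.lift ℂ (Module.End ℂ A) ℤ
    ((Units.coeHom (Module.End ℂ A)).comp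
      (zpowersHom _ (LinearMap.GeneralLinearGroup.ofLinearEquiv f)))

instance (f : A ≃ₗ[ℂ] A) : Module (LaurentPolynomial ℂ) (LaurentModule f) :=
  Module.compHom A (laurentAction f).toRingHom

theorem LaurentModule.T_smul (f : A ≃ₗ[ℂ] A) (a : A) :
    (LaurentPolynomial.T 1 : LaurentPolynomial ℂ) • (show LaurentModule f from a) = f a := by
  change laurentAction f (LaurentPolynomial.T 1) a = f a
  unfold laurentAction LaurentPolynomial.T
  rw [AddMonoidAlgebra.lift_single]
  simp

theorem LaurentModule.C_smul (f : A ≃ₗ[ℂ] A) (c : ℂ) (a : A) :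
    (LaurentPolynomial.C c : LaurentPolynomial ℂ) • (show LaurentModule f from a) = c • a := by
  change laurentAction f (LaurentPolynomial.C c) a = c • a
  rw [LaurentPolynomial.C_eq_algebraMap, AlgHom.commutes]
  rfl

end LaurentModule

end TwistedMonodromy

end

open TwistedMonodromy

/-! The map `MappingTorus.covering` makes `M × ℝ` an infinite cyclic covering of `X`, with deck
group generated by `(x, s) ↦ (φ x, s + 1)`. Hence `X̃ = M̃ × ℝ` (`coverHomeomorph`), the kernel of
`ξ` is the image of `H` and acts on the factor `M̃` alone, and `u` acts by `(x, s) ↦ (φ̃ x, s + 1)`.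
A twisted cochain of `X` is therefore a cochain of `X̃` that is equivariant under `ker ξ` and fixed
by `U`, where `(U f)(c) = ρ̄(u)⁻¹ f(u c)`. On the complex `C` of `ker ξ`-equivariant cochains `U -
1` is onto: `antidifference` is a right inverse, which sums translates along the orbit of `u`, as
many as the integer part of the height prescribes. So twisted cochains are the kernel of a
surjective endomorphism `U - 1` of `C`, and `H^*(X, ρ̄)` is tied to `H^*(C)` by a Wang sequence.

The cohomology of `C` is computed on the fibre. `X̃` deforms onto `M̃` equivariantly under `H`.
Since `V` is finite-dimensional, the cochains of `M̃` are the `L`-valued functionals on the chains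
`V* ⊗ C_*(M̃)`, and since `ℂ` is a field, `H^k(C) = Hom(N, L)` with `N = H_k(M, ρ₀*)`; on cocycles
this map is `fibreEval`. As `ξ(u) = 1`, `U` becomes `F ↦ t⁻¹ F ∘ A` with `A = φ_*`
(`fibreEval_translate`).

Now `N` is finite-dimensional. A fixed point `F` of this operator satisfies `F = t⁻ᵐ F ∘ Aᵐ` for all
`m`, which contradicts the bound on degrees unless `F = 0`; and the cokernel of the operator minus
the identity is `N*` with `t` acting by the transpose of `A`, because `f ∘ A ⊗ 1` and `t (f ⊗ 1)`
agree there. So the Wang sequence breaks up into `H^0(X, ρ̄) = 0` and `H^{k+1}(X, ρ̄) ≅ N*`. An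
endomorphism over a field is conjugate to its transpose (`exists_equiv_dual`), which turns `N*` into
`N`; this last isomorphism depends on choices. The long exact sequence is not built: `connecting`
sends a cocycle of `C` directly to the coboundary of its antidifference, and
`nonempty_equiv_of_conj` needs only that it is onto with kernel the image of `U - 1` on cocycles.

Finite-dimensionality (`twistedHomology_finite`) uses no cell structure. Embed `M` in a Euclidean
space, where it is a neighbourhood retract, and choose a finite net in `M`. Iterated barycentric
subdivision makes the simplices of a cycle small; a small simplex is then moved, by retracting a
linear homotopy to `M` and lifting it to `M̃`, to a simplex that is affine with vertices in the net.
In each degree there are only finitely many of these up to the fundamental group. -/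

noncomputable section

open scoped TensorProduct
open CategoryTheory

namespace TwistedMonodromy

universe u v w

/-! ### The standard basis of singular chains -/

section SingularSimplices

open Simplicial Opposite

variable {E : Type u} [TopologicalSpace E] {F : Type u} [TopologicalSpace F]

/-- The standard topological simplex. -/
abbrev Simplex (n : ℕ) : Type := stdSimplex ℝ (Fin (n + 1))

/-- The inclusion of the `i`-th face of the standard simplex. -/
def faceMap {n : ℕ} (i : Fin (n + 2)) : C(Simplex n, Simplex (n + 1)) :=
  ⟨stdSimplex.map i.succAbove, stdSimplex.continuous_map _⟩

/-- A singular simplex, as a singular chain. -/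
def ofSimplex {n : ℕ} (σ : C(Simplex n, E)) : (singularChains E).X n :=
  (SSet.ιChainComplex (X := TopCat.toSSet.obj (TopCat.of E)) (R := ModuleCat.of ℤ (ULift.{u} ℤ))
    (n := n) ((TopCat.toSSetObjEquiv (TopCat.of E) (op ⦋n⦌)).symm σ)).hom ⟨1⟩

/-- The coordinates of a singular chain. -/
def chainsRepr (n : ℕ) : (singularChains E).X n →ₗ[ℤ] (C(Simplex n, E) →₀ ℤ) :=
  ((SSet.isColimitChainComplexXCofan (TopCat.toSSet.obj (TopCat.of E))
    (ModuleCat.of ℤ (ULift.{u} ℤ)) n).desc (Limits.Cofan.mk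
      (ModuleCat.of ℤ (C(Simplex n, E) →₀ ℤ)) fun s =>
      ModuleCat.ofHom ((Finsupp.lsingle (TopCat.toSSetObjEquiv (TopCat.of E) (op ⦋n⦌) s)).comp
        (ULift.moduleEquiv (R := ℤ) (M := ℤ)).toLinearMap))).hom

theorem chainsRepr_ofSimplex {n : ℕ} (σ : C(Simplex n, E)) :
    chainsRepr n (ofSimplex σ) = Finsupp.single σ 1 := by
  have h := (SSet.isColimitChainComplexXCofan (TopCat.toSSet.obj (TopCat.of E))
    (ModuleCat.of ℤ (ULift.{u} ℤ)) n).fac (Limits.Cofan.mk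
      (ModuleCat.of ℤ (C(Simplex n, E) →₀ ℤ)) fun s =>
      ModuleCat.ofHom ((Finsupp.lsingle (TopCat.toSSetObjEquiv (TopCat.of E) (op ⦋n⦌) s)).comp
        (ULift.moduleEquiv (R := ℤ) (M := ℤ)).toLinearMap))
        ⟨(TopCat.toSSetObjEquiv (TopCat.of E) (op ⦋n⦌)).symm σ⟩
  have h2 := congrArg (fun f => f.hom ⟨1⟩) h
  refine h2.trans ?_
  change Finsupp.single ((TopCat.toSSetObjEquiv (TopCat.of E) (op ⦋n⦌))
    ((TopCat.toSSetObjEquiv (TopCat.of E) (op ⦋n⦌)).symm σ)) 1 = _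
  rw [Equiv.apply_symm_apply]

theorem linearCombination_chainsRepr {n : ℕ} (c : (singularChains E).X n) :
    Finsupp.linearCombination ℤ (ofSimplex (E := E) (n := n)) (chainsRepr n c) = c := by
  have h : ModuleCat.ofHom ((Finsupp.linearCombination ℤ (ofSimplex (E := E) (n := n))).comp
      (chainsRepr n)) = 𝟙 ((singularChains E).X n) := by
    refine SSet.chainComplex_hom_ext fun s => ?_
    obtain ⟨σ, rfl⟩ := (TopCat.toSSetObjEquiv (TopCat.of E) (op ⦋n⦌)).symm.surjective s
    refine ModuleCat.hom_ext (LinearMap.ext fun r => ?_)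
    obtain ⟨k⟩ := r
    -- The coefficient module is generated by `1`, so it suffices to compare the maps on the chains
    -- `ofSimplex σ`.
    have e : (ULift.up k : ULift.{u} ℤ) = k • (ULift.up 1) := by
      ext; simp
    rw [e, map_zsmul, map_zsmul]
    refine congrArg (fun z => k • z) ?_
    change Finsupp.linearCombination ℤ (ofSimplex (E := E) (n := n))
      (chainsRepr n (ofSimplex σ)) = ofSimplex σ
    rw [chainsRepr_ofSimplex, Finsupp.linearCombination_single]
    -- The `ℤ`-module structure stored in an object of `ModuleCat ℤ` is not syntactically that of
    -- its additive group, so the instance is given by hand.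
    exact @one_smul ℤ _ _ ((singularChains E).X n).isModule.toMulAction _
  exact LinearMap.congr_fun (congrArg ModuleCat.Hom.hom h) c

theorem chains_hom_ext {n : ℕ} {A : Type*} [AddCommGroup A] [Module ℤ A]
    {f g : (singularChains E).X n →ₗ[ℤ] A}
    (h : ∀ σ : C(Simplex n, E), f (ofSimplex σ) = g (ofSimplex σ)) : f = g := by
  ext c
  rw [← linearCombination_chainsRepr c]
  induction chainsRepr n c using Finsupp.induction_linear with
  | zero => simp
  | add a b ha hb => simp only [map_add, ha, hb]
  | single σ k =>
    rw [Finsupp.linearCombination_single]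
    exact (f.map_smul k _).trans ((congrArg _ (h σ)).trans (g.map_smul k _).symm)

/-- The linear map on singular chains with given values on singular simplices. -/
def chainsLift {n : ℕ} {A : Type*} [AddCommGroup A] [Module ℤ A] (v : C(Simplex n, E) → A) :
    (singularChains E).X n →ₗ[ℤ] A :=
  (Finsupp.linearCombination ℤ v).comp (chainsRepr n)

theorem chainsLift_ofSimplex {n : ℕ} {A : Type*} [AddCommGroup A] [inst : Module ℤ A] (v : C(Simplex n, E) → A)
    (σ : C(Simplex n, E)) : chainsLift v (ofSimplex σ) = v σ := by
  simp only [chainsLift, LinearMap.comp_apply, chainsRepr_ofSimplex,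
    Finsupp.linearCombination_single]
  exact @one_smul ℤ A _ inst.toMulAction _

/-- Integer multiples come from sums and negatives, so the cases mention only the additive group,
and the choice of a `ℤ`-module structure stays hidden here. -/
theorem chains_induction {n : ℕ} {p : (singularChains E).X n → Prop}
    (c : (singularChains E).X n) (zero : p 0) (add : ∀ a b, p a → p b → p (a + b))
    (neg : ∀ a, p a → p (-a)) (simplex : ∀ σ, p (ofSimplex σ)) : p c := by
  let S : AddSubgroup ((singularChains E).X n) :=
    { carrier := {a | p a}
      add_mem' := add _ _
      zero_mem' := zero
      neg_mem' := neg _ }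
  rw [← linearCombination_chainsRepr c]
  induction chainsRepr n c using Finsupp.induction_linear with
  | zero => simpa using zero
  | add a b ha hb => simpa only [map_add] using add _ _ ha hb
  | single σ k =>
    rw [Finsupp.linearCombination_single]
    have e := S.zsmul_mem (x := ofSimplex σ) (simplex σ) k
    rwa [← int_smul_eq_zsmul ((singularChains E).X n).isModule] at e

theorem boundary_ofSimplex {n : ℕ} (σ : C(Simplex (n + 1), E)) :
    boundary E (n + 1) n (ofSimplex σ) =
      ∑ i : Fin (n + 2), (-1 : ℤ) ^ (i : ℕ) • ofSimplex (σ.comp (faceMap i)) := by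
  have h := SSet.ιChainComplex_d (X := TopCat.toSSet.obj (TopCat.of E))
    (R := ModuleCat.of ℤ (ULift.{u} ℤ)) ((TopCat.toSSetObjEquiv (TopCat.of E) (op ⦋n+1⦌)).symm σ)
  have h2 := congrArg (fun f => f.hom ⟨1⟩) h
  refine h2.trans ?_
  simp
  rfl

theorem chainsMap_ofSimplex {n : ℕ} (f : C(E, F)) (σ : C(Simplex n, E)) :
    chainsMap f n (ofSimplex σ) = ofSimplex (f.comp σ) := by
  have h := SSet.ι_chainComplexMap_f (f := TopCat.toSSet.map (TopCat.ofHom f))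
    (R := ModuleCat.of ℤ (ULift.{u} ℤ)) (x := (TopCat.toSSetObjEquiv (TopCat.of E) (op ⦋n⦌)).symm σ)
  exact congrArg (fun f => f.hom ⟨1⟩) h

end SingularSimplices

/-! ### Affine chains -/

section AffineChains

/-- The module of formal combinations of `m`-tuples of points of `K`; an `m`-tuple is thought of as
an affine `(m - 1)`-simplex. -/
abbrev AffineChains (K : Type*) (m : ℕ) : Type _ := (Fin m → K) →₀ ℤ

variable {K K' : Type*}

/-- The simplex on a tuple of vertices. -/
abbrev tuple {m : ℕ} (x : Fin m → K) : AffineChains K m := Finsupp.single x 1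

theorem affine_hom_ext {m : ℕ} {A : Type*} [AddCommGroup A] [Module ℤ A]
    {f g : AffineChains K m →ₗ[ℤ] A} (h : ∀ x, f (tuple x) = g (tuple x)) : f = g :=
  Finsupp.lhom_ext' fun x => LinearMap.ext_ring (h x)

/-- The augmented boundary map of affine chains. -/
def affineBoundary (K : Type*) (m : ℕ) : AffineChains K (m + 1) →ₗ[ℤ] AffineChains K m :=
  ∑ i : Fin (m + 1), (-1 : ℤ) ^ (i : ℕ) • Finsupp.lmapDomain ℤ ℤ (fun x => i.removeNth x)

theorem affineBoundary_tuple {m : ℕ} (x : Fin (m + 1) → K) :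
    affineBoundary K m (tuple x) =
      ∑ i : Fin (m + 1), (-1 : ℤ) ^ (i : ℕ) • tuple (i.removeNth x) := by
  simp [affineBoundary, Finsupp.mapDomain_single]

/-- The cone with apex `b`. -/
def cone (b : K) (m : ℕ) : AffineChains K m →ₗ[ℤ] AffineChains K (m + 1) :=
  Finsupp.lmapDomain ℤ ℤ (fun x => Fin.cons b x)

theorem cone_tuple (b : K) {m : ℕ} (x : Fin m → K) : cone b m (tuple x) = tuple (Fin.cons b x) := by
  simp [cone, Finsupp.mapDomain_single]

/-- The face opposite the apex is `c`; every other face is the cone over a face of `c` with index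
raised by one, whence the minus sign. -/
theorem affineBoundary_cone (b : K) {m : ℕ} (c : AffineChains K (m + 1)) :
    affineBoundary K (m + 1) (cone b (m + 1) c) = c - cone b m (affineBoundary K m c) := by
  suffices h : affineBoundary K (m + 1) ∘ₗ cone b (m + 1) =
      LinearMap.id - cone b m ∘ₗ affineBoundary K m from LinearMap.congr_fun h c
  refine affine_hom_ext fun x => ?_
  simp only [LinearMap.comp_apply, LinearMap.sub_apply, LinearMap.id_apply, cone_tuple,
    affineBoundary_tuple, map_sum, map_smul]
  rw [Fin.sum_univ_succ]
  have h (i : Fin (m + 1)) : i.succ.removeNth (Fin.cons b x : Fin (m + 2) → K) =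
      (Fin.cons b (i.removeNth x) : Fin (m + 1) → K) := by
    ext j
    refine Fin.cases ?_ (fun j => ?_) j
    · simp [Fin.removeNth]
    · simp [Fin.removeNth, Fin.succ_succAbove_succ]
  simp only [h, Fin.removeNth_zero, Fin.tail_cons, Fin.val_zero, pow_zero, one_smul,
    Fin.val_succ, pow_succ, mul_neg, mul_one, neg_smul, Finset.sum_neg_distrib, sub_eq_add_neg]

theorem affineBoundary_cone_zero (b : K) (c : AffineChains K 0) :
    affineBoundary K 0 (cone b 0 c) = c := by
  suffices h : affineBoundary K 0 ∘ₗ cone b 0 = LinearMap.id from LinearMap.congr_fun h c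
  refine affine_hom_ext fun x => ?_
  simp only [LinearMap.comp_apply, cone_tuple, affineBoundary_tuple, LinearMap.id_apply]
  simp [Subsingleton.elim _ x]

/-- A tuple is the cone from its first vertex over the others, so the cone formula reduces the claim
to tuples with one vertex less, without a double sum over pairs of faces. -/
theorem affineBoundary_affineBoundary {m : ℕ} (c : AffineChains K (m + 2)) :
    affineBoundary K m (affineBoundary K (m + 1) c) = 0 := by
  suffices h : affineBoundary K m ∘ₗ affineBoundary K (m + 1) = 0 from LinearMap.congr_fun h c
  induction m with
  | zero =>
    refine affine_hom_ext fun x => ?_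
    rw [LinearMap.comp_apply, ← Fin.cons_self_tail x, ← cone_tuple, affineBoundary_cone, map_sub,
      affineBoundary_cone_zero, sub_self, LinearMap.zero_apply]
  | succ m ih =>
    refine affine_hom_ext fun x => ?_
    -- The induction hypothesis still quantifies over the chain `c`, on which the identity of
    -- operators does not depend; `0` is a dummy value, here and in the similar inductions below.
    have h := LinearMap.congr_fun (ih 0) (tuple (Fin.tail x))
    rw [LinearMap.comp_apply] at h
    rw [LinearMap.comp_apply, ← Fin.cons_self_tail x, ← cone_tuple, affineBoundary_cone, map_sub,
      affineBoundary_cone, h, LinearMap.zero_apply, map_zero, sub_zero, sub_self,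
      LinearMap.zero_apply]

/-- The map of affine chains induced by a map of vertices. -/
def affineMap (f : K → K') (m : ℕ) : AffineChains K m →ₗ[ℤ] AffineChains K' m :=
  Finsupp.lmapDomain ℤ ℤ (fun x => f ∘ x)

theorem affineMap_tuple (f : K → K') {m : ℕ} (x : Fin m → K) :
    affineMap f m (tuple x) = tuple (f ∘ x) := by
  simp [affineMap, Finsupp.mapDomain_single]

theorem affineMap_boundary (f : K → K') {m : ℕ} (c : AffineChains K (m + 1)) :
    affineMap f m (affineBoundary K m c) = affineBoundary K' m (affineMap f (m + 1) c) := by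
  suffices h : affineMap f m ∘ₗ affineBoundary K m = affineBoundary K' m ∘ₗ affineMap f (m + 1)
    from LinearMap.congr_fun h c
  refine affine_hom_ext fun x => ?_
  simp only [LinearMap.comp_apply, affineMap_tuple, affineBoundary_tuple, map_sum, map_smul]
  rfl

theorem affineMap_cone (f : K → K') (b : K) {m : ℕ} (c : AffineChains K m) :
    affineMap f (m + 1) (cone b m c) = cone (f b) m (affineMap f m c) := by
  suffices h : affineMap f (m + 1) ∘ₗ cone b m = cone (f b) m ∘ₗ affineMap f m
    from LinearMap.congr_fun h c
  refine affine_hom_ext fun x => ?_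
  simp only [LinearMap.comp_apply, affineMap_tuple, cone_tuple, Fin.comp_cons]

/-! #### Subdivision -/

variable (b : ∀ m : ℕ, (Fin (m + 1) → K) → K)

/-- The subdivision operator: `[x] ↦ b(x) · Sd ∂[x]`, for a choice of "centres" `b`. -/
def affineSd : ∀ m : ℕ, AffineChains K m →ₗ[ℤ] AffineChains K m
  | 0 => LinearMap.id
  | m + 1 => Finsupp.linearCombination ℤ fun x =>
      cone (b m x) m (affineSd m (affineBoundary K m (tuple x)))

theorem affineSd_tuple {m : ℕ} (x : Fin (m + 1) → K) : affineSd b (m + 1) (tuple x) =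
    cone (b m x) m (affineSd b m (affineBoundary K m (tuple x))) := by
  simp [affineSd]

/-- The homotopy from subdivision to the identity. -/
def affineSdHomotopy : ∀ m : ℕ, AffineChains K m →ₗ[ℤ] AffineChains K (m + 1)
  | 0 => 0
  | m + 1 => Finsupp.linearCombination ℤ fun x =>
      cone (b m x) (m + 1) (tuple x - affineSdHomotopy m (affineBoundary K m (tuple x)))

theorem affineSdHomotopy_tuple {m : ℕ} (x : Fin (m + 1) → K) :
    affineSdHomotopy b (m + 1) (tuple x) = cone (b m x) (m + 1)
      (tuple x - affineSdHomotopy b m (affineBoundary K m (tuple x))) := by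
  simp [affineSdHomotopy]

/-- Write `T` for the homotopy. By the cone formula `∂T[x] = [x] - T∂[x] - b(x) · ∂([x] - T∂[x])`.
By induction `∂T∂[x] = ∂[x] - Sd ∂[x]`, so the last cone is `b(x) · Sd ∂[x] = Sd [x]`. -/
theorem affineBoundary_affineSdHomotopy {m : ℕ} (c : AffineChains K (m + 1)) :
    affineBoundary K (m + 1) (affineSdHomotopy b (m + 1) c) =
      c - affineSd b (m + 1) c - affineSdHomotopy b m (affineBoundary K m c) := by
  suffices h : affineBoundary K (m + 1) ∘ₗ affineSdHomotopy b (m + 1) =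
      LinearMap.id - affineSd b (m + 1) - affineSdHomotopy b m ∘ₗ affineBoundary K m
    from LinearMap.congr_fun h c
  induction m with
  | zero =>
    refine affine_hom_ext fun x => ?_
    simp only [LinearMap.comp_apply, affineSdHomotopy_tuple, affineBoundary_cone, map_sub,
      LinearMap.sub_apply, LinearMap.id_apply, affineSd_tuple]
    simp [affineSdHomotopy, affineSd]
  | succ m ih =>
    refine affine_hom_ext fun x => ?_
    have h := LinearMap.congr_fun (ih 0) (affineBoundary K (m + 1) (tuple x))
    simp only [LinearMap.comp_apply, LinearMap.sub_apply, LinearMap.id_apply,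
      affineBoundary_affineBoundary, map_zero, sub_zero] at h
    simp only [LinearMap.comp_apply, affineSdHomotopy_tuple, affineBoundary_cone, map_sub,
      LinearMap.sub_apply, LinearMap.id_apply, affineSd_tuple, h]
    abel

variable {b} {b' : ∀ m : ℕ, (Fin (m + 1) → K') → K'} {f : K → K'}

theorem affineMap_affineSd (hf : ∀ m x, f (b m x) = b' m (f ∘ x)) {m : ℕ}
    (c : AffineChains K m) : affineMap f m (affineSd b m c) = affineSd b' m (affineMap f m c) := by
  suffices h : affineMap f m ∘ₗ affineSd b m = affineSd b' m ∘ₗ affineMap f m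
    from LinearMap.congr_fun h c
  induction m with
  | zero => rfl
  | succ m ih =>
    refine affine_hom_ext fun x => ?_
    have h := LinearMap.congr_fun (ih 0) (affineBoundary K m (tuple x))
    rw [LinearMap.comp_apply, LinearMap.comp_apply, affineMap_boundary, affineMap_tuple] at h
    rw [LinearMap.comp_apply, affineSd_tuple, affineMap_cone, h, LinearMap.comp_apply,
      affineMap_tuple, affineSd_tuple, hf]

theorem affineMap_affineSdHomotopy (hf : ∀ m x, f (b m x) = b' m (f ∘ x)) {m : ℕ}
    (c : AffineChains K m) : affineMap f (m + 1) (affineSdHomotopy b m c) =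
      affineSdHomotopy b' m (affineMap f m c) := by
  suffices h : affineMap f (m + 1) ∘ₗ affineSdHomotopy b m = affineSdHomotopy b' m ∘ₗ affineMap f m
    from LinearMap.congr_fun h c
  induction m with
  | zero => simp [affineSdHomotopy]
  | succ m ih =>
    refine affine_hom_ext fun x => ?_
    have h := LinearMap.congr_fun (ih 0) (affineBoundary K m (tuple x))
    rw [LinearMap.comp_apply, LinearMap.comp_apply, affineMap_boundary, affineMap_tuple] at h
    rw [LinearMap.comp_apply, affineSdHomotopy_tuple, affineMap_cone, map_sub, h,
      LinearMap.comp_apply, affineMap_tuple, affineSdHomotopy_tuple, hf]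

/-! #### Prisms -/

section Prism

variable (i₀ i₁ : K → K')

/-- The prism operator between two maps of vertices. -/
def affinePrism : ∀ m : ℕ, AffineChains K m →ₗ[ℤ] AffineChains K' (m + 1)
  | 0 => 0
  | m + 1 => Finsupp.linearCombination ℤ fun x => cone (i₀ (x 0)) (m + 1)
      (tuple (i₁ ∘ x) - tuple (i₀ ∘ x) - affinePrism m (affineBoundary K m (tuple x)))

theorem affinePrism_tuple {m : ℕ} (x : Fin (m + 1) → K) :
    affinePrism i₀ i₁ (m + 1) (tuple x) = cone (i₀ (x 0)) (m + 1) (tuple (i₁ ∘ x) -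
      tuple (i₀ ∘ x) - affinePrism i₀ i₁ m (affineBoundary K m (tuple x))) := by
  simp [affinePrism]

/-- The chain "top minus bottom minus sides" that is coned off from the first bottom vertex is a
cycle by induction, so the boundary of its cone is the chain itself. The cone over the bottom is
degenerate, which does no harm in unnormalised chains. -/
theorem affineBoundary_affinePrism {m : ℕ} (c : AffineChains K (m + 1)) :
    affineBoundary K' (m + 1) (affinePrism i₀ i₁ (m + 1) c) =
      affineMap i₁ (m + 1) c - affineMap i₀ (m + 1) c -
        affinePrism i₀ i₁ m (affineBoundary K m c) := by
  suffices h : affineBoundary K' (m + 1) ∘ₗ affinePrism i₀ i₁ (m + 1) =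
      affineMap i₁ (m + 1) - affineMap i₀ (m + 1) - affinePrism i₀ i₁ m ∘ₗ affineBoundary K m
    from LinearMap.congr_fun h c
  induction m with
  | zero =>
    refine affine_hom_ext fun x => ?_
    simp only [LinearMap.comp_apply, affinePrism_tuple, affineBoundary_cone, map_sub,
      LinearMap.sub_apply, affineMap_tuple]
    -- In lowest degree the chain to be coned off is a difference of two points, and it is the
    -- augmentation that makes it a cycle.
    have e (f : K → K') : affineBoundary K' 0 (tuple (f ∘ x)) = tuple Fin.elim0 := by
      rw [affineBoundary_tuple]
      simp [Subsingleton.elim _ (Fin.elim0 : Fin 0 → K')]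
    simp [affinePrism, e]
  | succ m ih =>
    refine affine_hom_ext fun x => ?_
    have h := LinearMap.congr_fun (ih 0) (affineBoundary K (m + 1) (tuple x))
    simp only [LinearMap.comp_apply, LinearMap.sub_apply, 
      affineBoundary_affineBoundary, map_zero, sub_zero, affineMap_boundary,
      affineMap_tuple] at h
    simp only [LinearMap.comp_apply, affinePrism_tuple, affineBoundary_cone, map_sub,
      LinearMap.sub_apply, affineMap_tuple, h]
    abel_nf

theorem affineMap_affinePrism {L L' : Type*} {j₀ j₁ : L → L'} {f : K → L} {f' : K' → L'}
    (h₀ : ∀ x, f' (i₀ x) = j₀ (f x)) (h₁ : ∀ x, f' (i₁ x) = j₁ (f x)) {m : ℕ}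
    (c : AffineChains K m) : affineMap f' (m + 1) (affinePrism i₀ i₁ m c) =
      affinePrism j₀ j₁ m (affineMap f m c) := by
  suffices h : affineMap f' (m + 1) ∘ₗ affinePrism i₀ i₁ m = affinePrism j₀ j₁ m ∘ₗ affineMap f m
    from LinearMap.congr_fun h c
  have e₀ : f' ∘ i₀ = j₀ ∘ f := funext h₀
  have e₁ : f' ∘ i₁ = j₁ ∘ f := funext h₁
  induction m with
  | zero => simp [affinePrism]
  | succ m ih =>
    refine affine_hom_ext fun x => ?_
    have h := LinearMap.congr_fun (ih 0) (affineBoundary K m (tuple x))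
    rw [LinearMap.comp_apply, LinearMap.comp_apply, affineMap_boundary, affineMap_tuple] at h
    rw [LinearMap.comp_apply, affinePrism_tuple, affineMap_cone, map_sub (affineMap f' (m + 1)),
      map_sub (affineMap f' (m + 1)), h, LinearMap.comp_apply, affineMap_tuple, affineMap_tuple,
      affineMap_tuple, affinePrism_tuple, h₀, ← Function.comp_assoc, ← Function.comp_assoc, e₀, e₁]
    rfl

end Prism

end AffineChains

/-! ### From affine chains to singular chains -/

/-- Sorting the sum over `X` by the fibres of `f` gives the sum over `Y`. With `f` a face inclusion,
this says that a face of an affine simplex is spanned by the remaining vertices. -/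
theorem sum_map_smul {X Y A : Type*} [Fintype X] [Fintype Y] [AddCommGroup A] [Module ℝ A]
    (f : X → Y) (t : stdSimplex ℝ X) (x : Y → A) :
    ∑ j, stdSimplex.map f t j • x j = ∑ k, t k • x (f k) := by
  classical
  rw [← Finset.sum_fiberwise Finset.univ f (fun k => t k • x (f k))]
  refine Finset.sum_congr rfl fun j _ => ?_
  rw [stdSimplex.map_coe, FunOnFinite.linearMap_apply_apply, Finset.sum_smul]
  refine Finset.sum_congr (by ext; simp) fun k hk => ?_
  rw [(Finset.mem_filter.1 hk).2]

section Realize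

variable {A B : Type*} [AddCommGroup A] [Module ℝ A] [TopologicalSpace A]
  [IsTopologicalAddGroup A] [ContinuousSMul ℝ A] [AddCommGroup B] [Module ℝ B]
  [TopologicalSpace B] [IsTopologicalAddGroup B] [ContinuousSMul ℝ B]
variable {K : Set A} (hK : Convex ℝ K) {K' : Set B} (hK' : Convex ℝ K')

/-- The affine combinations of points of a convex set. -/
def affineComb {m : ℕ} (x : Fin m → K) (t : stdSimplex ℝ (Fin m)) : K :=
  ⟨∑ i, t i • (x i : A), hK.sum_mem (fun i _ => t.2.1 i) t.2.2 fun i _ => (x i).2⟩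

/-- The affine simplex with given vertices. -/
def affineSimplex {n : ℕ} (x : Fin (n + 1) → K) : C(Simplex n, K) where
  toFun := affineComb hK x
  continuous_toFun := by
    refine Continuous.subtype_mk (continuous_finsetSum _ fun i _ => ?_) _
    exact ((continuous_apply i).comp continuous_subtype_val).smul continuous_const

theorem affineSimplex_face {n : ℕ} (x : Fin (n + 2) → K) (i : Fin (n + 2)) :
    (affineSimplex hK x).comp (faceMap i) = affineSimplex hK (i.removeNth x) := by
  ext t
  exact sum_map_smul i.succAbove t fun j => (x j : A)

/-- `f` commutes with affine combinations. -/
def IsAffineOn (f : K → K') : Prop :=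
  ∀ (m : ℕ) (x : Fin m → K) (t : stdSimplex ℝ (Fin m)),
    f (affineComb hK x t) = affineComb hK' (f ∘ x) t

/-- The barycentre of a tuple of points. -/
def bary (m : ℕ) (x : Fin (m + 1) → K) : K := affineComb hK x stdSimplex.barycenter

variable {E : Type u} [TopologicalSpace E] {F : Type u} [TopologicalSpace F]

/-- The singular chain that a map `K → E` makes of an affine chain of `K`. -/
def realize (σ : C(K, E)) (n : ℕ) : AffineChains K (n + 1) →ₗ[ℤ] (singularChains E).X n :=
  Finsupp.linearCombination ℤ fun x => ofSimplex (σ.comp (affineSimplex hK x))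

theorem realize_tuple (σ : C(K, E)) {n : ℕ} (x : Fin (n + 1) → K) :
    realize hK σ n (tuple x) = ofSimplex (σ.comp (affineSimplex hK x)) := by
  rw [realize, Finsupp.linearCombination_single]
  exact @one_smul ℤ _ _ ((singularChains E).X n).isModule.toMulAction _

theorem boundary_realize (σ : C(K, E)) {n : ℕ} (c : AffineChains K (n + 2)) :
    boundary E (n + 1) n (realize hK σ (n + 1) c) =
      realize hK σ n (affineBoundary K (n + 1) c) := by
  suffices h : boundary E (n + 1) n ∘ₗ realize hK σ (n + 1) =
      realize hK σ n ∘ₗ affineBoundary K (n + 1) from LinearMap.congr_fun h c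
  refine affine_hom_ext fun x => ?_
  simp only [LinearMap.comp_apply, realize_tuple, boundary_ofSimplex, affineBoundary_tuple,
    map_sum, map_zsmul, ContinuousMap.comp_assoc, affineSimplex_face]

theorem chainsMap_realize (f : C(E, F)) (σ : C(K, E)) {n : ℕ} (c : AffineChains K (n + 1)) :
    chainsMap f n (realize hK σ n c) = realize hK (f.comp σ) n c := by
  suffices h : chainsMap f n ∘ₗ realize hK σ n = realize hK (f.comp σ) n
    from LinearMap.congr_fun h c
  refine affine_hom_ext fun x => ?_
  simp only [LinearMap.comp_apply, realize_tuple, chainsMap_ofSimplex, ContinuousMap.comp_assoc]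

theorem realize_comp (σ : C(K', E)) (g : C(K, K')) (hg : IsAffineOn hK hK' g) {n : ℕ}
    (c : AffineChains K (n + 1)) :
    realize hK (σ.comp g) n c = realize hK' σ n (affineMap g (n + 1) c) := by
  suffices h : realize hK (σ.comp g) n = realize hK' σ n ∘ₗ affineMap g (n + 1)
    from LinearMap.congr_fun h c
  refine affine_hom_ext fun x => ?_
  have e : g.comp (affineSimplex hK x) = affineSimplex hK' (g ∘ x) :=
    ContinuousMap.ext fun t => hg _ x t
  simp only [LinearMap.comp_apply, realize_tuple, affineMap_tuple, ContinuousMap.comp_assoc, e]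

end Realize

/-! ### Barycentric subdivision of singular chains. -/

section Simplices

variable {E : Type u} [TopologicalSpace E] {F : Type u} [TopologicalSpace F]

theorem convex_simplex (n : ℕ) : Convex ℝ (stdSimplex ℝ (Fin (n + 1))) :=
  convex_stdSimplex ℝ _

/-- The tuple of vertices of the standard simplex. -/
def vertices (n : ℕ) (i : Fin (n + 1)) : Simplex n := stdSimplex.vertex i

theorem affineSimplex_vertices (n : ℕ) :
    affineSimplex (convex_simplex n) (vertices n) = ContinuousMap.id _ := by
  ext t i
  change (∑ j, t j • (Pi.single j (1 : ℝ) : Fin (n + 1) → ℝ)) i = t i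
  simp [Finset.sum_apply, Pi.single_apply]

theorem faceMap_vertices {n : ℕ} (i : Fin (n + 2)) :
    faceMap i ∘ vertices n = i.removeNth (vertices (n + 1)) := by
  funext j
  exact stdSimplex.map_vertex _ _

theorem isAffineOn_faceMap {n : ℕ} (i : Fin (n + 2)) :
    IsAffineOn (convex_simplex n) (convex_simplex (n + 1)) (faceMap i) := by
  intro m x t
  refine Subtype.ext ?_
  change FunOnFinite.linearMap ℝ ℝ i.succAbove (∑ j, t j • ((x j : Simplex n) : Fin (n + 1) → ℝ)) =
    ∑ j, t j • FunOnFinite.linearMap ℝ ℝ i.succAbove (x j)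
  simp only [map_sum, map_smul]

/-- Subdivision of singular chains. -/
def subdivision (E : Type u) [TopologicalSpace E] (n : ℕ) :
    (singularChains E).X n →ₗ[ℤ] (singularChains E).X n :=
  chainsLift fun σ => realize (convex_simplex n) σ n
    (affineSd (bary (convex_simplex n)) (n + 1) (tuple (vertices n)))

/-- The natural homotopy from subdivision to the identity. -/
def subdivisionHomotopy (E : Type u) [TopologicalSpace E] (n : ℕ) :
    (singularChains E).X n →ₗ[ℤ] (singularChains E).X (n + 1) :=
  chainsLift fun σ => realize (convex_simplex n) σ (n + 1)
    (affineSdHomotopy (bary (convex_simplex n)) (n + 1) (tuple (vertices n)))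

/-- Both sides realise one universal affine chain of the standard simplex. Naturality under deck
transformations is what lets subdivision, and below its homotopy, act on twisted chains. -/
theorem chainsMap_subdivision (f : C(E, F)) (n : ℕ) (c : (singularChains E).X n) :
    chainsMap f n (subdivision E n c) = subdivision F n (chainsMap f n c) := by
  suffices h : chainsMap f n ∘ₗ subdivision E n = subdivision F n ∘ₗ chainsMap f n
    from LinearMap.congr_fun h c
  refine chains_hom_ext fun σ => ?_
  simp only [LinearMap.comp_apply, subdivision, chainsLift_ofSimplex, chainsMap_ofSimplex,
    chainsMap_realize]

theorem chainsMap_subdivisionHomotopy (f : C(E, F)) (n : ℕ) (c : (singularChains E).X n) :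
    chainsMap f (n + 1) (subdivisionHomotopy E n c) =
      subdivisionHomotopy F n (chainsMap f n c) := by
  suffices h : chainsMap f (n + 1) ∘ₗ subdivisionHomotopy E n =
      subdivisionHomotopy F n ∘ₗ chainsMap f n from LinearMap.congr_fun h c
  refine chains_hom_ext fun σ => ?_
  simp only [LinearMap.comp_apply, subdivisionHomotopy, chainsLift_ofSimplex, chainsMap_ofSimplex,
    chainsMap_realize]

theorem faceMap_bary {n : ℕ} (i : Fin (n + 2)) (m : ℕ) (x : Fin (m + 1) → Simplex n) :
    faceMap i (bary (convex_simplex n) m x) = bary (convex_simplex (n + 1)) m (faceMap i ∘ x) :=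
  isAffineOn_faceMap i _ x _

theorem boundary_subdivisionHomotopy_succ (n : ℕ) (c : (singularChains E).X (n + 1)) :
    boundary E (n + 2) (n + 1) (subdivisionHomotopy E (n + 1) c) =
      c - subdivision E (n + 1) c - subdivisionHomotopy E n (boundary E (n + 1) n c) := by
  suffices h : boundary E (n + 2) (n + 1) ∘ₗ subdivisionHomotopy E (n + 1) =
      LinearMap.id - subdivision E (n + 1) - subdivisionHomotopy E n ∘ₗ boundary E (n + 1) n
    from LinearMap.congr_fun h c
  refine chains_hom_ext fun σ => ?_
  -- The face inclusion preserves barycentres, so the homotopy of the `i`-th face of `σ` can be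
  -- computed inside the simplex of `σ`.
  have h (i : Fin (n + 2)) : realize (convex_simplex n) (σ.comp (faceMap i)) (n + 1)
      (affineSdHomotopy (bary (convex_simplex n)) (n + 1) (tuple (vertices n))) =
      realize (convex_simplex (n + 1)) σ (n + 1) (affineSdHomotopy (bary (convex_simplex (n + 1)))
        (n + 1) (tuple (i.removeNth (vertices (n + 1))))) := by
    rw [realize_comp (convex_simplex n) (convex_simplex (n + 1)) _ _ (isAffineOn_faceMap i),
      affineMap_affineSdHomotopy (faceMap_bary i), affineMap_tuple, faceMap_vertices]
  simp only [LinearMap.comp_apply, LinearMap.sub_apply, LinearMap.id_apply, subdivision,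
    subdivisionHomotopy, chainsLift_ofSimplex, boundary_realize, affineBoundary_affineSdHomotopy,
    map_sub, boundary_ofSimplex, map_sum, map_zsmul, realize_tuple, affineSimplex_vertices,
    ContinuousMap.comp_id, h, affineBoundary_tuple]

theorem boundary_subdivisionHomotopy_zero (c : (singularChains E).X 0) :
    boundary E 1 0 (subdivisionHomotopy E 0 c) = c - subdivision E 0 c := by
  suffices h : boundary E 1 0 ∘ₗ subdivisionHomotopy E 0 = LinearMap.id - subdivision E 0
    from LinearMap.congr_fun h c
  refine chains_hom_ext fun σ => ?_
  simp only [LinearMap.comp_apply, LinearMap.sub_apply, LinearMap.id_apply, subdivision,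
    subdivisionHomotopy, chainsLift_ofSimplex, boundary_realize, affineBoundary_affineSdHomotopy,
    map_sub, realize_tuple, affineSimplex_vertices, ContinuousMap.comp_id]
  simp [affineSdHomotopy]

end Simplices

/-! ### Iterated subdivisions become small -/

section Mesh

variable {E : Type u} [TopologicalSpace E]

variable {A : Type*} [NormedAddCommGroup A] [NormedSpace ℝ A] {K : Set A} (hK : Convex ℝ K)

theorem dist_affineComb_le {m : ℕ} {x : Fin m → K} {z : K} {r : ℝ} (h : ∀ i, dist z (x i) ≤ r)
    (t : stdSimplex ℝ (Fin m)) : dist z (affineComb hK x t) ≤ r := by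
  have h' : ∀ i ∈ Finset.univ, (x i : A) ∈ Metric.closedBall (z : A) r := fun i _ => by
    rw [Metric.mem_closedBall, dist_comm]
    exact h i
  have := (convex_closedBall (z : A) r).sum_mem (fun i _ => t.2.1 i) t.2.2 h'
  rw [Metric.mem_closedBall, dist_comm] at this
  exact this

theorem dist_affineComb_affineComb_le {m : ℕ} {x : Fin m → K} {r : ℝ}
    (h : ∀ i j, dist (x i) (x j) ≤ r) (s t : stdSimplex ℝ (Fin m)) :
    dist (affineComb hK x s) (affineComb hK x t) ≤ r := by
  refine dist_affineComb_le hK (fun i => ?_) t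
  rw [dist_comm]
  exact dist_affineComb_le hK (h i) s

/-- The vector from `x k` to the barycentre is the average of the `m + 1` vectors `x i - x k`, of
which the one with `i = k` vanishes; hence the factor `m / (m + 1)`. It is weakened to `n / (n + 1)`
to serve all faces of an `n`-simplex at once. -/
theorem dist_bary_le {m n : ℕ} (hmn : m ≤ n) {x : Fin (m + 1) → K} {r : ℝ} (hr : 0 ≤ r)
    (h : ∀ i j, dist (x i) (x j) ≤ r) (k : Fin (m + 1)) :
    dist (bary hK m x) (x k) ≤ n / (n + 1) * r := by
  have hm : (0 : ℝ) < m + 1 := by positivity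
  have e : (bary hK m x : A) - x k = ∑ i ∈ Finset.univ.erase k, ((m : ℝ) + 1)⁻¹ • ((x i : A) - x k) := by
    have e1 : (bary hK m x : A) = ∑ i, ((m : ℝ) + 1)⁻¹ • (x i : A) := by
      change ∑ i, (stdSimplex.barycenter : stdSimplex ℝ (Fin (m + 1))) i • (x i : A) = _
      refine Finset.sum_congr rfl fun i _ => ?_
      refine congrArg (fun a : ℝ => a • (x i : A)) ((stdSimplex.barycenter_apply i).trans ?_)
      rw [Fintype.card_fin]
      push_cast
      rfl
    have e2 : ∑ i : Fin (m + 1), ((m : ℝ) + 1)⁻¹ • ((x i : A) - x k) = (bary hK m x : A) - x k := by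
      rw [e1]
      simp only [smul_sub, Finset.sum_sub_distrib]
      congr 1
      rw [Finset.sum_const, Finset.card_univ, Fintype.card_fin, ← Nat.cast_smul_eq_nsmul ℝ,
        smul_smul]
      push_cast
      rw [mul_inv_cancel₀ hm.ne', one_smul]
    rw [← e2, ← Finset.add_sum_erase _ _ (Finset.mem_univ k)]
    simp
  have h1 : dist (bary hK m x) (x k) ≤ m / (m + 1) * r := by
    rw [Subtype.dist_eq, dist_eq_norm, e]
    refine (norm_sum_le_of_le _ (f := fun i => ((m : ℝ) + 1)⁻¹ • ((x i : A) - x k))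
      (n := fun _ => ((m : ℝ) + 1)⁻¹ * r) fun i _ => ?_).trans ?_
    · rw [norm_smul, Real.norm_of_nonneg (by positivity)]
      gcongr
      rw [← dist_eq_norm]
      exact h i k
    · simp
      apply le_of_eq
      ring
  refine h1.trans (mul_le_mul_of_nonneg_right ?_ hr)
  rw [div_le_div_iff₀ hm (by positivity)]
  have : (m : ℝ) ≤ n := by exact_mod_cast hmn
  nlinarith

/-- The affine chains all of whose simplices have diameter at most `r`. -/
def fineChains (K : Set A) (m : ℕ) (r : ℝ) : Submodule ℤ (AffineChains K m) :=
  Finsupp.supported ℤ ℤ {y | ∀ i j, dist (y i) (y j) ≤ r}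

/-- The second property, that every closed ball containing the old vertices contains the new ones,
is there for the induction: applied to the ball about the barycentre of `x`, it bounds the distance
from the new apex to the vertices of the subdivided faces. -/
theorem affineSd_tuple_fine {n : ℕ} {r : ℝ} (hr : 0 ≤ r) : ∀ {m : ℕ} (_ : m ≤ n + 1)
    {x : Fin m → K} (_ : ∀ i j, dist (x i) (x j) ≤ r),
    affineSd (bary hK) m (tuple x) ∈ Finsupp.supported ℤ ℤ {y : Fin m → K |
      (∀ i j, dist (y i) (y j) ≤ n / (n + 1) * r) ∧
      ∀ (z : K) (r' : ℝ), (∀ i, dist z (x i) ≤ r') → ∀ i, dist z (y i) ≤ r'}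
  | 0, _, x, _ => by
    refine Finsupp.single_mem_supported ℤ 1 ⟨fun i => i.elim0, fun z r' _ i => i.elim0⟩
  | m + 1, hm, x, hx => by
    rw [affineSd_tuple, affineBoundary_tuple, map_sum, map_sum]
    refine Submodule.sum_mem _ fun k _ => ?_
    rw [map_smul, map_smul]
    refine Submodule.smul_mem _ _ ?_
    have ih := affineSd_tuple_fine (n := n) hr (m := m) (by omega)
      (x := k.removeNth x) (fun i j => hx _ _)
    generalize affineSd (bary hK) m (tuple (k.removeNth x)) = c at ih
    suffices hle : Finsupp.supported ℤ ℤ _ ≤ (Finsupp.supported ℤ ℤ _).comap (cone _ m) from hle ih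
    rw [Finsupp.supported_eq_span_single, Submodule.span_le]
    rintro _ ⟨y, ⟨hy1, hy2⟩, rfl⟩
    rw [SetLike.mem_coe, Submodule.mem_comap, cone_tuple]
    have hb (i : Fin m) : dist (bary hK m x) (y i) ≤ n / (n + 1) * r :=
      hy2 _ _ (fun j => dist_bary_le hK (Nat.le_of_succ_le_succ hm) hr hx _) i
    refine Finsupp.single_mem_supported ℤ 1 ⟨fun i j => ?_, fun z r' hz i => ?_⟩
    · have h0 : 0 ≤ (n / (n + 1) * r : ℝ) := by positivity
      refine Fin.cases ?_ (fun i => ?_) i <;> refine Fin.cases ?_ (fun j => ?_) j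
      · simpa using h0
      · simpa using hb j
      · simpa [dist_comm] using hb i
      · simpa using hy1 i j
    · refine Fin.cases ?_ (fun i => ?_) i
      · exact dist_affineComb_le hK hz _
      · simpa using hy2 z r' (fun j => hz _) i

theorem affineSd_mem_fineChains {n : ℕ} {r : ℝ} (hr : 0 ≤ r) {c : AffineChains K (n + 1)}
    (hc : c ∈ fineChains K (n + 1) r) :
    affineSd (bary hK) (n + 1) c ∈ fineChains K (n + 1) (n / (n + 1) * r) := by
  suffices hle : fineChains K (n + 1) r ≤
    (fineChains K (n + 1) (n / (n + 1) * r)).comap (affineSd (bary hK) (n + 1)) from hle hc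
  rw [fineChains, Finsupp.supported_eq_span_single, Submodule.span_le]
  rintro _ ⟨y, hy, rfl⟩
  exact Finsupp.supported_mono (fun y hy => hy.1) (affineSd_tuple_fine hK hr le_rfl hy)

theorem isAffineOn_affineSimplex {n : ℕ} (x : Fin (n + 1) → K) :
    IsAffineOn (convex_simplex n) hK (affineSimplex hK x) := by
  intro m y t
  refine Subtype.ext ?_
  change ∑ i, (∑ j, t j • ((y j : Simplex n) : Fin (n + 1) → ℝ)) i • (x i : A) =
    ∑ j, t j • ∑ i, (y j) i • (x i : A)
  simp only [Finset.sum_apply, Pi.smul_apply, Finset.sum_smul, Finset.smul_sum, smul_eq_mul,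
    mul_smul]
  exact Finset.sum_comm

theorem affineSimplex_comp_vertices {n : ℕ} (x : Fin (n + 1) → K) :
    affineSimplex hK x ∘ vertices n = x := by
  funext i
  refine Subtype.ext ?_
  change ∑ j, (Pi.single i (1 : ℝ) : Fin (n + 1) → ℝ) j • (x j : A) = x i
  simp [Pi.single_apply]

/-- An affine simplex carries barycentres to barycentres. Thus iterating singular subdivision on `σ`
amounts to iterating affine subdivision on the standard simplex, where diameters can be measured. -/
theorem subdivision_realize (σ : C(K, E)) {n : ℕ} (c : AffineChains K (n + 1)) :
    subdivision E n (realize hK σ n c) = realize hK σ n (affineSd (bary hK) (n + 1) c) := by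
  suffices h : subdivision E n ∘ₗ realize hK σ n = realize hK σ n ∘ₗ affineSd (bary hK) (n + 1)
    from LinearMap.congr_fun h c
  refine affine_hom_ext fun x => ?_
  rw [LinearMap.comp_apply, realize_tuple, subdivision, chainsLift_ofSimplex,
    realize_comp _ hK _ _ (isAffineOn_affineSimplex hK x),
    affineMap_affineSd (b := bary (convex_simplex n)) (b' := bary hK) (fun m y => isAffineOn_affineSimplex hK x _ y _), affineMap_tuple,
    affineSimplex_comp_vertices, LinearMap.comp_apply]

/-- The additive subgroup of `C_n(E)` generated by the simplices with property `P`. -/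
def chainsSpan {n : ℕ} (P : C(Simplex n, E) → Prop) : AddSubgroup ((singularChains E).X n) :=
  AddSubgroup.closure {c | ∃ σ, P σ ∧ c = ofSimplex σ}

theorem realize_mem_chainsSpan {n : ℕ} (σ : C(K, E)) {r : ℝ} {P : C(Simplex n, E) → Prop}
    (hP : ∀ x : Fin (n + 1) → K, (∀ i j, dist (x i) (x j) ≤ r) → P (σ.comp (affineSimplex hK x)))
    {c : AffineChains K (n + 1)} (hc : c ∈ fineChains K (n + 1) r) :
    realize hK σ n c ∈ chainsSpan P := by
  rw [fineChains, Finsupp.supported_eq_span_single] at hc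
  induction hc using Submodule.span_induction with
  | mem c hc =>
    obtain ⟨x, hx, rfl⟩ := hc
    rw [realize_tuple]
    exact AddSubgroup.subset_closure ⟨_, hP x hx, rfl⟩
  | zero => rw [map_zero]; exact AddSubgroup.zero_mem _
  | add a b _ _ ha hb => rw [map_add]; exact AddSubgroup.add_mem _ ha hb
  | smul k a _ ha => rw [map_zsmul]; exact AddSubgroup.zsmul_mem _ ha k

/-- The conclusion is asked for all large `k`, not for one `k`, so that it passes to sums. -/
theorem exists_subdivision_pow_small {Y : Type*} [PseudoMetricSpace Y] (p : C(E, Y)) {ε : ℝ}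
    (hε : 0 < ε) {n : ℕ} (c : (singularChains E).X n) : ∃ k₀ : ℕ, ∀ k ≥ k₀,
      (subdivision E n)^[k] c ∈
        chainsSpan (fun σ : C(Simplex n, E) => ∀ s t, dist (p (σ s)) (p (σ t)) < ε) := by
  induction c using chains_induction with
  | zero =>
    refine ⟨0, fun k _ => ?_⟩
    rw [iterate_map_zero]
    exact AddSubgroup.zero_mem _
  | add a b ha hb =>
    obtain ⟨i, hi⟩ := ha
    obtain ⟨j, hj⟩ := hb
    refine ⟨max i j, fun k hk => ?_⟩
    rw [iterate_map_add]
    exact AddSubgroup.add_mem _ (hi k (le_of_max_le_left hk)) (hj k (le_of_max_le_right hk))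
  | neg a ha =>
    obtain ⟨i, hi⟩ := ha
    refine ⟨i, fun k hk => ?_⟩
    rw [iterate_map_neg]
    exact AddSubgroup.neg_mem _ (hi k hk)
  | simplex σ =>
    have e (k : ℕ) : (subdivision E n)^[k] (ofSimplex σ) = realize (convex_simplex n) σ n
        ((affineSd (bary (convex_simplex n)) (n + 1))^[k] (tuple (vertices n))) := by
      induction k with
      | zero => rw [Function.iterate_zero_apply, Function.iterate_zero_apply, realize_tuple,
          affineSimplex_vertices, ContinuousMap.comp_id]
      | succ k ih => rw [Function.iterate_succ_apply', ih, subdivision_realize,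
          Function.iterate_succ_apply']
    have e' (k : ℕ) : (affineSd (bary (convex_simplex n)) (n + 1))^[k] (tuple (vertices n)) ∈
        fineChains (stdSimplex ℝ (Fin (n + 1))) (n + 1) ((n / (n + 1) : ℝ) ^ k * 1) := by
      induction k with
      | zero =>
        -- The initial bound `1` is the diameter of the standard simplex in the sup metric.
        refine Finsupp.single_mem_supported ℤ 1 fun i j => ?_
        rw [pow_zero, one_mul]
        exact (Metric.dist_le_diam_of_mem (bounded_stdSimplex _) (vertices n i).2
          (vertices n j).2).trans (diam_stdSimplex_le)
      | succ k ih =>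
        rw [Function.iterate_succ_apply', pow_succ', mul_assoc]
        exact affineSd_mem_fineChains _ (by positivity) ih
    -- The simplex is compact, so `p ∘ σ` is uniformly continuous, and it is enough that the affine
    -- pieces have diameter below `δ`.
    obtain ⟨δ, hδ, h⟩ := Metric.uniformContinuous_iff.1
      (CompactSpace.uniformContinuous_of_continuous (p.comp σ).continuous) ε hε
    obtain ⟨k₀, hk₀⟩ := exists_pow_lt_of_lt_one hδ
      (show (n / (n + 1) : ℝ) < 1 by rw [div_lt_one (by positivity)]; linarith)
    refine ⟨k₀, fun k hk => ?_⟩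
    rw [e]
    refine realize_mem_chainsSpan _ σ (fun x hx s t => h ?_) (e' k)
    refine (dist_affineComb_affineComb_le (convex_simplex n) hx s t).trans_lt ?_
    rw [mul_one]
    refine (pow_le_pow_of_le_one (by positivity) ?_ hk).trans_lt hk₀
    rw [div_le_one (by positivity)]; linarith

end Mesh

/-! ### Prisms -/

section Prisms

variable {E : Type u} [TopologicalSpace E] {F : Type u} [TopologicalSpace F]

/-- The prism over the standard simplex, as a convex set. -/
abbrev prismSet (n : ℕ) : Set (ℝ × (Fin (n + 1) → ℝ)) :=
  Set.Icc (0 : ℝ) 1 ×ˢ stdSimplex ℝ (Fin (n + 1))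

theorem convex_prismSet (n : ℕ) : Convex ℝ (prismSet n) :=
  (convex_Icc _ _).prod (convex_simplex n)

/-- The prism as a product. -/
def prismSplit (n : ℕ) : C(prismSet n, unitInterval × Simplex n) where
  toFun p := (⟨p.1.1, p.2.1⟩, ⟨p.1.2, p.2.2⟩)

/-- The inclusion of a level of the prism. -/
def prismLevel (n : ℕ) (s : unitInterval) (t : Simplex n) : prismSet n := ⟨(s, t), s.2, t.2⟩

/-- The singular chain given by a map of the prism. -/
def prismChain {n : ℕ} (h : C(unitInterval × Simplex n, E)) : (singularChains E).X (n + 1) :=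
  realize (convex_prismSet n) (h.comp (prismSplit n)) (n + 1)
    (affinePrism (prismLevel n 0) (prismLevel n 1) (n + 1) (tuple (vertices n)))

theorem chainsMap_prismChain (f : C(E, F)) {n : ℕ} (h : C(unitInterval × Simplex n, E)) :
    chainsMap f (n + 1) (prismChain h) = prismChain (f.comp h) := by
  simp only [prismChain, chainsMap_realize, ContinuousMap.comp_assoc]

/-- A level of a map of the prism. -/
def level {n : ℕ} (h : C(unitInterval × Simplex n, E)) (s : unitInterval) : C(Simplex n, E) :=
  h.comp ((ContinuousMap.const _ s).prodMk (ContinuousMap.id _))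

/-- A face of a map of the prism. -/
def prismFace {n : ℕ} (h : C(unitInterval × Simplex (n + 1), E)) (i : Fin (n + 2)) : C(unitInterval × Simplex n, E) :=
  h.comp ((ContinuousMap.id _).prodMap (faceMap i))

theorem realize_level {n : ℕ} (h : C(unitInterval × Simplex n, E)) (s : unitInterval) :
    realize (convex_prismSet n) (h.comp (prismSplit n)) n
      (tuple (prismLevel n s ∘ vertices n)) = ofSimplex (level h s) := by
  rw [realize_tuple]
  refine congrArg _ (ContinuousMap.ext fun t => congrArg h ?_)
  have e := congrArg (fun f => ((f t : Simplex n) : Fin (n + 1) → ℝ)) (affineSimplex_vertices n)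
  refine Prod.ext (Subtype.ext ?_) (Subtype.ext ?_)
  · change (∑ i, t i • ((s : ℝ), ((vertices n i : Simplex n) : Fin (n + 1) → ℝ))).1 = s
    simp only [Prod.fst_sum, Prod.smul_fst, smul_eq_mul, ← Finset.sum_mul]
    rw [stdSimplex.sum_eq_one, one_mul]
  · change (∑ i, t i • ((s : ℝ), ((vertices n i : Simplex n) : Fin (n + 1) → ℝ))).2 = t
    simp only [Prod.snd_sum, Prod.smul_snd]
    exact e

theorem realize_prismFace {n : ℕ} (h : C(unitInterval × Simplex (n + 1), E)) (i : Fin (n + 2)) :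
    realize (convex_prismSet (n + 1)) (h.comp (prismSplit (n + 1))) (n + 1)
      (affinePrism (prismLevel (n + 1) 0) (prismLevel (n + 1) 1) (n + 1)
        (tuple (i.removeNth (vertices (n + 1))))) = prismChain (prismFace h i) := by
  -- This is the identity of the interval times the face inclusion; being affine, it transports the
  -- prism over the smaller simplex.
  let g : C(prismSet n, prismSet (n + 1)) :=
    ⟨fun p => ⟨(p.1.1, faceMap i ⟨p.1.2, p.2.2⟩), p.2.1, (faceMap i ⟨p.1.2, p.2.2⟩).2⟩, by fun_prop⟩
  have hg : IsAffineOn (convex_prismSet n) (convex_prismSet (n + 1)) g := by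
    intro m x t
    refine Subtype.ext (Prod.ext ?_ ?_)
    · change (∑ j, t j • (x j : ℝ × (Fin (n + 1) → ℝ))).1 =
        (∑ j, t j • (g (x j) : ℝ × (Fin (n + 2) → ℝ))).1
      simp only [Prod.fst_sum]
      rfl
    · change FunOnFinite.linearMap ℝ ℝ i.succAbove (∑ j, t j • (x j : ℝ × (Fin (n + 1) → ℝ))).2 =
        (∑ j, t j • (g (x j) : ℝ × (Fin (n + 2) → ℝ))).2
      simp only [Prod.snd_sum, map_sum]
      refine Finset.sum_congr rfl fun j _ => ?_
      exact map_smul (FunOnFinite.linearMap ℝ ℝ i.succAbove) _ _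
  have e : (prismFace h i).comp (prismSplit n) = (h.comp (prismSplit (n + 1))).comp g := rfl
  rw [prismChain, e, realize_comp _ (convex_prismSet (n + 1)) _ _ hg,
    affineMap_affinePrism (j₀ := prismLevel (n + 1) 0) (j₁ := prismLevel (n + 1) 1)
      (f := faceMap i) (f' := g) _ _ (fun _ => rfl) (fun _ => rfl), affineMap_tuple, faceMap_vertices]

theorem boundary_prismChain_succ {n : ℕ} (h : C(unitInterval × Simplex (n + 1), E)) :
    boundary E (n + 2) (n + 1) (prismChain h) = ofSimplex (level h 1) - ofSimplex (level h 0) -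
      ∑ i : Fin (n + 2), (-1 : ℤ) ^ (i : ℕ) • prismChain (prismFace h i) := by
  simp only [prismChain, boundary_realize, affineBoundary_affinePrism, map_sub, affineMap_tuple,
    affineBoundary_tuple, map_sum, map_zsmul, realize_prismFace]
  rw [realize_level, realize_level]

theorem boundary_prismChain_zero (h : C(unitInterval × Simplex 0, E)) :
    boundary E 1 0 (prismChain h) = ofSimplex (level h 1) - ofSimplex (level h 0) := by
  simp only [prismChain, boundary_realize, affineBoundary_affinePrism, map_sub, affineMap_tuple]
  rw [realize_level, realize_level]
  simp [affinePrism]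

/-- The chain homotopy given by a homotopy. -/
def homotopyOperator (h : C(unitInterval × E, F)) (n : ℕ) :
    (singularChains E).X n →ₗ[ℤ] (singularChains F).X (n + 1) :=
  chainsLift fun σ => prismChain (h.comp ((ContinuousMap.id _).prodMap σ))

theorem homotopyOperator_ofSimplex (h : C(unitInterval × E, F)) {n : ℕ} (σ : C(Simplex n, E)) :
    homotopyOperator h n (ofSimplex σ) =
      prismChain (h.comp ((ContinuousMap.id _).prodMap σ)) :=
  chainsLift_ofSimplex _ _

theorem boundary_homotopyOperator_succ {f g : C(E, F)} (h : f.Homotopy g) (n : ℕ)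
    (c : (singularChains E).X (n + 1)) :
    boundary F (n + 2) (n + 1) (homotopyOperator h.toContinuousMap (n + 1) c) =
      chainsMap g (n + 1) c - chainsMap f (n + 1) c -
        homotopyOperator h.toContinuousMap n (boundary E (n + 1) n c) := by
  suffices h : boundary F (n + 2) (n + 1) ∘ₗ homotopyOperator h.toContinuousMap (n + 1) =
      chainsMap g (n + 1) - chainsMap f (n + 1) -
        homotopyOperator h.toContinuousMap n ∘ₗ boundary E (n + 1) n from LinearMap.congr_fun h c
  refine chains_hom_ext fun σ => ?_
  have e1 : level (h.toContinuousMap.comp ((ContinuousMap.id _).prodMap σ)) 1 = g.comp σ :=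
    ContinuousMap.ext fun t => h.apply_one _
  have e0 : level (h.toContinuousMap.comp ((ContinuousMap.id _).prodMap σ)) 0 = f.comp σ :=
    ContinuousMap.ext fun t => h.apply_zero _
  simp only [LinearMap.comp_apply, LinearMap.sub_apply, homotopyOperator_ofSimplex,
    boundary_prismChain_succ, chainsMap_ofSimplex, boundary_ofSimplex, map_sum, map_zsmul, e0, e1]
  rfl

theorem boundary_homotopyOperator_zero {f g : C(E, F)} (h : f.Homotopy g)
    (c : (singularChains E).X 0) :
    boundary F 1 0 (homotopyOperator h.toContinuousMap 0 c) =
      chainsMap g 0 c - chainsMap f 0 c := by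
  suffices h : boundary F 1 0 ∘ₗ homotopyOperator h.toContinuousMap 0 =
      chainsMap g 0 - chainsMap f 0 from LinearMap.congr_fun h c
  refine chains_hom_ext fun σ => ?_
  have e1 : level (h.toContinuousMap.comp ((ContinuousMap.id _).prodMap σ)) 1 = g.comp σ :=
    ContinuousMap.ext fun t => h.apply_one _
  have e0 : level (h.toContinuousMap.comp ((ContinuousMap.id _).prodMap σ)) 0 = f.comp σ :=
    ContinuousMap.ext fun t => h.apply_zero _
  simp only [LinearMap.comp_apply, LinearMap.sub_apply, homotopyOperator_ofSimplex,
    boundary_prismChain_zero, chainsMap_ofSimplex, e0, e1]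

end Prisms

/-! ### The universal covering is a covering -/

section Covering

open Topology

variable {Y : Type u} [TopologicalSpace Y] {y₀ : Y}

/-- Every point has an open neighbourhood in which paths with the same end points are homotopic
in the whole space. -/
def SemilocallySimplyConnected (Y : Type*) [TopologicalSpace Y] : Prop :=
  ∀ y : Y, ∃ U : Set Y, IsOpen U ∧ y ∈ U ∧ ∀ (a b : Y) (p q : Path a b),
    (∀ t, p t ∈ U) → (∀ t, q t ∈ U) →
      Path.Homotopic.Quotient.mk p = Path.Homotopic.Quotient.mk q

namespace UniversalCover

theorem sheet_mono (x : UniversalCover Y y₀) {U V : Set Y} (h : U ⊆ V) :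
    x.sheet U ⊆ x.sheet V := fun _ ⟨γ, hγ, e⟩ => ⟨γ, fun t => h (hγ t), e⟩

/-- The topology is only generated by the sheets, but a sheet over `U` contains the sheet over `U`
of each of its points. So the sheets through a point form a neighbourhood basis there. -/
theorem exists_sheet_subset {S : Set (UniversalCover Y y₀)} (hS : IsOpen S)
    {x : UniversalCover Y y₀} (hx : x ∈ S) :
    ∃ U : Set Y, IsOpen U ∧ x.proj ∈ U ∧ x.sheet U ⊆ S := by
  induction hS with
  | basic S hS =>
    obtain ⟨z, U, hU, rfl⟩ := hS
    exact ⟨U, hU, mem_of_mem_sheet hx, sheet_subset hx⟩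
  | univ => exact ⟨Set.univ, isOpen_univ, trivial, fun _ _ => trivial⟩
  | inter S T _ _ hS hT =>
    obtain ⟨U, hU, hxU, h⟩ := hS hx.1
    obtain ⟨V, hV, hxV, h'⟩ := hT hx.2
    exact ⟨U ∩ V, hU.inter hV, ⟨hxU, hxV⟩, Set.subset_inter
      ((x.sheet_mono Set.inter_subset_left).trans h)
      ((x.sheet_mono Set.inter_subset_right).trans h')⟩
  | sUnion C _ ih =>
    obtain ⟨T, hT, hxT⟩ := hx
    obtain ⟨U, hU, hxU, h⟩ := ih T hT hxT
    exact ⟨U, hU, hxU, h.trans (Set.subset_sUnion_of_mem hT)⟩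

theorem continuous_proj : Continuous (proj : UniversalCover Y y₀ → Y) := by
  refine continuous_def.2 fun U hU => isOpen_iff_forall_mem_open.2 fun x hx => ?_
  exact ⟨x.sheet U, fun z hz => mem_of_mem_sheet hz, x.isOpen_sheet hU, x.mem_sheet_self hx⟩

/-- The image of a sheet over `U` contains the path component in `U` of the base point of the sheet,
which is open. -/
theorem isOpenMap_proj [LocallyPathConnectedSpace Y] :
    IsOpenMap (proj : UniversalCover Y y₀ → Y) := by
  intro S hS
  refine isOpen_iff_forall_mem_open.2 ?_
  rintro _ ⟨x, hx, rfl⟩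
  obtain ⟨U, hU, hxU, h⟩ := exists_sheet_subset hS hx
  refine ⟨pathComponentIn U x.proj, ?_, hU.pathComponentIn _, mem_pathComponentIn_self hxU⟩
  rintro y ⟨γ, hγ⟩
  exact ⟨⟨y, x.cls.trans (Path.Homotopic.Quotient.mk γ)⟩, h ⟨γ, hγ, rfl⟩, rfl⟩

theorem proj_surjective [PathConnectedSpace Y] :
    Function.Surjective (proj : UniversalCover Y y₀ → Y) := fun y =>
  ⟨⟨y, Path.Homotopic.Quotient.mk (PathConnectedSpace.somePath y₀ y)⟩, rfl⟩

theorem exists_smul_eq {x y : UniversalCover Y y₀} (h : x.proj = y.proj) :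
    ∃ g : PiOne Y y₀, g • y = x := by
  obtain ⟨a, p⟩ := x
  obtain ⟨b, q⟩ := y
  obtain rfl : a = b := h
  refine ⟨p.trans q.symm, UniversalCover.ext rfl (heq_of_eq ?_)⟩
  exact (trans_assoc' p q.symm q).trans (by rw [symm_trans', trans_refl'])

theorem eq_one_of_smul_eq {g : PiOne Y y₀} {x : UniversalCover Y y₀} (h : g • x = x) : g = 1 := by
  obtain ⟨a, p⟩ := x
  have key (g' : Path.Homotopic.Quotient y₀ y₀) (h' : g'.trans p = p) :
      g' = Path.Homotopic.Quotient.refl y₀ := by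
    have e : (g'.trans p).trans p.symm = p.trans p.symm := by rw [h']
    rwa [trans_assoc', trans_symm', trans_refl'] at e
  refine key g ?_
  rw [smul_def, UniversalCover.mk.injEq] at h
  exact eq_of_heq h.2

/-- If `z` and `g • z` lie in one sheet over a set `U` as in `SemilocallySimplyConnected`, they
differ from the centre by paths in `U` with equal end points, hence coincide, and the action is
free. -/
theorem isQuotientCoveringMap_proj [PathConnectedSpace Y] [LocallyPathConnectedSpace Y]
    (hY : SemilocallySimplyConnected Y) :
    IsQuotientCoveringMap (proj : UniversalCover Y y₀ → Y) (PiOne Y y₀) where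
  toIsQuotientMap := isOpenMap_proj.isQuotientMap continuous_proj proj_surjective
  toContinuousConstSMul := inferInstance
  apply_eq_iff_mem_orbit {x y} := by
    refine ⟨fun h => exists_smul_eq h, ?_⟩
    rintro ⟨g, rfl⟩
    rfl
  disjoint x := by
    obtain ⟨U, hU, hxU, h⟩ := hY x.proj
    refine ⟨x.sheet U, (x.isOpen_sheet hU).mem_nhds (x.mem_sheet_self hxU), fun g => ?_⟩
    rintro ⟨_, ⟨z, ⟨γ, hγ, e⟩, rfl⟩, ⟨γ', hγ', e'⟩⟩
    refine eq_one_of_smul_eq (x := z) (UniversalCover.ext rfl (heq_of_eq ?_))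
    exact e'.trans ((congrArg x.cls.trans (h _ _ γ' γ hγ' hγ)).trans e.symm)

end UniversalCover

end Covering

/-! ### Compact manifolds are neighbourhood retracts -/

section Retraction

open Topology Metric

/-- Tietze extends the chart on a closed coordinate ball `S` to all of `B`, and the inverse chart
turns this into a map `ρ : B → e(M)` that fixes `e(S)`. The map `h` interpolates linearly between
the identity and `ρ`, by a cut-off function that is `1` near `e x` and `0` on `e(M)` outside the
interior ball `W ⊆ S`; thus `h` fixes all of `e(M)` and can be composed with its analogues at other
points. -/
theorem exists_local_retraction {A M B : Type*} [NormedAddCommGroup A] [NormedSpace ℝ A]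
    [FiniteDimensional ℝ A] [TopologicalSpace M] [T2Space M] [CompactSpace M]
    [NormedAddCommGroup B] [NormedSpace ℝ B] {e : M → B} (he : IsClosedEmbedding e)
    (c : OpenPartialHomeomorph M A) {x : M} (hx : x ∈ c.source) :
    ∃ (h : C(B, B)) (O : Set B), IsOpen O ∧ e x ∈ O ∧ (∀ p, h (e p) = e p) ∧
      ∀ y ∈ O, h y ∈ Set.range e := by
  obtain ⟨ε, hε, hball⟩ := nhds_basis_closedBall.mem_iff.1
    (c.open_target.mem_nhds (c.map_source hx))
  have : ProperSpace A := FiniteDimensional.proper ℝ A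
  have : TietzeExtension (closedBall (c x) ε) := instTietzeExtensionClosedBall ℝ _ hε
  set S : Set M := c.symm '' closedBall (c x) ε with hSdef
  have hS : IsCompact S :=
    (isCompact_closedBall _ _).image_of_continuousOn (c.continuousOn_symm.mono hball)
  have hSs : S ⊆ c.source := by
    rintro _ ⟨a, ha, rfl⟩
    exact c.map_target (hball ha)
  have hcS {p : M} (hp : p ∈ S) : c p ∈ closedBall (c x) ε := by
    obtain ⟨a, ha, rfl⟩ := hp
    rwa [c.right_inv (hball ha)]
  have heS : IsClosedEmbedding (fun p : S => e p) := he.comp hS.isClosed.isClosedEmbedding_subtypeVal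
  let f : C(S, closedBall (c x) ε) := ⟨fun p => ⟨c p, hcS p.2⟩,
    (c.continuousOn.mono hSs).domRestrict.subtype_mk _⟩
  obtain ⟨F, hF⟩ := f.exists_extension heS
  let ρ : C(B, B) := ⟨fun y => e (c.symm (F y)), he.continuous.comp
    ((c.continuousOn_symm.mono hball).comp_continuous
      (continuous_subtype_val.comp F.continuous) fun y => (F y).2)⟩
  have hρ {p : M} (hp : p ∈ S) : ρ (e p) = e p := by
    have h1 : F (e p) = f ⟨p, hp⟩ := DFunLike.congr_fun hF ⟨p, hp⟩
    change e (c.symm (F (e p))) = e p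
    rw [h1]
    exact congrArg e (c.left_inv (hSs hp))
  set W : Set M := c.source ∩ c ⁻¹' ball (c x) ε with hWdef
  have hW : IsOpen W := c.continuousOn.isOpen_inter_preimage c.open_source isOpen_ball
  have hWS : W ⊆ S := fun p hp => ⟨c p, ball_subset_closedBall hp.2, c.left_inv hp.1⟩
  have hT : IsClosed (e '' Wᶜ) := he.isClosedMap _ hW.isClosed_compl
  have hxT : e x ∈ (e '' Wᶜ)ᶜ := by
    rintro ⟨p, hp, hpx⟩
    rw [he.injective hpx] at hp
    exact hp ⟨hx, mem_ball_self hε⟩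
  obtain ⟨η, hη, hηT⟩ := nhds_basis_closedBall.mem_iff.1 (hT.isOpen_compl.mem_nhds hxT)
  obtain ⟨l, hl0, hl1, -⟩ := exists_continuous_zero_one_of_isClosed hT
    (isClosed_closedBall (x := e x) (ε := η)) (Set.disjoint_left.2 fun y hy hy' => hηT hy' hy)
  refine ⟨⟨fun y => y + l y • (ρ y - y), by fun_prop⟩, ball (e x) η, isOpen_ball,
    mem_ball_self hη, fun p => ?_, fun y hy => ?_⟩
  · by_cases hp : p ∈ W
    · simp [hρ (hWS hp)]
    · simp [hl0 ⟨p, hp, rfl⟩]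
  · simp only [ContinuousMap.coe_mk, hl1 (ball_subset_closedBall hy), Pi.one_apply, one_smul,
      add_sub_cancel]
    exact ⟨_, rfl⟩

/-- A compact manifold in a normed space is a neighbourhood retract. -/
theorem exists_neighborhood_retraction {A M B : Type*} [NormedAddCommGroup A] [NormedSpace ℝ A]
    [FiniteDimensional ℝ A] [TopologicalSpace M] [T2Space M] [CompactSpace M] [ChartedSpace A M]
    [NormedAddCommGroup B] [NormedSpace ℝ B] {e : M → B} (he : IsClosedEmbedding e) [Nonempty M] :
    ∃ (r : B → M) (δ : ℝ), 0 < δ ∧ ContinuousOn r (thickening δ (Set.range e)) ∧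
      ∀ p, r (e p) = p := by
  have key : ∃ (h : C(B, B)) (O : Set B), IsOpen O ∧ e '' Set.univ ⊆ O ∧ (∀ p, h (e p) = e p) ∧
      ∀ y ∈ O, h y ∈ Set.range e := by
    refine isCompact_univ.induction_on (p := fun S => ∃ (h : C(B, B)) (O : Set B), IsOpen O ∧
      e '' S ⊆ O ∧ (∀ p, h (e p) = e p) ∧ ∀ y ∈ O, h y ∈ Set.range e)
      ⟨ContinuousMap.id B, ∅, isOpen_empty, by simp, fun _ => rfl, fun _ h => h.elim⟩ ?_ ?_ ?_
    · rintro S T hST ⟨h, O, hO, hTO, h1, h2⟩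
      exact ⟨h, O, hO, (Set.image_mono hST).trans hTO, h1, h2⟩
    · rintro S T ⟨h, O, hO, hSO, h1, h2⟩ ⟨h', O', hO', hTO, h1', h2'⟩
      -- On `O` the map `h` already lands in `e(M)`, which `h'` fixes; on the preimage of `O'` it is
      -- `h'` that lands there. So finitely many local maps combine by composition.
      refine ⟨h'.comp h, O ∪ h ⁻¹' O', hO.union (hO'.preimage h.continuous), ?_, fun p => ?_, ?_⟩
      · rw [Set.image_union]
        refine Set.union_subset_union hSO ?_
        rintro _ ⟨p, hp, rfl⟩
        rw [Set.mem_preimage, h1]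
        exact hTO ⟨p, hp, rfl⟩
      · simp [h1, h1']
      · rintro y (hy | hy)
        · obtain ⟨p, hp⟩ := h2 y hy
          exact ⟨p, by simp [← hp, h1']⟩
        · exact h2' _ hy
    · intro x _
      obtain ⟨h, O, hO, hx, h1, h2⟩ := exists_local_retraction he (chartAt A x)
        (mem_chart_source A x)
      refine ⟨e ⁻¹' O, mem_nhdsWithin_of_mem_nhds ((hO.preimage he.continuous).mem_nhds hx),
        h, O, hO, Set.image_preimage_subset _ _, h1, h2⟩
  obtain ⟨h, O, hO, hMO, h1, h2⟩ := key
  rw [Set.image_univ] at hMO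
  obtain ⟨δ, hδ, hsub⟩ := (isCompact_range he.continuous).exists_thickening_subset_open hO hMO
  refine ⟨fun y => Function.invFun e (h y), δ, hδ, ?_, fun p => ?_⟩
  · have : ContinuousOn (Function.invFun e) (Set.range e) := by
      rw [continuousOn_iff_continuous_domRestrict]
      have e1 : (Set.range e).domRestrict (Function.invFun e) =
          (he.isEmbedding.toHomeomorph).symm := by
        funext y
        obtain ⟨p, rfl⟩ := he.isEmbedding.toHomeomorph.surjective y
        rw [Homeomorph.symm_apply_apply]
        exact Function.leftInverse_invFun he.injective p
      rw [e1]
      exact Homeomorph.continuous _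
    exact this.comp h.continuous.continuousOn fun y hy => h2 y (hsub hy)
  · simp only [h1]
    exact Function.leftInverse_invFun he.injective p

/-- Inside a coordinate ball the straight-line homotopy joins two paths, and it fixes their common
end points. -/
theorem semilocallySimplyConnected_of_charts {A M : Type*} [NormedAddCommGroup A]
    [NormedSpace ℝ A] [TopologicalSpace M] [ChartedSpace A M] : SemilocallySimplyConnected M := by
  intro y
  set c := chartAt A y
  obtain ⟨ε, hε, hball⟩ := Metric.isOpen_iff.1 c.open_target _ (c.map_source (mem_chart_source A y))
  refine ⟨c.source ∩ c ⁻¹' ball (c y) ε,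
    c.continuousOn.isOpen_inter_preimage c.open_source isOpen_ball,
    ⟨mem_chart_source A y, mem_ball_self hε⟩, fun a b p q hp hq => ?_⟩
  have hcp : Continuous fun t => c (p t) := c.continuousOn.comp_continuous p.continuous
    fun t => (hp t).1
  have hcq : Continuous fun t => c (q t) := c.continuousOn.comp_continuous q.continuous
    fun t => (hq t).1
  refine Path.Homotopic.Quotient.eq.2 ⟨⟨⟨⟨fun st => c.symm
    (AffineMap.lineMap (c (p st.2)) (c (q st.2)) (st.1 : ℝ)), ?_⟩, fun t => ?_, fun t => ?_⟩, ?_⟩⟩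
  · refine c.continuousOn_symm.comp_continuous ?_ fun st => hball ?_
    · simp only [AffineMap.lineMap_apply_module]
      exact ((continuous_const.sub (continuous_subtype_val.comp continuous_fst)).smul
        (hcp.comp continuous_snd)).add ((continuous_subtype_val.comp continuous_fst).smul
          (hcq.comp continuous_snd))
    · exact (convex_ball _ _).lineMap_mem (hp st.2).2 (hq st.2).2 st.1.2
  · simpa using c.left_inv (hp t).1
  · simpa using c.left_inv (hq t).1
  · rintro s t (rfl | ht)
    · have h := (hp 0).1
      simp only [p.source] at h
      simpa using c.left_inv h
    · obtain rfl : t = 1 := ht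
      have h := (hp 1).1
      simp only [p.target] at h
      simpa using c.left_inv h

end Retraction

/-! ### Homology classes -/

section HomologyClasses

variable {R : Type v} [Ring R] {ι : Type*} {s : ComplexShape ι}
  (C D : HomologicalComplex (ModuleCat.{w} R) s)

/-- The cycles of a complex of modules, as a submodule. -/
def cyclesSubmodule (i : ι) : Submodule R (C.X i) := ⨅ j, LinearMap.ker (C.d i j).hom

variable {C} in
theorem mem_cyclesSubmodule {i : ι} {z : C.X i} :
    z ∈ cyclesSubmodule C i ↔ ∀ j, (C.d i j).hom z = 0 := by
  simp [cyclesSubmodule, Submodule.mem_iInf]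

/-- The identification of the cycles with those of the homology theory of complexes. -/
def cyclesLift (i : ι) : cyclesSubmodule C i →ₗ[R] C.cycles i :=
  (C.liftCycles (ModuleCat.ofHom (cyclesSubmodule C i).subtype) (s.next i) rfl (by
    ext z
    exact mem_cyclesSubmodule.1 z.2 _)).hom

theorem iCycles_cyclesLift {i : ι} (z : cyclesSubmodule C i) :
    (C.iCycles i).hom (cyclesLift C i z) = z :=
  LinearMap.congr_fun (congrArg ModuleCat.Hom.hom (C.liftCycles_i
    (ModuleCat.ofHom (cyclesSubmodule C i).subtype) (s.next i) rfl (by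
      ext z
      exact mem_cyclesSubmodule.1 z.2 _))) z

variable {C} in
theorem iCycles_injective {i : ι} {x y : C.cycles i}
    (h : (C.iCycles i).hom x = (C.iCycles i).hom y) : x = y :=
  (ModuleCat.mono_iff_injective (C.iCycles i)).1 inferInstance h

/-- The map from the cycles to the homology. -/
def homologyClass (i : ι) : cyclesSubmodule C i →ₗ[R] C.homology i :=
  (C.homologyπ i).hom ∘ₗ cyclesLift C i

theorem homologyClass_surjective (i : ι) : Function.Surjective (homologyClass C i) := by
  intro x
  obtain ⟨y, rfl⟩ := (ModuleCat.epi_iff_surjective (C.homologyπ i)).1 inferInstance x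
  have hz : (C.iCycles i).hom y ∈ cyclesSubmodule C i := mem_cyclesSubmodule.2 fun j =>
    LinearMap.congr_fun (congrArg ModuleCat.Hom.hom (C.iCycles_d i j)) y
  exact ⟨⟨_, hz⟩, congrArg (C.homologyπ i).hom (iCycles_injective (iCycles_cyclesLift C ⟨_, hz⟩))⟩

theorem homologyClass_eq_zero {i : ι} {z : cyclesSubmodule C i} :
    homologyClass C i z = 0 ↔ ∃ j, ∃ w : C.X j, (C.d j i).hom w = z := by
  have ht (j : ι) (w : C.X j) : (C.iCycles i).hom ((C.toCycles j i).hom w) = (C.d j i).hom w :=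
    LinearMap.congr_fun (congrArg ModuleCat.Hom.hom (C.toCycles_i j i)) w
  constructor
  · intro h
    have hex := ShortComplex.exact_of_g_is_cokernel (ShortComplex.mk _ _
      (C.toCycles_comp_homologyπ (s.prev i) i)) (C.homologyIsCokernel (s.prev i) i rfl)
    obtain ⟨w, hw⟩ := (ShortComplex.moduleCat_exact_iff _).1 hex _ h
    exact ⟨_, w, (ht _ w).symm.trans ((congrArg _ hw).trans (iCycles_cyclesLift C z))⟩
  · rintro ⟨j, w, hw⟩
    have e : cyclesLift C i z = (C.toCycles j i).hom w := by
      refine iCycles_injective ((iCycles_cyclesLift C z).trans ?_)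
      rw [ht, hw]
    rw [homologyClass, LinearMap.comp_apply, e]
    exact LinearMap.congr_fun (congrArg ModuleCat.Hom.hom (C.toCycles_comp_homologyπ j i)) w

variable {C D}

theorem map_mem_cyclesSubmodule (f : C ⟶ D) {i : ι} {z : C.X i} (hz : z ∈ cyclesSubmodule C i) :
    (f.f i).hom z ∈ cyclesSubmodule D i := mem_cyclesSubmodule.2 fun j => by
  have h := LinearMap.congr_fun (congrArg ModuleCat.Hom.hom (f.comm i j)) z
  simp only [ModuleCat.hom_comp, LinearMap.comp_apply, mem_cyclesSubmodule.1 hz j, map_zero] at h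
  exact h

theorem homologyMap_homologyClass (f : C ⟶ D) {i : ι} (z : cyclesSubmodule C i) :
    (HomologicalComplex.homologyMap f i).hom (homologyClass C i z) =
      homologyClass D i ⟨(f.f i).hom z, map_mem_cyclesSubmodule f z.2⟩ := by
  refine (LinearMap.congr_fun (congrArg ModuleCat.Hom.hom
    (HomologicalComplex.homologyπ_naturality f i)) (cyclesLift C i z)).trans ?_
  refine congrArg (D.homologyπ i).hom (iCycles_injective ?_)
  rw [iCycles_cyclesLift]
  refine (LinearMap.congr_fun (congrArg ModuleCat.Hom.hom
    (HomologicalComplex.cyclesMap_i f i)) (cyclesLift C i z)).trans ?_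
  exact congrArg (f.f i).hom (iCycles_cyclesLift C z)

/-- The elements of `F` need not be cycles, but `z'` is one, as it differs from `z` by a boundary.
So the cycles in `F`, finitely generated because `F` is Noetherian, map onto the homology. -/
theorem homology_finite {i : ι} (F : Submodule R (C.X i)) [IsNoetherian R F]
    (h : ∀ z ∈ cyclesSubmodule C i, ∃ z' ∈ F, ∃ j, ∃ w : C.X j, (C.d j i).hom w = z - z') :
    Module.Finite R (C.homology i) := by
  let F' : Submodule R F := (cyclesSubmodule C i).comap F.subtype
  let f : F' →ₗ[R] C.homology i := (homologyClass C i).comp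
    ((F.subtype.comp F'.subtype).codRestrict (cyclesSubmodule C i) fun z => z.2)
  refine Module.Finite.of_surjective f fun x => ?_
  obtain ⟨z, rfl⟩ := homologyClass_surjective C i x
  obtain ⟨z', hz', j, w, hw⟩ := h z z.2
  have hb : z - z' ∈ cyclesSubmodule C i := mem_cyclesSubmodule.2 fun k => by
    rw [← hw]
    exact LinearMap.congr_fun (congrArg ModuleCat.Hom.hom (C.d_comp_d j i k)) w
  have hc : z' ∈ cyclesSubmodule C i := by
    have := (cyclesSubmodule C i).sub_mem z.2 hb
    rwa [sub_sub_cancel] at this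
  refine ⟨⟨⟨z', hz'⟩, hc⟩, ?_⟩
  change homologyClass C i ⟨z', hc⟩ = _
  rw [← sub_eq_zero, ← map_sub, homologyClass_eq_zero]
  refine ⟨j, -w, ?_⟩
  rw [map_neg, hw]
  simp

end HomologyClasses

/-! ### Straightening of small simplices -/

section Straightening

open Metric

/-- A map of `Y` to a normed space `B` with a retraction of a neighbourhood of the image, and a
finite net in `Y`. -/
structure StraighteningData (Y : Type u) [TopologicalSpace Y] (B : Type v)
    [NormedAddCommGroup B] [NormedSpace ℝ B] where
  /-- the map to a normed space -/
  e : C(Y, B)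
  /-- the retraction -/
  r : B → Y
  /-- the choice of a nearby point of the net -/
  q : Y → Y
  /-- the mesh of the net -/
  η : ℝ
  η_pos : 0 < η
  retract : ∀ p, r (e p) = p
  continuousOn_r : ContinuousOn r (thickening (2 * η) (Set.range e))
  dist_q_lt : ∀ p, dist (e (q p)) (e p) < η
  finite_range : (Set.range q).Finite

/-- The mesh is `δ / 2`, so that `2 * η` is the radius on which `r` is continuous; the net is the
set of centres of a finite subcover by preimages of `η`-balls. -/
theorem nonempty_straighteningData {M B : Type*} [TopologicalSpace M] [CompactSpace M]
    [NormedAddCommGroup B] [NormedSpace ℝ B] (e : C(M, B)) {r : B → M} {δ : ℝ} (hδ : 0 < δ)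
    (hr : ContinuousOn r (thickening δ (Set.range e))) (hre : ∀ p, r (e p) = p) :
    Nonempty (StraighteningData M B) := by
  have hη : 0 < δ / 2 := by positivity
  obtain ⟨t, ht⟩ := isCompact_univ.elim_finite_subcover (fun p : M => e ⁻¹' ball (e p) (δ / 2))
    (fun p => isOpen_ball.preimage e.continuous)
    fun p _ => Set.mem_iUnion.2 ⟨p, mem_ball_self hη⟩
  have h (p : M) : ∃ q ∈ t, dist (e q) (e p) < δ / 2 := by
    have := ht (Set.mem_univ p)
    simp only [Set.mem_iUnion, Set.mem_preimage, mem_ball'] at this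
    obtain ⟨q, hq, h⟩ := this
    exact ⟨q, hq, h⟩
  choose q hq hd using h
  exact ⟨⟨e, r, q, δ / 2, hη, hre, by rwa [mul_div_cancel₀ _ two_ne_zero], hd,
    t.finite_toSet.subset (by rintro _ ⟨p, rfl⟩; exact hq p)⟩⟩

variable {Y : Type u} [TopologicalSpace Y] {y₀ : Y} {B : Type v}
    [NormedAddCommGroup B] [NormedSpace ℝ B] (S : StraighteningData Y B)

namespace StraighteningData

/-- The simplices of the universal covering whose projections are small. -/
def Small {n : ℕ} (σ : C(Simplex n, UniversalCover Y y₀)) : Prop :=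
  ∀ s t, dist (S.e (σ s).proj) (S.e (σ t).proj) < S.η

/-- The affine map that takes the vertices to nearby points of the net. -/
def target {n : ℕ} (σ : C(Simplex n, UniversalCover Y y₀)) (t : Simplex n) : B :=
  ∑ i, t i • S.e (S.q (σ (vertices n i)).proj)

/-- `k` is the linear homotopy from `σ` to the affine simplex with vertices in the net. -/
def IsStraightening {n : ℕ} (σ : C(Simplex n, UniversalCover Y y₀))
    (k : C(unitInterval × Simplex n, UniversalCover Y y₀)) : Prop :=
  (∀ t, k (0, t) = σ t) ∧ ∀ s t, (k (s, t)).proj =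
    S.r (AffineMap.lineMap (S.e (σ t).proj) (S.target σ t) (s : ℝ))

variable {S}

/-- A net point is within `η` of the image of its vertex, and this is within `η` of the image of `t`
because the simplex is small; balls are convex. Hence the linear homotopy to the target stays where
the retraction is continuous. -/
theorem dist_target_lt {n : ℕ} {σ : C(Simplex n, UniversalCover Y y₀)} (hσ : S.Small σ)
    (t : Simplex n) : dist (S.target σ t) (S.e (σ t).proj) < 2 * S.η := by
  refine (convex_ball (S.e (σ t).proj) (2 * S.η)).sum_mem (fun i _ => t.2.1 i) t.2.2
    fun i _ => ?_
  rw [mem_ball, two_mul]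
  exact (dist_triangle _ _ _).trans_lt (add_lt_add (S.dist_q_lt _) (hσ _ _))

/-- The linear homotopy in `B` is pushed to `Y` by the retraction and then lifted, starting from
`σ`, by the homotopy lifting property. -/
theorem exists_isStraightening (hc : IsCoveringMap (UniversalCover.proj (y₀ := y₀))) {n : ℕ}
    {σ : C(Simplex n, UniversalCover Y y₀)} (hσ : S.Small σ) : ∃ k, S.IsStraightening σ k := by
  have hpσ : Continuous fun t => S.e (σ t).proj :=
    S.e.continuous.comp (hc.continuous.comp σ.continuous)
  have htarget : Continuous (S.target σ) := by
    refine continuous_finsetSum _ fun i _ => Continuous.smul ?_ continuous_const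
    exact (continuous_apply i).comp continuous_subtype_val
  let H : C(unitInterval × Simplex n, Y) :=
    ⟨fun x => S.r (AffineMap.lineMap (S.e (σ x.2).proj) (S.target σ x.2) (x.1 : ℝ)), by
      refine S.continuousOn_r.comp_continuous ?_ fun x => ?_
      · simp only [AffineMap.lineMap_apply_module]
        exact ((continuous_const.sub (continuous_subtype_val.comp continuous_fst)).smul
          (hpσ.comp continuous_snd)).add ((continuous_subtype_val.comp continuous_fst).smul
            (htarget.comp continuous_snd))
      · have h0 : 0 < 2 * S.η := by linarith [S.η_pos]
        exact mem_thickening_iff.2 ⟨_, ⟨_, rfl⟩, (convex_ball (S.e (σ x.2).proj) _).lineMap_mem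
          (mem_ball_self h0) (dist_target_lt hσ x.2) x.1.2⟩⟩
  have H0 (t : Simplex n) : H (0, t) = (σ t).proj := by
    change S.r (AffineMap.lineMap _ _ ((0 : unitInterval) : ℝ)) = _
    rw [Set.Icc.coe_zero, AffineMap.lineMap_apply_zero, S.retract]
  exact ⟨hc.liftHomotopy H σ H0, fun t => hc.liftHomotopy_zero H σ H0 t,
    fun s t => congrFun (hc.liftHomotopy_lifts H σ H0) (s, t)⟩

/-- Lifts over a connected space that agree at one point are equal. Uniqueness makes the chosen
straightenings commute with faces and deck transformations. -/
theorem IsStraightening.unique (hc : IsCoveringMap (UniversalCover.proj (y₀ := y₀))) {n : ℕ}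
    {σ : C(Simplex n, UniversalCover Y y₀)}
    {k k' : C(unitInterval × Simplex n, UniversalCover Y y₀)}
    (h : S.IsStraightening σ k) (h' : S.IsStraightening σ k') : k = k' := by
  have e := hc.eq_of_comp_eq k.continuous k'.continuous
    (funext fun x => (h.2 x.1 x.2).trans (h'.2 x.1 x.2).symm) (0, Classical.arbitrary _)
    ((h.1 _).trans (h'.1 _).symm)
  exact ContinuousMap.ext (congrFun e)

theorem Small.face {n : ℕ} {σ : C(Simplex (n + 1), UniversalCover Y y₀)} (hσ : S.Small σ)
    (i : Fin (n + 2)) : S.Small (σ.comp (faceMap i)) := fun _ _ => hσ _ _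

theorem Small.act {n : ℕ} {σ : C(Simplex n, UniversalCover Y y₀)} (hσ : S.Small σ)
    (g : PiOne Y y₀) : S.Small ((UniversalCover.act g).comp σ) := fun _ _ => hσ _ _

theorem IsStraightening.face {n : ℕ} {σ : C(Simplex (n + 1), UniversalCover Y y₀)}
    {k : C(unitInterval × Simplex (n + 1), UniversalCover Y y₀)} (h : S.IsStraightening σ k)
    (i : Fin (n + 2)) : S.IsStraightening (σ.comp (faceMap i)) (prismFace k i) := by
  refine ⟨fun t => h.1 _, fun s t => ?_⟩
  -- The target depends affinely on the vertices only, so its restriction to a face is the target of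
  -- that face.
  have e : S.target σ (faceMap i t) = S.target (σ.comp (faceMap i)) t := by
    refine (sum_map_smul i.succAbove t _).trans (Finset.sum_congr rfl fun j _ => ?_)
    have := congrFun (faceMap_vertices i) j
    simp only [Function.comp_apply, Fin.removeNth] at this
    rw [ContinuousMap.comp_apply, this]
  rw [← e]
  exact h.2 s (faceMap i t)

theorem IsStraightening.act {n : ℕ} {σ : C(Simplex n, UniversalCover Y y₀)}
    {k : C(unitInterval × Simplex n, UniversalCover Y y₀)} (h : S.IsStraightening σ k)
    (g : PiOne Y y₀) : S.IsStraightening ((UniversalCover.act g).comp σ)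
      ((UniversalCover.act g).comp k) :=
  ⟨fun t => congrArg (fun x => g • x) (h.1 t), h.2⟩

variable (S) in
/-- A simplex of the universal covering whose projection is affine with vertices in the net. -/
def IsStraight {n : ℕ} (τ : C(Simplex n, UniversalCover Y y₀)) : Prop :=
  ∃ x : Fin (n + 1) → Set.range S.q, ∀ t, (τ t).proj = S.r (∑ i, t i • S.e (x i))

theorem IsStraightening.isStraight {n : ℕ} {σ : C(Simplex n, UniversalCover Y y₀)}
    {k : C(unitInterval × Simplex n, UniversalCover Y y₀)} (h : S.IsStraightening σ k) :
    S.IsStraight (level k 1) := by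
  refine ⟨fun i => ⟨_, ⟨(σ (vertices n i)).proj, rfl⟩⟩, fun t => (h.2 1 t).trans ?_⟩
  rw [Set.Icc.coe_one, AffineMap.lineMap_apply_one]
  rfl

open Classical in
variable (S) in
/-- The straightening homotopy of small simplices; it is zero on the other simplices. -/
def straightHomotopy (y₀ : Y) (n : ℕ) :
    (singularChains (UniversalCover Y y₀)).X n →ₗ[ℤ]
      (singularChains (UniversalCover Y y₀)).X (n + 1) :=
  chainsLift fun σ => if h : ∃ k, S.Small σ ∧ S.IsStraightening σ k then prismChain h.choose else 0

open Classical in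
variable (S) in
/-- The straightening of small simplices; it is zero on the other simplices. -/
def straighten (y₀ : Y) (n : ℕ) :
    (singularChains (UniversalCover Y y₀)).X n →ₗ[ℤ]
      (singularChains (UniversalCover Y y₀)).X n :=
  chainsLift fun σ => if h : ∃ k, S.Small σ ∧ S.IsStraightening σ k
    then ofSimplex (level h.choose 1) else 0

theorem straightHomotopy_ofSimplex (hc : IsCoveringMap (UniversalCover.proj (y₀ := y₀))) {n : ℕ}
    {σ : C(Simplex n, UniversalCover Y y₀)} (hσ : S.Small σ)
    {k : C(unitInterval × Simplex n, UniversalCover Y y₀)} (h : S.IsStraightening σ k) :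
    S.straightHomotopy y₀ n (ofSimplex σ) = prismChain k := by
  have h' : ∃ k, S.Small σ ∧ S.IsStraightening σ k := ⟨k, hσ, h⟩
  rw [straightHomotopy, chainsLift_ofSimplex, dif_pos h', h'.choose_spec.2.unique hc h]

theorem straighten_ofSimplex (hc : IsCoveringMap (UniversalCover.proj (y₀ := y₀))) {n : ℕ}
    {σ : C(Simplex n, UniversalCover Y y₀)} (hσ : S.Small σ)
    {k : C(unitInterval × Simplex n, UniversalCover Y y₀)} (h : S.IsStraightening σ k) :
    S.straighten y₀ n (ofSimplex σ) = ofSimplex (level k 1) := by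
  have h' : ∃ k, S.Small σ ∧ S.IsStraightening σ k := ⟨k, hσ, h⟩
  rw [straighten, chainsLift_ofSimplex, dif_pos h', h'.choose_spec.2.unique hc h]

theorem straightHomotopy_ofSimplex_of_not_small {n : ℕ}
    {σ : C(Simplex n, UniversalCover Y y₀)} (hσ : ¬ S.Small σ) :
    S.straightHomotopy y₀ n (ofSimplex σ) = 0 := by
  rw [straightHomotopy, chainsLift_ofSimplex, dif_neg fun ⟨_, h, _⟩ => hσ h]

theorem straightHomotopy_act (hc : IsCoveringMap (UniversalCover.proj (y₀ := y₀)))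
    (g : PiOne Y y₀) {n : ℕ} (c : (singularChains (UniversalCover Y y₀)).X n) :
    S.straightHomotopy y₀ n (chainsMap (UniversalCover.act g) n c) =
      chainsMap (UniversalCover.act g) (n + 1) (S.straightHomotopy y₀ n c) := by
  suffices h : S.straightHomotopy y₀ n ∘ₗ chainsMap (UniversalCover.act g) n =
    chainsMap (UniversalCover.act g) (n + 1) ∘ₗ S.straightHomotopy y₀ n from LinearMap.congr_fun h c
  refine chains_hom_ext fun σ => ?_
  rw [LinearMap.comp_apply, LinearMap.comp_apply, chainsMap_ofSimplex]
  by_cases hσ : S.Small σ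
  · obtain ⟨k, hk⟩ := exists_isStraightening hc hσ
    rw [straightHomotopy_ofSimplex hc (hσ.act g) (hk.act g), straightHomotopy_ofSimplex hc hσ hk,
      chainsMap_prismChain]
  · rw [straightHomotopy_ofSimplex_of_not_small hσ, straightHomotopy_ofSimplex_of_not_small
      (σ := (UniversalCover.act g).comp σ) hσ, map_zero]

theorem boundary_straightHomotopy_succ (hc : IsCoveringMap (UniversalCover.proj (y₀ := y₀)))
    {n : ℕ} {c : (singularChains (UniversalCover Y y₀)).X (n + 1)} (h : c ∈ chainsSpan S.Small) :
    boundary _ (n + 2) (n + 1) (S.straightHomotopy y₀ (n + 1) c) =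
      S.straighten y₀ (n + 1) c - c - S.straightHomotopy y₀ n (boundary _ (n + 1) n c) := by
  induction h using AddSubgroup.closure_induction with
  | mem c hc' =>
    obtain ⟨σ, hσ, rfl⟩ := hc'
    obtain ⟨k, hk⟩ := exists_isStraightening hc hσ
    have e0 : level k 0 = σ := ContinuousMap.ext hk.1
    rw [straightHomotopy_ofSimplex hc hσ hk, straighten_ofSimplex hc hσ hk,
      boundary_prismChain_succ, boundary_ofSimplex, map_sum, e0]
    simp only [map_zsmul, fun i => straightHomotopy_ofSimplex hc (hσ.face i) (hk.face i)]
  | zero => simp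
  | add a b _ _ ha hb => simp only [map_add, ha, hb]; abel
  | neg a _ ha => simp only [map_neg, ha]; abel

theorem boundary_straightHomotopy_zero (hc : IsCoveringMap (UniversalCover.proj (y₀ := y₀)))
    {c : (singularChains (UniversalCover Y y₀)).X 0} (h : c ∈ chainsSpan S.Small) :
    boundary _ 1 0 (S.straightHomotopy y₀ 0 c) = S.straighten y₀ 0 c - c := by
  induction h using AddSubgroup.closure_induction with
  | mem c hc' =>
    obtain ⟨σ, hσ, rfl⟩ := hc'
    obtain ⟨k, hk⟩ := exists_isStraightening hc hσ
    have e0 : level k 0 = σ := ContinuousMap.ext hk.1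
    rw [straightHomotopy_ofSimplex hc hσ hk, straighten_ofSimplex hc hσ hk,
      boundary_prismChain_zero, e0]
  | zero => simp
  | add a b _ _ ha hb => simp only [map_add, ha, hb]; abel
  | neg a _ ha => simp only [map_neg, ha]; abel

theorem straighten_mem (hc : IsCoveringMap (UniversalCover.proj (y₀ := y₀)))
    {n : ℕ} {c : (singularChains (UniversalCover Y y₀)).X n} (h : c ∈ chainsSpan S.Small) :
    S.straighten y₀ n c ∈ chainsSpan S.IsStraight := by
  induction h using AddSubgroup.closure_induction with
  | mem c hc' =>
    obtain ⟨σ, hσ, rfl⟩ := hc'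
    obtain ⟨k, hk⟩ := exists_isStraightening hc hσ
    rw [straighten_ofSimplex hc hσ hk]
    exact AddSubgroup.subset_closure ⟨_, hk.isStraight, rfl⟩
  | zero => rw [map_zero]; exact AddSubgroup.zero_mem _
  | add a b _ _ ha hb => rw [map_add]; exact AddSubgroup.add_mem _ ha hb
  | neg a _ ha => rw [map_neg]; exact AddSubgroup.neg_mem _ ha

end StraighteningData

end Straightening

/-! ### Twisted homology is finite-dimensional -/

section Finiteness

variable {Y : Type u} [TopologicalSpace Y] {y₀ : Y}
variable {R : Type v} [CommRing R] {K : Type w} [AddCommGroup K] [Module R K]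
variable (β : Representation R (PiOne Y y₀)ᵐᵒᵖ K)

/-- The map of twisted chains given by an equivariant map of chains. -/
def twistedMap {m n : ℕ} (f : (singularChains (UniversalCover Y y₀)).X m →ₗ[ℤ]
      (singularChains (UniversalCover Y y₀)).X n)
    (hf : ∀ g c, f (chainsMap (UniversalCover.act g) m c) =
      chainsMap (UniversalCover.act g) n (f c)) :
    twistedChains β m →ₗ[R] twistedChains β n :=
  Submodule.mapQ _ _ (TensorProduct.AlgebraTensorModule.map (LinearMap.id : K →ₗ[R] K) f) (by
    refine Submodule.span_le.2 ?_
    rintro _ ⟨x, g, c, rfl⟩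
    refine Submodule.subset_span ⟨x, g, f c, ?_⟩
    simp only [map_sub, TensorProduct.AlgebraTensorModule.map_tmul, LinearMap.id_apply, hf])

/-- The class of `x ⊗ c`. -/
abbrev twistedMk {n : ℕ} (x : K) (c : (singularChains (UniversalCover Y y₀)).X n) :
    twistedChains β n := Submodule.Quotient.mk (x ⊗ₜ[ℤ] c)

variable {β}

theorem twistedMk_add {n : ℕ} (x : K) (c c' : (singularChains (UniversalCover Y y₀)).X n) :
    twistedMk β x (c + c') = twistedMk β x c + twistedMk β x c' := by
  simp only [twistedMk, TensorProduct.tmul_add, Submodule.Quotient.mk_add]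

theorem twistedMk_zero {n : ℕ} (x : K) :
    twistedMk β x (0 : (singularChains (UniversalCover Y y₀)).X n) = 0 := by
  simp only [twistedMk, TensorProduct.tmul_zero, Submodule.Quotient.mk_zero]

theorem twistedMk_neg {n : ℕ} (x : K) (c : (singularChains (UniversalCover Y y₀)).X n) :
    twistedMk β x (-c) = -twistedMk β x c := by
  simp only [twistedMk, TensorProduct.tmul_neg, Submodule.Quotient.mk_neg]

theorem twistedMk_sub {n : ℕ} (x : K) (c c' : (singularChains (UniversalCover Y y₀)).X n) :
    twistedMk β x (c - c') = twistedMk β x c - twistedMk β x c' := by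
  simp only [twistedMk, TensorProduct.tmul_sub, Submodule.Quotient.mk_sub]

theorem twistedMk_act {n : ℕ} (g : PiOne Y y₀) (x : K)
    (c : (singularChains (UniversalCover Y y₀)).X n) :
    twistedMk β x (chainsMap (UniversalCover.act g) n c) =
      twistedMk β (β (MulOpposite.op g) x) c := by
  symm
  rw [← sub_eq_zero, ← Submodule.Quotient.mk_sub, Submodule.Quotient.mk_eq_zero]
  exact Submodule.subset_span ⟨x, g, c, rfl⟩

theorem twistedChains_induction {n : ℕ} {p : twistedChains β n → Prop} (z : twistedChains β n)
    (zero : p 0) (mk : ∀ x c, p (twistedMk β x c)) (add : ∀ a b, p a → p b → p (a + b)) : p z := by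
  induction z using Submodule.Quotient.induction_on with
  | H z =>
    induction z using TensorProduct.induction_on with
    | zero => exact zero
    | tmul x c => exact mk x c
    | add a b ha hb => exact add _ _ ha hb

variable (β) in
/-- The submodule generated by the classes of `x ⊗ c` with `c` in an additive subgroup. -/
def twistedSpan {n : ℕ} (S : AddSubgroup ((singularChains (UniversalCover Y y₀)).X n)) :
    Submodule R (twistedChains β n) :=
  Submodule.span R {z | ∃ x, ∃ c ∈ S, z = twistedMk β x c}

variable (β) in
/-- Subdivision of twisted chains. -/
def twistedSubdivision (n : ℕ) : twistedChains β n →ₗ[R] twistedChains β n :=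
  twistedMap β (subdivision _ n) fun _ c => (chainsMap_subdivision _ n c).symm

theorem twistedSubdivision_homologous {n : ℕ} {z : twistedChains β n}
    (hz : ∀ j, twistedBoundary β n j z = 0) :
    ∃ w, twistedBoundary β (n + 1) n w = z - twistedSubdivision β n z := by
  let T (n : ℕ) : twistedChains β n →ₗ[R] twistedChains β (n + 1) :=
    twistedMap β (subdivisionHomotopy _ n) fun _ c => (chainsMap_subdivisionHomotopy _ n c).symm
  refine ⟨T n z, ?_⟩
  cases n with
  | zero =>
    suffices h : twistedBoundary β 1 0 ∘ₗ T 0 = LinearMap.id - twistedSubdivision β 0 from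
      LinearMap.congr_fun h z
    refine twistedChains_ext fun x c => ?_
    change twistedMk β x (boundary _ 1 0 (subdivisionHomotopy _ 0 c)) =
      twistedMk β x c - twistedMk β x (subdivision _ 0 c)
    rw [boundary_subdivisionHomotopy_zero, twistedMk_sub]
  | succ n =>
    have h : twistedBoundary β (n + 2) (n + 1) ∘ₗ T (n + 1) = LinearMap.id -
        twistedSubdivision β (n + 1) - T n ∘ₗ twistedBoundary β (n + 1) n := by
      refine twistedChains_ext fun x c => ?_
      change twistedMk β x (boundary _ (n + 2) (n + 1) (subdivisionHomotopy _ (n + 1) c)) =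
        twistedMk β x c - twistedMk β x (subdivision _ (n + 1) c) -
          twistedMk β x (subdivisionHomotopy _ n (boundary _ (n + 1) n c))
      rw [boundary_subdivisionHomotopy_succ, twistedMk_sub, twistedMk_sub]
    have h' := LinearMap.congr_fun h z
    simp only [LinearMap.comp_apply, LinearMap.sub_apply, hz, map_zero, sub_zero,
      LinearMap.id_apply] at h'
    exact h'

theorem twistedBoundary_twistedBoundary (i j k : ℕ) (z : twistedChains β i) :
    twistedBoundary β j k (twistedBoundary β i j z) = 0 :=
  LinearMap.congr_fun (congrArg ModuleCat.Hom.hom ((twistedChainComplex β).d_comp_d i j k)) z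

theorem twistedBoundary_shape {n j : ℕ} (h : ¬ (ComplexShape.down ℕ).Rel n j)
    (z : twistedChains β n) : twistedBoundary β n j z = 0 :=
  LinearMap.congr_fun (congrArg ModuleCat.Hom.hom ((twistedChainComplex β).shape n j h)) z

theorem twistedSubdivision_iterate_homologous {n : ℕ} {z : twistedChains β n}
    (hz : ∀ j, twistedBoundary β n j z = 0) (k : ℕ) :
    ∃ w, twistedBoundary β (n + 1) n w = z - (twistedSubdivision β n)^[k] z := by
  induction k with
  | zero => exact ⟨0, by simp⟩
  | succ k ih =>
    obtain ⟨w, hw⟩ := ih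
    have hz' (j : ℕ) : twistedBoundary β n j ((twistedSubdivision β n)^[k] z) = 0 := by
      rw [← sub_sub_cancel z ((twistedSubdivision β n)^[k] z), ← hw, map_sub, hz,
        twistedBoundary_twistedBoundary, sub_zero]
    obtain ⟨w', hw'⟩ := twistedSubdivision_homologous hz'
    refine ⟨w + w', ?_⟩
    rw [map_add, hw, hw', Function.iterate_succ_apply']
    abel

variable {B : Type*} [NormedAddCommGroup B] [NormedSpace ℝ B] (S : StraighteningData Y B)

theorem exists_twistedSubdivision_small (hc : IsCoveringMap (UniversalCover.proj (y₀ := y₀)))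
    {n : ℕ} (z : twistedChains β n) : ∃ k₀ : ℕ, ∀ k ≥ k₀,
      (twistedSubdivision β n)^[k] z ∈ twistedSpan β (chainsSpan S.Small) := by
  induction z using twistedChains_induction with
  | zero =>
    refine ⟨0, fun k _ => ?_⟩
    rw [iterate_map_zero]
    exact Submodule.zero_mem _
  | add a b ha hb =>
    obtain ⟨i, hi⟩ := ha
    obtain ⟨j, hj⟩ := hb
    refine ⟨max i j, fun k hk => ?_⟩
    rw [iterate_map_add]
    exact Submodule.add_mem _ (hi k (le_of_max_le_left hk)) (hj k (le_of_max_le_right hk))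
  | mk x c =>
    obtain ⟨k₀, h⟩ := exists_subdivision_pow_small
      (S.e.comp ⟨UniversalCover.proj (y₀ := y₀), hc.continuous⟩) S.η_pos c
    refine ⟨k₀, fun k hk => Submodule.subset_span ⟨x, _, h k hk, ?_⟩⟩
    clear hk
    induction k with
    | zero => rfl
    | succ k ih => rw [Function.iterate_succ_apply', ih, Function.iterate_succ_apply']; rfl

open StraighteningData in
theorem straighten_homologous (hc : IsCoveringMap (UniversalCover.proj (y₀ := y₀))) {n : ℕ}
    {z : twistedChains β n} (hz : ∀ j, twistedBoundary β n j z = 0)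
    (hs : z ∈ twistedSpan β (chainsSpan S.Small)) :
    ∃ z' ∈ twistedSpan β (chainsSpan S.IsStraight),
      ∃ w, twistedBoundary β (n + 1) n w = z - z' := by
  let D (n : ℕ) : twistedChains β n →ₗ[R] twistedChains β (n + 1) :=
    twistedMap β (S.straightHomotopy y₀ n) fun g c => straightHomotopy_act hc g c
  -- Span induction decomposes `z` into pieces that need not be cycles, so the term `D ∂ z` is kept
  -- in `key` and disappears only afterwards. In degree `0` there is no such term.
  let P : ∀ n, twistedChains β n →ₗ[R] twistedChains β n
    | 0 => 0
    | n + 1 => D n ∘ₗ twistedBoundary β (n + 1) n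
  have key : ∃ z' ∈ twistedSpan β (chainsSpan S.IsStraight), twistedBoundary β (n + 1) n (D n z) =
      z' - z - P n z := by
    clear hz
    induction hs using Submodule.span_induction with
    | mem z hz =>
      obtain ⟨x, c, h, rfl⟩ := hz
      refine ⟨twistedMk β x (S.straighten y₀ n c),
        Submodule.subset_span ⟨x, _, straighten_mem hc h, rfl⟩, ?_⟩
      cases n with
      | zero =>
        change twistedMk β x (boundary _ 1 0 (S.straightHomotopy y₀ 0 c)) = _
        rw [boundary_straightHomotopy_zero hc h, twistedMk_sub]
        exact (sub_zero _).symm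
      | succ n =>
        change twistedMk β x (boundary _ (n + 2) (n + 1) (S.straightHomotopy y₀ (n + 1) c)) =
          _ - _ - twistedMk β x (S.straightHomotopy y₀ n (boundary _ (n + 1) n c))
        rw [boundary_straightHomotopy_succ hc h, twistedMk_sub, twistedMk_sub]
    | zero => exact ⟨0, Submodule.zero_mem _, by simp⟩
    | add a b _ _ ha hb =>
      obtain ⟨a', ha', ea⟩ := ha
      obtain ⟨b', hb', eb⟩ := hb
      refine ⟨a' + b', Submodule.add_mem _ ha' hb', ?_⟩
      rw [map_add, map_add, ea, eb, map_add]
      abel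
    | smul r a _ ha =>
      obtain ⟨a', ha', ea⟩ := ha
      refine ⟨r • a', Submodule.smul_mem _ r ha', ?_⟩
      rw [map_smul, map_smul, ea, map_smul, smul_sub, smul_sub]
  obtain ⟨z', hz', e⟩ := key
  refine ⟨z', hz', -D n z, ?_⟩
  have hP : P n z = 0 := by
    cases n with
    | zero => rfl
    | succ n => exact (congrArg (D n) (hz n)).trans (map_zero _)
  rw [map_neg, e, hP, sub_zero, neg_sub]

/-- Simplices of the universal covering with the same projection are translates of each other. -/
theorem exists_act_eq (hc : IsCoveringMap (UniversalCover.proj (y₀ := y₀))) {n : ℕ}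
    {τ τ' : C(Simplex n, UniversalCover Y y₀)} (h : ∀ t, (τ t).proj = (τ' t).proj) :
    ∃ g : PiOne Y y₀, τ = (UniversalCover.act g).comp τ' := by
  let t₀ : Simplex n := Classical.arbitrary _
  obtain ⟨g, hg⟩ := UniversalCover.exists_smul_eq (h t₀)
  refine ⟨g, ContinuousMap.ext (congrFun (hc.eq_of_comp_eq τ.continuous
    ((UniversalCover.act g).comp τ').continuous (funext fun t => h t) t₀ hg.symm))⟩

/-- A straight simplex is determined up to a deck transformation by its tuple of net points, and in
twisted chains a deck transformation can be moved to the coefficient. So one lift `τ x` for each of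
finitely many tuples suffices, with value `0` when no lift exists. -/
theorem twistedSpan_straight_fg (hc : IsCoveringMap (UniversalCover.proj (y₀ := y₀)))
    [IsNoetherianRing R] [Module.Finite R K] (n : ℕ) :
    IsNoetherian R (twistedSpan β (chainsSpan (n := n) S.IsStraight)) := by
  classical
  have : Finite (Set.range S.q) := S.finite_range
  let τ (x : Fin (n + 1) → Set.range S.q) : (singularChains (UniversalCover Y y₀)).X n :=
    if h : ∃ τ : C(Simplex n, UniversalCover Y y₀),
      ∀ t, (τ t).proj = S.r (∑ i, t i • S.e (x i)) then ofSimplex h.choose else 0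
  let L (x : Fin (n + 1) → Set.range S.q) : K →ₗ[R] twistedChains β n :=
    (Submodule.mkQ _).comp ((TensorProduct.AlgebraTensorModule.mk ℤ R K _).flip (τ x))
  have hL (x k) : L x k = twistedMk β k (τ x) := rfl
  have hle : twistedSpan β (chainsSpan (n := n) S.IsStraight) ≤ ⨆ x, LinearMap.range (L x) := by
    refine Submodule.span_le.2 ?_
    rintro _ ⟨k, c, h, rfl⟩
    rw [SetLike.mem_coe]
    induction h using AddSubgroup.closure_induction with
    | mem c h =>
      obtain ⟨σ, ⟨x, hx⟩, rfl⟩ := h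
      have h' : ∃ τ : C(Simplex n, UniversalCover Y y₀),
        ∀ t, (τ t).proj = S.r (∑ i, t i • S.e (x i)) := ⟨σ, hx⟩
      obtain ⟨g, hg⟩ := exists_act_eq hc fun t => (hx t).trans (h'.choose_spec t).symm
      have e : ofSimplex σ = chainsMap (UniversalCover.act g) n (τ x) := by
        rw [show τ x = ofSimplex h'.choose from dif_pos h', chainsMap_ofSimplex, ← hg]
      rw [e, twistedMk_act]
      exact Submodule.mem_iSup_of_mem x ⟨_, rfl⟩
    | zero => rw [twistedMk_zero]; exact Submodule.zero_mem _
    | add a b _ _ ha hb => rw [twistedMk_add]; exact Submodule.add_mem _ ha hb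
    | neg a _ ha => rw [twistedMk_neg]; exact Submodule.neg_mem _ ha
  have : IsNoetherian R (⨆ x, LinearMap.range (L x) : Submodule R (twistedChains β n)) := by
    infer_instance
  exact isNoetherian_of_le hle

/-- Subdivide until the simplices are small, then straighten; both operations change a cycle by a
boundary. -/
theorem exists_straight_homologous (hc : IsCoveringMap (UniversalCover.proj (y₀ := y₀))) {n : ℕ}
    {z : twistedChains β n} (hz : ∀ j, twistedBoundary β n j z = 0) :
    ∃ z' ∈ twistedSpan β (chainsSpan S.IsStraight),
      ∃ w, twistedBoundary β (n + 1) n w = z - z' := by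
  obtain ⟨k, hk⟩ := exists_twistedSubdivision_small S hc z
  obtain ⟨w, hw⟩ := twistedSubdivision_iterate_homologous hz k
  have hz'' (j : ℕ) : twistedBoundary β n j ((twistedSubdivision β n)^[k] z) = 0 := by
    rw [← sub_sub_cancel z ((twistedSubdivision β n)^[k] z), ← hw, map_sub, hz,
      twistedBoundary_twistedBoundary, sub_zero]
  obtain ⟨z', hz', w', hw'⟩ := straighten_homologous S hc hz'' (hk k le_rfl)
  refine ⟨z', hz', w + w', ?_⟩
  rw [map_add, hw, hw']
  abel

theorem twistedHomology_finite_of_straightening {B : Type*} [NormedAddCommGroup B]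
    [NormedSpace ℝ B] (S : StraighteningData Y B)
    (hc : IsCoveringMap (UniversalCover.proj (y₀ := y₀)))
    [IsNoetherianRing R] [Module.Finite R K] (n : ℕ) : Module.Finite R (twistedHomology β n) := by
  let F : Submodule R ((twistedChainComplex β).X n) :=
    twistedSpan β (chainsSpan (n := n) S.IsStraight)
  have : IsNoetherian R F := twistedSpan_straight_fg (β := β) S hc n
  refine homology_finite (C := twistedChainComplex β) F fun z hz => ?_
  obtain ⟨z', hz', w, hw⟩ := exists_straight_homologous S hc (mem_cyclesSubmodule.1 hz)
  exact ⟨z', hz', n + 1, w, hw⟩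

/-- The twisted homology of a compact connected manifold is finite-dimensional. -/
theorem twistedHomology_finite {d : ℕ} {M : Type u} [TopologicalSpace M] [T2Space M]
    [CompactSpace M] [ConnectedSpace M] [ChartedSpace (EuclideanSpace ℝ (Fin d)) M]
    [IsManifold (𝓡 d) ∞ M] {x₀ : M} (β : Representation R (PiOne M x₀)ᵐᵒᵖ K)
    [IsNoetherianRing R] [Module.Finite R K] (n : ℕ) : Module.Finite R (twistedHomology β n) := by
  -- The Whitney embedding is the only use of the smooth structure; everything else needs continuous
  -- charts.
  obtain ⟨N, e, -, he, -⟩ := exists_embedding_euclidean_of_compact (I := 𝓡 d) (M := M)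
  obtain ⟨r, δ, hδ, hr, hre⟩ := exists_neighborhood_retraction (A := EuclideanSpace ℝ (Fin d)) he
  obtain ⟨S⟩ := nonempty_straighteningData ⟨e, he.continuous⟩ hδ hr hre
  have : LocallyPathConnectedSpace M :=
    ChartedSpace.locallyPathConnectedSpace (EuclideanSpace ℝ (Fin d)) M
  have : PathConnectedSpace M := pathConnectedSpace_iff_connectedSpace.2 inferInstance
  exact twistedHomology_finite_of_straightening S (UniversalCover.isQuotientCoveringMap_proj
    (semilocallySimplyConnected_of_charts (A := EuclideanSpace ℝ (Fin d)))).isCoveringMap n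

end Finiteness

/-! ### Universal coverings and covering maps -/

section CoveringLift

variable {E X : Type*} [TopologicalSpace E] [TopologicalSpace X]

theorem cast_trans_cast {a a' b b' c c' : X} (ha : a' = a) (hb : b' = b) (hc : c' = c)
    (p : Path.Homotopic.Quotient a b) (q : Path.Homotopic.Quotient b c) :
    (p.trans q).cast ha hc = (p.cast ha hb).trans (q.cast hb hc) := by
  subst ha hb hc
  simp

theorem trans_left_cancel' {a b c : X} (t : Path.Homotopic.Quotient a b)
    {p q : Path.Homotopic.Quotient b c} (h : t.trans p = t.trans q) : p = q := by
  have := congrArg t.symm.trans h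
  rwa [← trans_assoc', ← trans_assoc', symm_trans', refl_trans', refl_trans'] at this

namespace UniversalCover

/-- The end point of a path from `e₀` is recovered from its image in `X` by monodromy, and a
covering is injective on homotopy classes of paths. -/
theorem lift_injective {f : C(E, X)} (hf : IsCoveringMap f) {e₀ : E} {x₀ : X}
    (τ : Path.Homotopic.Quotient x₀ (f e₀)) : Function.Injective (lift (y₀ := e₀) f τ) := by
  rintro ⟨a, p⟩ ⟨b, q⟩ h
  have h1 : f a = f b := congrArg proj h
  -- The end points `f a` and `f b` are equal only by `h1`; letting the end point vary allows the
  -- cast to be eliminated.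
  have key : ∀ (c : X) (hc : f b = c) (s : Path.Homotopic.Quotient (f e₀) c),
      s = (q.map f).cast rfl hc.symm → (hf.monodromy s ⟨e₀, rfl⟩ : E) = b := by
    rintro _ rfl s rfl
    rw [Path.Homotopic.Quotient.cast_rfl_rfl]
    exact congrArg Subtype.val (hf.monodromy_map q)
  have h2 : τ.trans (p.map f) = (τ.trans (q.map f)).cast rfl h1 := by
    have h' := (UniversalCover.mk.injEq _ _ _ _).mp h
    exact eq_of_heq (h'.2.trans (Path.Homotopic.Quotient.cast_heq rfl h1).symm)
  rw [← trans_cast'] at h2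
  have h3 := trans_left_cancel' τ h2
  obtain rfl : a = b := (congrArg Subtype.val (hf.monodromy_map p)).symm.trans (key _ h1.symm _ h3)
  rw [Path.Homotopic.Quotient.cast_rfl_rfl] at h3
  rw [hf.injective_path_homotopic_map _ _ h3]

theorem lift_surjective {f : C(E, X)} (hf : IsCoveringMap f) {e₀ : E} {x₀ : X}
    (τ : Path.Homotopic.Quotient x₀ (f e₀)) : Function.Surjective (lift (y₀ := e₀) f τ) := by
  rintro ⟨x, c⟩
  obtain ⟨c', rfl⟩ : ∃ c', c = τ.trans c' :=
    ⟨τ.symm.trans c, by rw [← trans_assoc', trans_symm', refl_trans']⟩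
  induction c' using Path.Homotopic.Quotient.ind with
  | mk γ =>
    let Γ := hf.liftPath γ e₀ γ.source
    have hΓ (t) : f (Γ t) = γ t := congrFun (hf.liftPath_lifts γ e₀ γ.source) t
    let P : Path e₀ (Γ 1) := ⟨Γ, hf.liftPath_zero γ e₀ γ.source, rfl⟩
    refine ⟨⟨Γ 1, Path.Homotopic.Quotient.mk P⟩, cover_ext ((hΓ 1).trans γ.target) ?_⟩
    refine (congrArg τ.trans ?_).trans (trans_cast' _ _ _)
    refine congrArg Path.Homotopic.Quotient.mk (Path.ext (funext fun t => hΓ t))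

/-- A local inverse of `f` near the end point of `z` carries paths in `W` to paths in `U`, so the
image of a sheet over `U` contains a sheet over `W`. -/
theorem isOpenMap_lift {f : C(E, X)} (hf : IsCoveringMap f) {e₀ : E} {x₀ : X}
    (τ : Path.Homotopic.Quotient x₀ (f e₀)) : IsOpenMap (lift (y₀ := e₀) f τ) := by
  intro S hS
  refine isOpen_iff_forall_mem_open.2 ?_
  rintro _ ⟨z, hz, rfl⟩
  obtain ⟨U, hU, hzU, h⟩ := exists_sheet_subset hS hz
  obtain ⟨φ, hφ, e⟩ := hf.isLocalHomeomorph z.proj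
  let W : Set X := φ.target ∩ φ.symm ⁻¹' U
  have hW : IsOpen W := φ.isOpen_inter_preimage_symm hU
  refine ⟨(lift f τ z).sheet W, ?_, isOpen_sheet _ hW, mem_sheet_self _ ?_⟩
  · rintro y ⟨γ, hγ, ey⟩
    have hc : Continuous fun t => φ.symm (γ t) :=
      φ.continuousOn_symm.comp_continuous γ.continuous fun t => (hγ t).1
    have hfs (t) : f (φ.symm (γ t)) = γ t := by
      rw [e]; exact φ.right_inv (hγ t).1
    let P : Path z.proj (φ.symm y.proj) := ⟨⟨_, hc⟩, by
      change φ.symm (γ 0) = z.proj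
      rw [γ.source]
      change φ.symm (f z.proj) = z.proj
      rw [e, φ.left_inv hφ], by
      change φ.symm (γ 1) = _
      rw [γ.target]⟩
    have hy : y.proj = f (φ.symm y.proj) := by have := hfs 1; rw [γ.target] at this; exact this.symm
    refine ⟨⟨φ.symm y.proj, z.cls.trans (Path.Homotopic.Quotient.mk P)⟩,
      h ⟨P, fun t => (hγ t).2, rfl⟩, cover_ext hy.symm ?_⟩
    change τ.trans ((z.cls.trans (Path.Homotopic.Quotient.mk P)).map f) = _
    rw [ey, map_trans', ← trans_assoc']
    refine Eq.trans (congrArg _ ?_) (trans_cast' hy.symm _ _)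
    exact congrArg Path.Homotopic.Quotient.mk (Path.ext (funext fun t => hfs t))
  · change f z.proj ∈ W
    rw [e]
    exact ⟨φ.map_source hφ, by rw [Set.mem_preimage, φ.left_inv hφ]; exact hzU⟩

/-- A covering map induces a homeomorphism of universal coverings. -/
def liftHomeomorph {f : C(E, X)} (hf : IsCoveringMap f) {e₀ : E} {x₀ : X}
    (τ : Path.Homotopic.Quotient x₀ (f e₀)) : UniversalCover E e₀ ≃ₜ UniversalCover X x₀ :=
  (Equiv.ofBijective _ ⟨lift_injective hf τ, lift_surjective hf τ⟩).toHomeomorphOfContinuousOpen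
    (lift f τ).continuous (isOpenMap_lift hf τ)

end UniversalCover

end CoveringLift

/-! ### The universal covering of a product with the real line. -/

section ProductWithReals

variable {M : Type u} [TopologicalSpace M] {x₀ : M}

/-- The class of the paths in `ℝ` from `a` to `b`. -/
def realClass (a b : ℝ) : Path.Homotopic.Quotient a b :=
  Path.Homotopic.Quotient.mk (PathConnectedSpace.somePath a b)

theorem realClass_eq {a b : ℝ} (p : Path.Homotopic.Quotient a b) : p = realClass a b :=
  Subsingleton.elim _ _

theorem prod_realClass_trans {a b c : M} {r s t : ℝ} (p : Path.Homotopic.Quotient a b)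
    (q : Path.Homotopic.Quotient b c) : Path.Homotopic.prod (p.trans q) (realClass r t) =
    (Path.Homotopic.prod p (realClass r s)).trans (Path.Homotopic.prod q (realClass s t)) := by
  rw [Path.Homotopic.comp_prod_eq_prod_comp, realClass_eq ((realClass r s).trans _)]

/-- The universal covering of `M × ℝ` is `M̃ × ℝ`. -/
def coverProdReal : UniversalCover M x₀ × ℝ ≃ₜ UniversalCover (M × ℝ) (x₀, (0 : ℝ)) where
  toFun z := ⟨(z.1.proj, z.2), Path.Homotopic.prod z.1.cls (realClass 0 z.2)⟩
  invFun y := (UniversalCover.lift (y₀ := (x₀, (0 : ℝ))) ⟨Prod.fst, continuous_fst⟩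
    (Path.Homotopic.Quotient.refl x₀) y, y.proj.2)
  left_inv z := Prod.ext (UniversalCover.ext rfl (heq_of_eq
    ((refl_trans' _).trans (Path.Homotopic.projLeft_prod _ _)))) rfl
  right_inv y := UniversalCover.ext rfl (heq_of_eq (by
    change Path.Homotopic.prod ((Path.Homotopic.Quotient.refl x₀).trans
      (Path.Homotopic.projLeft y.cls)) _ = y.cls
    rw [refl_trans', ← realClass_eq (Path.Homotopic.projRight y.cls),
      Path.Homotopic.prod_projLeft_projRight]))
  continuous_toFun := by
    refine continuous_generateFrom_iff.2 ?_
    rintro _ ⟨z, U, hU, rfl⟩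
    refine isOpen_iff_forall_mem_open.2 ?_
    rintro ⟨x, s⟩ hx
    have hxU : (x.proj, s) ∈ U := UniversalCover.mem_of_mem_sheet (Set.mem_preimage.1 hx)
    obtain ⟨V, B, hV, hB, hxV, hsB, hVB⟩ := isOpen_prod_iff.1 hU _ _ hxU
    obtain ⟨ε, hε, hεB⟩ := Metric.isOpen_iff.1 hB s hsB
    refine ⟨x.sheet V ×ˢ Metric.ball s ε, ?_, (x.isOpen_sheet hV).prod Metric.isOpen_ball,
      x.mem_sheet_self hxV, Metric.mem_ball_self hε⟩
    rintro ⟨x', s'⟩ ⟨⟨γ, hγ, e⟩, hs'⟩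
    -- The second coordinate is joined within the ball; all paths in `ℝ` with given end points being
    -- homotopic, any such path represents `realClass`.
    have hJ : JoinedIn (Metric.ball s ε) s s' :=
      ((convex_ball s ε).isPathConnected ⟨s, Metric.mem_ball_self hε⟩).joinedIn _
        (Metric.mem_ball_self hε) _ hs'
    refine UniversalCover.sheet_subset hx ⟨γ.prod hJ.somePath,
      fun t => hVB ⟨hγ t, hεB (hJ.somePath_mem t)⟩, ?_⟩
    change Path.Homotopic.prod x'.cls _ = (Path.Homotopic.prod x.cls _).trans _
    rw [e, prod_realClass_trans (s := s), ← realClass_eq (Path.Homotopic.Quotient.mk hJ.somePath)]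
    rfl
  continuous_invFun := ((UniversalCover.lift _ _).continuous).prodMk
    (continuous_snd.comp UniversalCover.continuous_proj)

end ProductWithReals

/-! ### The infinite cyclic covering of the mapping torus -/

namespace MappingTorus

variable {M : Type u} [TopologicalSpace M] (φ : M ≃ₜ M)

/-- The covering `M × ℝ → X`, as a function. -/
def coveringFun (a : M × ℝ) : MappingTorus φ :=
  mk φ ((φ ^ (-⌊a.2⌋)) a.1, ⟨Int.fract a.2, Int.fract_nonneg _, (Int.fract_lt_one _).le⟩)

/-- At the right end of the interval, where `s - n = 1`, the floor jumps to `n + 1`, and the gluing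
relation reconciles the two formulas. So one formula is valid on the whole closed strip. -/
theorem coveringFun_of_mem {x : M} {s : ℝ} {n : ℤ} (h : s - n ∈ unitInterval) :
    coveringFun φ (x, s) = mk φ ((φ ^ (-n)) x, ⟨s - n, h⟩) := by
  obtain ⟨h0, h1⟩ := h
  rcases h1.lt_or_eq with h1 | h1
  · have hn : ⌊s⌋ = n := Int.floor_eq_iff.2 ⟨by linarith, by linarith⟩
    subst hn
    rfl
  · have hs : s = (n + 1 : ℤ) := by push_cast; linarith
    subst hs
    have e1 : (⟨Int.fract ((n + 1 : ℤ) : ℝ), Int.fract_nonneg _, (Int.fract_lt_one _).le⟩ :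
        unitInterval) = 0 := Subtype.ext (Int.fract_intCast _)
    have e2 : (⟨((n + 1 : ℤ) : ℝ) - n, h0, h1.le⟩ : unitInterval) = 1 := Subtype.ext h1
    change mk φ ((φ ^ (-⌊((n + 1 : ℤ) : ℝ)⌋)) x, _) = _
    rw [e1, e2, mk_zero, Int.floor_intCast, neg_add_rev]
    congr 2
    rw [zpow_add, zpow_neg_one]
    exact φ.apply_symm_apply _

theorem coveringFun_unitInterval (x : M) (t : unitInterval) :
    coveringFun φ (x, (t : ℝ)) = mk φ (x, t) := by
  have h : (t : ℝ) - (0 : ℤ) ∈ unitInterval := by simp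
  rw [coveringFun_of_mem φ h]
  congr 2
  exact Subtype.ext (by simp)

/-- The closed strips `M × [n, n + 1]` form a locally finite cover, and on each of them the function
is given by a single continuous formula. -/
theorem continuous_coveringFun : Continuous (coveringFun φ) := by
  have hf : LocallyFinite fun n : ℤ => (Prod.snd : M × ℝ → ℝ) ⁻¹' Set.Icc (n : ℝ) (n + 1) := by
    refine LocallyFinite.preimage_continuous ?_ continuous_snd
    intro x
    refine ⟨Set.Ioo (x - 1) (x + 1), Ioo_mem_nhds (by linarith) (by linarith),
      (Set.finite_Icc (⌊x⌋ - 2) (⌊x⌋ + 2)).subset ?_⟩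
    rintro n ⟨y, ⟨h1, h2⟩, h3, h4⟩
    have := Int.floor_le x
    have := Int.lt_floor_add_one x
    constructor
    · have : ((⌊x⌋ - 3 : ℤ) : ℝ) < n := by push_cast; linarith
      have := Int.cast_lt.1 this
      omega
    · have : (n : ℝ) < ((⌊x⌋ + 3 : ℤ) : ℝ) := by push_cast; linarith
      have := Int.cast_lt.1 this
      omega
  refine hf.continuous ?_ (fun n => isClosed_Icc.preimage continuous_snd) fun n => ?_
  · refine Set.eq_univ_of_forall fun a => Set.mem_iUnion.2 ⟨⌊a.2⌋, Int.floor_le _,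
      (Int.lt_floor_add_one _).le⟩
  · rw [continuousOn_iff_continuous_domRestrict]
    have hm (a : (Prod.snd : M × ℝ → ℝ) ⁻¹' Set.Icc (n : ℝ) (n + 1)) :
        a.1.2 - n ∈ unitInterval := ⟨by linarith [a.2.1], by linarith [a.2.2]⟩
    have e : Set.domRestrict ((Prod.snd : M × ℝ → ℝ) ⁻¹' Set.Icc (n : ℝ) (n + 1)) (coveringFun φ) =
        fun a => mk φ ((φ ^ (-n)) a.1.1, ⟨a.1.2 - n, hm a⟩) :=
      funext fun a => coveringFun_of_mem φ (hm a)
    rw [e]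
    have hc := (φ ^ (-n)).continuous
    fun_prop

/-- The covering `M × ℝ → X`. -/
def covering : C(M × ℝ, MappingTorus φ) := ⟨coveringFun φ, continuous_coveringFun φ⟩

theorem covering_zero (x : M) : covering φ (x, 0) = incl φ x := coveringFun_unitInterval φ x 0

theorem covering_translate (n : ℤ) (a : M × ℝ) :
    covering φ ((φ ^ n) a.1, a.2 + n) = covering φ a := by
  obtain ⟨x, s⟩ := a
  change coveringFun φ _ = _
  have h : s + n - (⌊s⌋ + n : ℤ) ∈ unitInterval := by
    push_cast
    rw [add_sub_add_right_eq_sub]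
    exact ⟨Int.fract_nonneg _, (Int.fract_lt_one _).le⟩
  rw [coveringFun_of_mem φ h]
  refine congrArg (mk φ) (Prod.ext ?_ (Subtype.ext ?_))
  · change ((φ ^ (-(⌊s⌋ + n))) * φ ^ n) x = (φ ^ (-⌊s⌋)) x
    rw [← zpow_add, neg_add, neg_add_cancel_right]
  · change s + n - (⌊s⌋ + n : ℤ) = s - ⌊s⌋
    push_cast
    exact add_sub_add_right_eq_sub _ _ _

/-- The action of `ℤ` on `M × ℝ` by deck transformations. -/
@[reducible] def deckAction : AddAction ℤ (M × ℝ) where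
  vadd n a := ((φ ^ n) a.1, a.2 + n)
  zero_vadd a := Prod.ext (by change (φ ^ (0 : ℤ)) a.1 = a.1; rw [zpow_zero]; rfl)
    (by change a.2 + ((0 : ℤ) : ℝ) = a.2; simp)
  add_vadd m n a := Prod.ext (by
      change (φ ^ (m + n)) a.1 = (φ ^ m) ((φ ^ n) a.1)
      rw [zpow_add]
      rfl)
    (by change a.2 + ((m + n : ℤ) : ℝ) = a.2 + n + m; push_cast; ring)

/-- The inclusion of `M × [0,1]` into `M × ℝ` induces a map `F` from `X` to the orbit space of the
deck action, as `(x, 0)` and `(φ x, 1)` lie in one orbit. Since `F` after the covering is the orbit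
projection, points with the same image share an orbit. -/
theorem exists_translate_of_covering_eq {a b : M × ℝ} (h : covering φ a = covering φ b) :
    ∃ n : ℤ, a = ((φ ^ n) b.1, b.2 + n) := by
  let := deckAction φ
  let F : MappingTorus φ → AddAction.orbitRel.Quotient ℤ (M × ℝ) :=
    Quot.lift (fun a => Quotient.mk'' (a.1, (a.2 : ℝ))) (by
      rintro ⟨x, s⟩ b ⟨hs, rfl⟩
      obtain rfl : s = 0 := hs
      refine _root_.Quotient.sound' ((AddAction.orbitRel ℤ (M × ℝ)).symm ⟨1, ?_⟩)
      refine Prod.ext ?_ ?_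
      · change (φ ^ (1 : ℤ)) x = φ x
        rw [zpow_one]
      · change (0 : ℝ) + ((1 : ℤ) : ℝ) = 1
        norm_num)
  have hF (a : M × ℝ) : F (covering φ a) = Quotient.mk'' a := by
    refine _root_.Quotient.sound' ⟨-⌊a.2⌋, Prod.ext rfl ?_⟩
    change a.2 + ((-⌊a.2⌋ : ℤ) : ℝ) = Int.fract a.2
    push_cast
    rfl
  obtain ⟨n, hn⟩ := _root_.Quotient.exact' ((hF a).symm.trans ((congrArg F h).trans (hF b)))
  exact ⟨n, hn.symm⟩

/-- The map is a quotient map because its restriction to `M × [0,1]` is the defining one of `X`. A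
non-zero integer moves heights by at least `1`, so an open strip of width `1` is disjoint from its
other translates. -/
theorem isCoveringMap_covering : IsCoveringMap (covering φ) := by
  let := deckAction φ
  have h : IsAddQuotientCoveringMap (covering φ) ℤ := 
    { toIsQuotientMap := by
        refine Topology.IsQuotientMap.of_comp (f := fun a : M × unitInterval => (a.1, (a.2 : ℝ)))
          (by fun_prop) (covering φ).continuous ?_
        have e : (covering φ) ∘ (fun a : M × unitInterval => (a.1, (a.2 : ℝ))) = Quot.mk _ :=
          funext fun a => coveringFun_unitInterval φ a.1 a.2
        rw [e]
        exact isQuotientMap_quot_mk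
      continuous_const_vadd := fun n => by
        have hc := (φ ^ n).continuous
        change Continuous fun a : M × ℝ => ((φ ^ n) a.1, a.2 + (n : ℝ))
        fun_prop
      apply_eq_iff_mem_orbit := fun {a b} => by
        refine ⟨fun h => ?_, ?_⟩
        · obtain ⟨n, rfl⟩ := exists_translate_of_covering_eq φ h
          exact ⟨n, rfl⟩
        · rintro ⟨n, rfl⟩
          exact covering_translate φ n b
      disjoint := fun a => by
        refine ⟨Prod.snd ⁻¹' Set.Ioo (a.2 - 1 / 2) (a.2 + 1 / 2),
          continuous_snd.continuousAt.preimage_mem_nhds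
            (Ioo_mem_nhds (by linarith) (by linarith)), fun n => ?_⟩
        rintro ⟨_, ⟨b, ⟨h1, h2⟩, rfl⟩, h3, h4⟩
        change a.2 - 1 / 2 < b.2 + n at h3
        change b.2 + n < a.2 + 1 / 2 at h4
        have h5 : ((-1 : ℤ) : ℝ) < n := by push_cast; linarith
        have h6 : (n : ℝ) < ((1 : ℤ) : ℝ) := by push_cast; linarith
        have := Int.cast_lt.1 h5
        have := Int.cast_lt.1 h6
        omega }
  exact h.isCoveringMap

variable {x₀ : M}

/-- The universal covering of the mapping torus is `M̃ × ℝ`. -/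
def coverHomeomorph : UniversalCover M x₀ × ℝ ≃ₜ UniversalCover (MappingTorus φ) (incl φ x₀) :=
  coverProdReal.trans (UniversalCover.liftHomeomorph (isCoveringMap_covering φ)
    ((Path.Homotopic.Quotient.refl _).cast (covering_zero φ x₀).symm rfl))

theorem coverHomeomorph_cls (x : UniversalCover M x₀) (s : ℝ) :
    (coverHomeomorph φ (x, s)).cls = ((Path.Homotopic.prod x.cls (realClass 0 s)).map
      (covering φ)).cast (covering_zero φ x₀).symm rfl := by
  have key {a b : MappingTorus φ} (h : a = b) {c : MappingTorus φ}
      (p : Path.Homotopic.Quotient b c) :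
      ((Path.Homotopic.Quotient.refl b).cast h rfl).trans p = p.cast h rfl := by
    rw [cast_trans', refl_trans']
  exact key _ _

/-- A path in `M × ℝ` representing `(h • x, s)` may first run through `h` at height `0` and then
follow a path representing `(x, s)`; the first part projects to the image of `h` in `X`. -/
theorem map_incl_smul_coverHomeomorph (h : PiOne M x₀) (x : UniversalCover M x₀) (s : ℝ) :
    PiOne.map (incl φ) x₀ h • coverHomeomorph φ (x, s) = coverHomeomorph φ (h • x, s) := by
  refine UniversalCover.ext rfl (heq_of_eq ?_)
  have key (h : Path.Homotopic.Quotient x₀ x₀) : (h.map (incl φ)).trans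
      (coverHomeomorph φ (x, s)).cls = ((Path.Homotopic.prod (h.trans x.cls)
        (realClass 0 s)).map (covering φ)).cast (covering_zero φ x₀).symm rfl := by
    rw [prod_realClass_trans (s := 0), map_trans',
      cast_trans_cast _ (covering_zero φ x₀).symm rfl, ← coverHomeomorph_cls]
    refine congrArg (fun z => Path.Homotopic.Quotient.trans z _) ?_
    induction h using Path.Homotopic.Quotient.ind with
    | mk γ =>
      rw [← realClass_eq (Path.Homotopic.Quotient.mk (Path.refl (0 : ℝ)))]
      exact congrArg Path.Homotopic.Quotient.mk
        (Path.ext (funext fun t => (covering_zero φ (γ t)).symm))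
  exact (key h).trans (coverHomeomorph_cls φ (h • x) s).symm

/-- A path representing the right-hand side splits into `τ` at height `0`, the vertical segment over
`φ x₀` from `0` to `1`, and the translate by the deck transformation `D` of a path representing `(x,
s)`. The first two pieces project to `u`, and the translate projects to the same path in `X` as the
original. -/
theorem uElt_smul_coverHomeomorph (τ : Path x₀ (φ x₀)) (x : UniversalCover M x₀) (s : ℝ) :
    uElt φ τ • coverHomeomorph φ (x, s) = coverHomeomorph φ (phiLift φ τ x, s + 1) := by
  have hD (a : M × ℝ) : covering φ (φ a.1, a.2 + 1) = covering φ a := by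
    simpa using covering_translate φ 1 a
  let D : C(M × ℝ, M × ℝ) := ⟨fun a => (φ a.1, a.2 + 1), by fun_prop⟩
  have hD' {a b : M × ℝ} (q : Path.Homotopic.Quotient a b) : q.map (covering φ) =
      ((q.map D).map (covering φ)).cast (hD a).symm (hD b).symm := by
    induction q using Path.Homotopic.Quotient.ind with
    | mk γ =>
      exact congrArg Path.Homotopic.Quotient.mk (Path.ext (funext fun t => (hD (γ t)).symm))
  -- The height `0 + 1` is left unevaluated because it is by definition the height of `D (x₀, 0)`.
  have h1 : incl φ x₀ = covering φ (φ x₀, 0 + 1) :=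
    (covering_zero φ x₀).symm.trans (hD (x₀, 0)).symm
  have key {y : M} (T : Path.Homotopic.Quotient x₀ (φ x₀)) (c : Path.Homotopic.Quotient x₀ y) :
      ((T.map (incl φ)).trans (Path.Homotopic.Quotient.mk ((flow φ).evalAt x₀))).trans
        (((Path.Homotopic.prod c (realClass 0 s)).map (covering φ)).cast
          (covering_zero φ x₀).symm rfl) =
      ((Path.Homotopic.prod (T.trans (c.map (φ : C(M, M)))) (realClass 0 (s + 1))).map
        (covering φ)).cast (covering_zero φ x₀).symm (hD (y, s)).symm := by
    have e1 : (Path.Homotopic.prod c (realClass 0 s)).map D =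
        Path.Homotopic.prod (c.map (φ : C(M, M))) (realClass (0 + 1) (s + 1)) := by
      generalize realClass 0 s = r
      induction c using Path.Homotopic.Quotient.ind with
      | mk c =>
        induction r using Path.Homotopic.Quotient.ind with
        | mk r =>
          rw [← realClass_eq (Path.Homotopic.Quotient.mk
            (r.map (f := fun a : ℝ => a + 1) (by fun_prop)))]
          rfl
    have e2 : Path.Homotopic.prod (T.trans (c.map (φ : C(M, M)))) (realClass 0 (s + 1)) =
        (Path.Homotopic.prod T (realClass 0 0)).trans ((Path.Homotopic.prod
          (Path.Homotopic.Quotient.refl (φ x₀)) (realClass 0 (0 + 1))).trans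
            (Path.Homotopic.prod (c.map (φ : C(M, M))) (realClass (0 + 1) (s + 1)))) := by
      rw [← prod_realClass_trans, ← prod_realClass_trans, refl_trans']
    have e3 : ((Path.Homotopic.prod T (realClass 0 0)).map (covering φ)).cast
        (covering_zero φ x₀).symm (covering_zero φ (φ x₀)).symm = T.map (incl φ) := by
      induction T using Path.Homotopic.Quotient.ind with
      | mk γ =>
        rw [← realClass_eq (Path.Homotopic.Quotient.mk (Path.refl (0 : ℝ)))]
        exact congrArg Path.Homotopic.Quotient.mk
          (Path.ext (funext fun t => covering_zero φ (γ t)))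
    have e4 : ((Path.Homotopic.prod (Path.Homotopic.Quotient.refl (φ x₀))
        (realClass 0 (0 + 1))).map (covering φ)).cast (covering_zero φ (φ x₀)).symm h1 =
        Path.Homotopic.Quotient.mk ((flow φ).evalAt x₀) := by
      let r : Path (0 : ℝ) (0 + 1) := ⟨⟨fun t => (t : ℝ), by fun_prop⟩, rfl, by simp⟩
      rw [← realClass_eq (Path.Homotopic.Quotient.mk r)]
      exact congrArg Path.Homotopic.Quotient.mk
        (Path.ext (funext fun t => coveringFun_unitInterval φ (φ x₀) t))
    rw [e2, map_trans', map_trans', cast_trans_cast _ (covering_zero φ (φ x₀)).symm,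
      cast_trans_cast _ h1, e3, e4, trans_assoc', ← e1, hD' (Path.Homotopic.prod c (realClass 0 s)),
      Path.Homotopic.Quotient.cast_cast]
  refine cover_ext (hD (x.proj, s)).symm ?_
  refine (congrArg (Path.Homotopic.Quotient.trans (uElt φ τ)) (coverHomeomorph_cls φ x s)).trans ?_
  refine (key (Path.Homotopic.Quotient.mk τ) x.cls).trans ?_
  refine Eq.symm (Eq.trans (congrArg (fun z : Path.Homotopic.Quotient (incl φ x₀) _ =>
    z.cast rfl (hD (x.proj, s)).symm) (coverHomeomorph_cls φ (phiLift φ τ x) (s + 1))) ?_)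
  exact Path.Homotopic.Quotient.cast_cast _ _ _ _ _

end MappingTorus

namespace MappingTorus

variable {M : Type u} [TopologicalSpace M] (φ : M ≃ₜ M) {x₀ : M}

/-! ### Winding numbers -/

theorem windingNumber_eq_of_lift {e : ℝ} (δ : Path (e : UnitAddCircle) e) (Γ : C(unitInterval, ℝ))
    (h : ∀ t, ((Γ t : ℝ) : UnitAddCircle) = δ t) (h0 : Γ 0 = e) {n : ℤ} (h1 : Γ 1 = e + n) :
    windingNumber e (Path.Homotopic.Quotient.mk δ : Path.Homotopic.Quotient _ _) = n := by
  have key := coe_windingNumber e (Path.Homotopic.Quotient.mk δ : Path.Homotopic.Quotient _ _)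
  have e1 : (Γ : unitInterval → ℝ) =
      (AddCircle.isCoveringMap_coe (1 : ℝ)).liftPath δ e δ.source :=
    ((AddCircle.isCoveringMap_coe (1 : ℝ)).eq_liftPath_iff _).2
      ⟨Γ.continuous, funext h, h0⟩
  have e2 : ((AddCircle.isCoveringMap_coe (1 : ℝ)).monodromy
      (Path.Homotopic.Quotient.mk δ) ⟨e, rfl⟩ : ℝ) = Γ 1 := (congrFun e1 1).symm
  rw [e2, h1] at key
  exact_mod_cast key.trans (add_sub_cancel_left _ _)

theorem xi_map_incl (h : PiOne M x₀) : xi φ x₀ (PiOne.map (incl φ) x₀ h) = 1 := by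
  change Path.Homotopic.Quotient x₀ x₀ at h
  induction h using Path.Homotopic.Quotient.ind with
  | mk γ =>
    exact congrArg Multiplicative.ofAdd (windingNumber_eq_of_lift (e := ((0 : unitInterval) : ℝ))
      ((γ.map (incl φ).continuous).map (toCircle φ).continuous)
      (.const _ 0) (fun t => rfl) rfl (n := 0) (by simp))

theorem xi_uElt (τ : Path x₀ (φ x₀)) : xi φ x₀ (uElt φ τ) = Multiplicative.ofAdd 1 := by
  let c : PiOne UnitAddCircle (((0 : unitInterval) : ℝ) : UnitAddCircle) :=
    Path.Homotopic.Quotient.mk ((τ.map (incl φ).continuous).map (toCircle φ).continuous)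
  let δ : PiOne UnitAddCircle (((0 : unitInterval) : ℝ) : UnitAddCircle) :=
    Path.Homotopic.Quotient.mk (((flow φ).evalAt x₀).map (toCircle φ).continuous)
  have h1 : xi φ x₀ (uElt φ τ) = windingHom ((0 : unitInterval) : ℝ) (c * δ) :=
    congrArg (windingHom ((0 : unitInterval) : ℝ)) (map_trans' (toCircle φ)
      ((Path.Homotopic.Quotient.mk τ).map (incl φ))
      (Path.Homotopic.Quotient.mk ((flow φ).evalAt x₀)))
  have hc : windingHom ((0 : unitInterval) : ℝ) c = 1 :=
    congrArg Multiplicative.ofAdd (windingNumber_eq_of_lift (e := ((0 : unitInterval) : ℝ))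
      ((τ.map (incl φ).continuous).map (toCircle φ).continuous)
      (.const _ 0) (fun t => rfl) rfl (n := 0) (by simp))
  have hδ : windingHom ((0 : unitInterval) : ℝ) δ = Multiplicative.ofAdd 1 :=
    congrArg Multiplicative.ofAdd (windingNumber_eq_of_lift (e := ((0 : unitInterval) : ℝ))
      (((flow φ).evalAt x₀).map (toCircle φ).continuous)
      ⟨fun t => (t : ℝ), by fun_prop⟩ (fun t => rfl) rfl (n := 1) (by simp))
  rw [h1, map_mul, hc, hδ, one_mul]

/-! ### The fibre in the universal covering -/

/-- The retraction of the universal covering of `X` onto that of the fibre. -/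
def fibreProj : C(UniversalCover (MappingTorus φ) (incl φ x₀), UniversalCover M x₀) :=
  ⟨fun z => ((coverHomeomorph φ).symm z).1, by fun_prop⟩

/-- The height function on the universal covering of `X`. -/
def height : C(UniversalCover (MappingTorus φ) (incl φ x₀), ℝ) :=
  ⟨fun z => ((coverHomeomorph φ).symm z).2, by fun_prop⟩

/-- The inclusion of the universal covering of the fibre. -/
def fibreIncl : C(UniversalCover M x₀, UniversalCover (MappingTorus φ) (incl φ x₀)) :=
  ⟨fun x => coverHomeomorph φ (x, 0), by fun_prop⟩

theorem fibreProj_fibreIncl (x : UniversalCover M x₀) : fibreProj φ (fibreIncl φ x) = x :=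
  congrArg Prod.fst ((coverHomeomorph φ).symm_apply_apply (x, 0))

theorem exists_eq_coverHomeomorph (z : UniversalCover (MappingTorus φ) (incl φ x₀)) :
    ∃ x s, z = coverHomeomorph φ (x, s) :=
  ⟨_, _, ((coverHomeomorph φ).apply_symm_apply z).symm⟩

theorem fibreProj_coverHomeomorph (a : UniversalCover M x₀ × ℝ) :
    fibreProj φ (coverHomeomorph φ a) = a.1 :=
  congrArg Prod.fst ((coverHomeomorph φ).symm_apply_apply a)

theorem height_coverHomeomorph (a : UniversalCover M x₀ × ℝ) :
    height φ (coverHomeomorph φ a) = a.2 :=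
  congrArg Prod.snd ((coverHomeomorph φ).symm_apply_apply a)

theorem fibreIncl_smul (h : PiOne M x₀) (x : UniversalCover M x₀) :
    fibreIncl φ (h • x) = PiOne.map (incl φ) x₀ h • fibreIncl φ x :=
  (map_incl_smul_coverHomeomorph φ h x 0).symm

theorem fibreProj_map_incl_smul (h : PiOne M x₀)
    (z : UniversalCover (MappingTorus φ) (incl φ x₀)) :
    fibreProj φ (PiOne.map (incl φ) x₀ h • z) = h • fibreProj φ z := by
  obtain ⟨x, s, rfl⟩ := exists_eq_coverHomeomorph φ z
  rw [map_incl_smul_coverHomeomorph, fibreProj_coverHomeomorph, fibreProj_coverHomeomorph]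

theorem height_map_incl_smul (h : PiOne M x₀)
    (z : UniversalCover (MappingTorus φ) (incl φ x₀)) :
    height φ (PiOne.map (incl φ) x₀ h • z) = height φ z := by
  obtain ⟨x, s, rfl⟩ := exists_eq_coverHomeomorph φ z
  rw [map_incl_smul_coverHomeomorph, height_coverHomeomorph, height_coverHomeomorph]

theorem fibreProj_uElt_smul (τ : Path x₀ (φ x₀))
    (z : UniversalCover (MappingTorus φ) (incl φ x₀)) :
    fibreProj φ (uElt φ τ • z) = phiLift φ τ (fibreProj φ z) := by
  obtain ⟨x, s, rfl⟩ := exists_eq_coverHomeomorph φ z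
  rw [uElt_smul_coverHomeomorph, fibreProj_coverHomeomorph, fibreProj_coverHomeomorph]

theorem height_uElt_smul (τ : Path x₀ (φ x₀))
    (z : UniversalCover (MappingTorus φ) (incl φ x₀)) :
    height φ (uElt φ τ • z) = height φ z + 1 := by
  obtain ⟨x, s, rfl⟩ := exists_eq_coverHomeomorph φ z
  rw [uElt_smul_coverHomeomorph, height_coverHomeomorph, height_coverHomeomorph]

/-- The universal covering of `X` deforms onto that of the fibre. -/
def fibreHomotopy : ((fibreIncl φ).comp (fibreProj (x₀ := x₀) φ)).Homotopy
    (ContinuousMap.id (UniversalCover (MappingTorus φ) (incl φ x₀))) where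
  toFun p := coverHomeomorph φ (fibreProj φ p.2, p.1 * height φ p.2)
  continuous_toFun := by fun_prop
  map_zero_left z := by simp; rfl
  map_one_left z := by
    simp only [Set.Icc.coe_one, one_mul]
    exact (coverHomeomorph φ).apply_symm_apply z

theorem fibreHomotopy_map_incl_smul (h : PiOne M x₀) (s : unitInterval)
    (z : UniversalCover (MappingTorus φ) (incl φ x₀)) :
    fibreHomotopy φ (s, PiOne.map (incl φ) x₀ h • z) =
      PiOne.map (incl φ) x₀ h • fibreHomotopy φ (s, z) := by
  change coverHomeomorph φ _ = _ • coverHomeomorph φ _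
  rw [map_incl_smul_coverHomeomorph, fibreProj_map_incl_smul, height_map_incl_smul]

theorem height_zpow_smul (τ : Path x₀ (φ x₀)) (n : ℤ)
    (z : UniversalCover (MappingTorus φ) (incl φ x₀)) :
    height φ (uElt φ τ ^ n • z) = height φ z + n := by
  have key (n : ℕ) (z : UniversalCover (MappingTorus φ) (incl φ x₀)) :
      height φ (uElt φ τ ^ n • z) = height φ z + n := by
    induction n with
    | zero => simp
    | succ n ih =>
      rw [pow_succ', mul_smul, height_uElt_smul, ih]
      push_cast
      ring
  obtain ⟨n, rfl | rfl⟩ := n.eq_nat_or_neg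
  · simpa using key n z
  · have := key n (uElt φ τ ^ (-(n : ℤ)) • z)
    rw [← zpow_natCast, ← mul_smul, ← zpow_add, add_neg_cancel, zpow_zero, one_smul] at this
    push_cast
    linarith

/-- The kernel of `ξ` is the fundamental group of the fibre. -/
theorem exists_map_incl_eq (τ : Path x₀ (φ x₀)) {g : PiOne (MappingTorus φ) (incl φ x₀)}
    (hg : xi φ x₀ g = 1) : ∃ h, PiOne.map (incl φ) x₀ h = g := by
  let z₀ : UniversalCover M x₀ := ⟨x₀, Path.Homotopic.Quotient.refl x₀⟩
  let z := coverHomeomorph φ (z₀, 0)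
  -- The point `g • z` lies over the base point of `X`, so its height is an integer `n`. Then `u⁻ⁿ
  -- g` moves `z` to a point at height `0` over `x₀`, as some `h` in `π₁(M, x₀)` does; freeness
  -- gives `g = uⁿ h`, and `ξ(g) = 0` forces `n = 0`.
  obtain ⟨y, s, hy⟩ := exists_eq_coverHomeomorph φ (g • z)
  have h1 : covering φ (y.proj, s) = covering φ (x₀, 0) := (congrArg UniversalCover.proj hy).symm
  obtain ⟨n, hn⟩ := exists_translate_of_covering_eq φ h1
  have hs : s = n := by simpa using congrArg Prod.snd hn
  obtain ⟨y', s', hy'⟩ := exists_eq_coverHomeomorph φ (uElt φ τ ^ (-n) • g • z)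
  have hs' : s' = 0 := by
    have := congrArg (height φ) hy'
    rw [height_zpow_smul, hy, height_coverHomeomorph, height_coverHomeomorph] at this
    change s + ((-n : ℤ) : ℝ) = s' at this
    rw [← this, hs]
    simp
  subst hs'
  have h2 : covering φ (y'.proj, 0) = covering φ (x₀, 0) :=
    (congrArg UniversalCover.proj hy').symm
  obtain ⟨m, hm⟩ := exists_translate_of_covering_eq φ h2
  have hm0 : m = 0 := by
    have : (0 : ℝ) = m := by simpa using congrArg Prod.snd hm
    exact_mod_cast this.symm
  subst hm0
  have h3 : y'.proj = z₀.proj := by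
    have := congrArg Prod.fst hm
    rw [zpow_zero] at this
    exact this
  obtain ⟨h, rfl⟩ := UniversalCover.exists_smul_eq h3
  have h4 : (PiOne.map (incl φ) x₀ h)⁻¹ * (uElt φ τ ^ (-n) * g) = 1 := by
    refine UniversalCover.eq_one_of_smul_eq (x := z) ?_
    rw [mul_smul, mul_smul, hy', ← map_incl_smul_coverHomeomorph, inv_smul_smul]
  have h5 : uElt φ τ ^ (-n) * g = PiOne.map (incl φ) x₀ h := (inv_mul_eq_one.1 h4).symm
  have h6 := congrArg (xi φ x₀) h5
  rw [xi_map_incl, map_mul, hg, mul_one, map_zpow, xi_uElt] at h6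
  have h7 : -n = 0 := by simpa using congrArg Multiplicative.toAdd h6
  rw [h7, zpow_zero, one_mul] at h5
  exact ⟨h, h5.symm⟩

end MappingTorus

/-! ### Linear algebra over Laurent polynomials -/

section SelfDuality

variable {k : Type u} [Field k]

open Polynomial in
-- The power `p ^ (e - 1)` generates the socle of the quotient, which lies in every non-zero ideal:
-- the gcd of a representative with `p ^ e` is, up to a unit, `p ^ j` with `j ≤ e - 1`, and Bézout
-- supplies the multiplier.
theorem exists_mul_eq_pow_pred {p : k[X]} (hp : Irreducible p) {e : ℕ}
    {a : k[X] ⧸ Submodule.span k[X] {p ^ e}} (ha : a ≠ 0) :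
    ∃ b : k[X] ⧸ Submodule.span k[X] {p ^ e},
      Ideal.Quotient.mk (Submodule.span k[X] {p ^ e}) (p ^ (e - 1)) = b * a := by
  classical
  obtain ⟨q, rfl⟩ := Ideal.Quotient.mk_surjective a
  have hq : ¬ p ^ e ∣ q := fun h => ha (Ideal.Quotient.eq_zero_iff_mem.2
    (Ideal.mem_span_singleton.2 h))
  obtain ⟨j, hj, hd⟩ := (dvd_prime_pow hp.prime e).1 (EuclideanDomain.gcd_dvd_right q (p ^ e))
  have hje : j ≤ e - 1 := by
    rcases hj.lt_or_eq with h | rfl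
    · omega
    · exact absurd (hd.symm.dvd.trans (EuclideanDomain.gcd_dvd_left _ _)) hq
  obtain ⟨w, hw⟩ := hd.dvd.trans (pow_dvd_pow p hje)
  have hb := EuclideanDomain.gcd_eq_gcd_ab q (p ^ e)
  refine ⟨Ideal.Quotient.mk _ (EuclideanDomain.gcdA q (p ^ e) * w), ?_⟩
  rw [← map_mul, Ideal.Quotient.eq]
  refine Ideal.mem_span_singleton.2 ⟨EuclideanDomain.gcdB q (p ^ e) * w, ?_⟩
  rw [hw, hb]
  ring

open Polynomial in
/-- Cyclic torsion modules over `k[X]` of prime power order carry a nondegenerate functional. -/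
theorem exists_functional {p : k[X]} (hp : Irreducible p) (e : ℕ) :
    ∃ l : (k[X] ⧸ Submodule.span k[X] {p ^ e}) →ₗ[k] k,
      ∀ a, (∀ b : k[X] ⧸ Submodule.span k[X] {p ^ e}, l (b * a) = 0) → a = 0 := by
  -- With truncated subtraction `p ^ (e - 1)` vanishes in the quotient exactly for `e = 0`, when the
  -- module is zero. Otherwise any functional that is non-zero on this socle generator works,
  -- because it cannot vanish on a non-zero ideal.
  by_cases h0 : Ideal.Quotient.mk (Submodule.span k[X] {p ^ e}) (p ^ (e - 1)) = 0
  · refine ⟨0, fun a _ => ?_⟩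
    have h1 := Ideal.mem_span_singleton.1 (Ideal.Quotient.eq_zero_iff_mem.1 h0)
    have h2 : e = 0 := by
      have := (pow_dvd_pow_iff hp.ne_zero hp.not_isUnit).1 h1
      omega
    subst h2
    obtain ⟨q, rfl⟩ := Ideal.Quotient.mk_surjective a
    exact Ideal.Quotient.eq_zero_iff_mem.2 (Ideal.mem_span_singleton.2 (by simp))
  · obtain ⟨l, hl⟩ : ∃ l : Module.Dual k (k[X] ⧸ Submodule.span k[X] {p ^ e}),
        l (Ideal.Quotient.mk (Submodule.span k[X] {p ^ e}) (p ^ (e - 1))) ≠ 0 := by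
      by_contra! h
      exact h0 ((Module.forall_dual_apply_eq_zero_iff k _).1 h)
    refine ⟨l, fun a h => by_contra fun ha => hl ?_⟩
    obtain ⟨b, hb⟩ := exists_mul_eq_pow_pred hp ha
    rw [hb]
    exact h b

variable {N : Type v} [AddCommGroup N] [Module k N] [FiniteDimensional k N]

open Polynomial DirectSum in
/-- Every endomorphism of a finite-dimensional vector space is self-adjoint for some nondegenerate
bilinear form. -/
theorem exists_bilinForm (A : N →ₗ[k] N) : ∃ B : N →ₗ[k] N →ₗ[k] k,
    (∀ x, (∀ y, B x y = 0) → x = 0) ∧ ∀ x y, B (A x) y = B x (A y) := by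
  classical
  -- With `X` acting by `A`, `N` is a sum of cyclic modules of prime power order. The form is the
  -- sum of `l i (x i * y i)` over the summands; multiplication by `X` is self-adjoint because the
  -- product is associative and commutative.
  obtain ⟨ι, _, p, hp, e, ⟨E⟩⟩ := Module.equiv_directSum_of_isTorsion (R := k[X])
    (M := Module.AEval' A) (Module.AEval.isTorsion_of_finiteDimensional k N A)
  choose l hl using fun i => exists_functional (hp i) (e i)
  let π (i : ι) : N →ₗ[k] (k[X] ⧸ Submodule.span k[X] {p i ^ e i}) :=
    ((DirectSum.component k[X] ι _ i ∘ₗ E.toLinearMap).restrictScalars k) ∘ₗ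
      (Module.AEval'.of A).toLinearMap
  have hπ (i : ι) (x : N) : π i (A x) = Ideal.Quotient.mk _ X * π i x := by
    change DirectSum.component k[X] ι _ i (E (Module.AEval'.of A (A x))) = _
    rw [← Module.AEval'.X_smul_of, map_smul, map_smul]
    rfl
  let B : N →ₗ[k] N →ₗ[k] k := ∑ i, ((LinearMap.mul k _).compl₁₂ (π i) (π i)).compr₂ (l i)
  have hB (x y : N) : B x y = ∑ i, l i (π i x * π i y) := by
    simp [B, LinearMap.sum_apply]
  refine ⟨B, fun x hx => ?_, fun x y => ?_⟩
  · have h (i : ι) : π i x = 0 := by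
      refine hl i _ fun b => ?_
      -- Pairing `x` with the elements of the `i`-th summand isolates the `i`-th component, where `l
      -- i` is nondegenerate.
      have h1 := hx ((Module.AEval'.of A).symm (E.symm (DirectSum.lof k[X] ι _ i b)))
      rw [hB] at h1
      have h2 (j : ι) : π j ((Module.AEval'.of A).symm (E.symm (DirectSum.lof k[X] ι _ i b))) =
          DirectSum.lof k[X] ι (fun i => k[X] ⧸ Submodule.span k[X] {p i ^ e i}) i b j := by
        change DirectSum.component k[X] ι _ j (E (Module.AEval'.of A _)) = _
        rw [LinearEquiv.apply_symm_apply, LinearEquiv.apply_symm_apply]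
        rfl
      rw [Finset.sum_eq_single i] at h1
      · rw [h2, DirectSum.lof_apply, mul_comm] at h1
        exact h1
      · intro j _ hj
        rw [h2, DirectSum.lof_eq_of, DirectSum.of_eq_of_ne _ _ _ hj, mul_zero, map_zero]
      · simp
    have h3 : E (Module.AEval'.of A x) = 0 := DFinsupp.ext fun i => h i
    simpa using h3
  · rw [hB, hB]
    refine Finset.sum_congr rfl fun i _ => ?_
    rw [hπ, hπ, mul_assoc, mul_left_comm]

/-- Every endomorphism of a finite-dimensional vector space is conjugate to its transpose. -/
theorem exists_equiv_dual (A : N →ₗ[k] N) :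
    ∃ e : Module.Dual k N ≃ₗ[k] N, ∀ f : Module.Dual k N, e (f ∘ₗ A) = A (e f) := by
  obtain ⟨B, hB, hA⟩ := exists_bilinForm A
  let e : N ≃ₗ[k] Module.Dual k N := LinearEquiv.ofInjectiveOfFinrankEq B
    (LinearMap.ker_eq_bot.1 (LinearMap.ker_eq_bot'.2 fun x hx => hB x fun y => by simp [hx]))
    Subspace.dual_finrank_eq.symm
  refine ⟨e.symm, fun f => ?_⟩
  rw [LinearEquiv.symm_apply_eq]
  refine LinearMap.ext fun y => ?_
  change f (A y) = B (A (e.symm f)) y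
  rw [hA]
  exact (LinearMap.congr_fun (e.apply_symm_apply f) (A y)).symm

end SelfDuality

/-! ### Laurent-polynomial-valued functionals on a vector space with an automorphism. -/

section Laurent

local notation "𝕃" => LaurentPolynomial ℂ

/-- A map of modules over `ℂ[t, t⁻¹]` is linear if it commutes with scalars and with `t`. -/
def laurentLinearMap {P Q : Type*} [AddCommGroup P] [AddCommGroup Q] [Module 𝕃 P] [Module 𝕃 Q]
    (F : P →+ Q)
    (hC : ∀ (c : ℂ) x, F ((LaurentPolynomial.C c : 𝕃) • x) = (LaurentPolynomial.C c : 𝕃) • F x)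
    (hT : ∀ x, F ((LaurentPolynomial.T 1 : 𝕃) • x) = (LaurentPolynomial.T 1 : 𝕃) • F x) :
    P →ₗ[𝕃] Q :=
  { F with
    map_smul' := fun p x => by
      change F (p • x) = p • F x
      have hT' (x : P) : F ((LaurentPolynomial.T (-1) : 𝕃) • x) =
          (LaurentPolynomial.T (-1) : 𝕃) • F x := by
        have h := hT ((LaurentPolynomial.T (-1) : 𝕃) • x)
        rw [← mul_smul, ← LaurentPolynomial.T_add, add_neg_cancel, LaurentPolynomial.T_zero,
          one_smul] at h
        rw [h, ← mul_smul, ← LaurentPolynomial.T_add, neg_add_cancel, LaurentPolynomial.T_zero,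
          one_smul]
      induction p using LaurentPolynomial.induction_on generalizing x with
      | h_C a => exact hC a x
      | h_add hp hq => rw [add_smul, map_add, hp, hq, add_smul]
      | h_C_mul_T n a h =>
        rw [LaurentPolynomial.T_add, ← mul_assoc, mul_smul, h, hT, ← mul_smul]
      | h_C_mul_T_Z n a h =>
        rw [sub_eq_add_neg, LaurentPolynomial.T_add, ← mul_assoc, mul_smul, h, hT', ← mul_smul] }

variable {N : Type w} [AddCommGroup N] [Module ℂ N]

/-- The identity of `N`, regarded as a map to `LaurentModule f`. -/
def LaurentModule.of (f : N ≃ₗ[ℂ] N) : N ≃+ LaurentModule f := AddEquiv.refl N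

theorem LaurentModule.C_smul_of (f : N ≃ₗ[ℂ] N) (c : ℂ) (x : N) :
    (LaurentPolynomial.C c : 𝕃) • LaurentModule.of f x = LaurentModule.of f (c • x) :=
  LaurentModule.C_smul f c x

theorem LaurentModule.T_smul_of (f : N ≃ₗ[ℂ] N) (x : N) :
    (LaurentPolynomial.T 1 : 𝕃) • LaurentModule.of f x = LaurentModule.of f (f x) :=
  LaurentModule.T_smul f x

/-- Conjugate automorphisms give isomorphic modules. -/
def LaurentModule.congr {N' : Type v} [AddCommGroup N'] [Module ℂ N'] {f : N ≃ₗ[ℂ] N}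
    {g : N' ≃ₗ[ℂ] N'} (e : N ≃ₗ[ℂ] N') (h : ∀ x, e (f x) = g (e x)) :
    LaurentModule f ≃ₗ[𝕃] LaurentModule g :=
  LinearEquiv.ofBijective (laurentLinearMap
    (((LaurentModule.of f).symm.trans e.toAddEquiv).trans (LaurentModule.of g)).toAddMonoidHom
    (fun c x => by
      obtain ⟨x, rfl⟩ := (LaurentModule.of f).surjective x
      simp [LaurentModule.C_smul_of])
    (fun x => by
      obtain ⟨x, rfl⟩ := (LaurentModule.of f).surjective x
      simp [LaurentModule.T_smul_of, h]))
    (((LaurentModule.of f).symm.trans e.toAddEquiv).trans (LaurentModule.of g)).bijective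

/-- The endomorphism `F ↦ t⁻¹ F ∘ A` of `Hom(N, ℂ[t, t⁻¹])`. -/
def homTwist (A : N ≃ₗ[ℂ] N) : (N →ₗ[ℂ] 𝕃) →ₗ[𝕃] (N →ₗ[ℂ] 𝕃) where
  toFun F := (LaurentPolynomial.T (-1) : 𝕃) • (F ∘ₗ A.toLinearMap)
  map_add' F G := by rw [LinearMap.add_comp, smul_add]
  map_smul' p F := by rw [LinearMap.smul_comp, smul_comm]; rfl

variable (A : N ≃ₗ[ℂ] N)

theorem homTwist_smulRight (f : Module.Dual ℂ N) (p : 𝕃) : homTwist A (f.smulRight p) =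
    ((f ∘ₗ A.toLinearMap).smulRight (LaurentPolynomial.T (-1) * p)) := by
  refine LinearMap.ext fun x => ?_
  change (LaurentPolynomial.T (-1) : 𝕃) • (f (A x) • p) = f (A x) • (LaurentPolynomial.T (-1) * p)
  rw [smul_comm, smul_eq_mul]

/-- The map `f ↦ f ⊗ 1` from `N*` to the cokernel of `F ↦ t⁻¹ F ∘ A - F`. -/
def toHomCokernel : LaurentModule A.dualMap →ₗ[𝕃]
    ((N →ₗ[ℂ] 𝕃) ⧸ LinearMap.range (homTwist A - LinearMap.id)) :=
  laurentLinearMap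
    { toFun := fun f =>
        (LinearMap.range (homTwist A - LinearMap.id)).mkQ
          (((LaurentModule.of A.dualMap).symm f).smulRight (1 : 𝕃))
      map_zero' := by
        rw [map_zero, ← map_zero (Submodule.mkQ _)]
        exact congrArg _ (LinearMap.ext fun x => zero_smul _ _)
      map_add' := fun f g => by
        rw [map_add, ← map_add (Submodule.mkQ _)]
        exact congrArg _ (LinearMap.ext fun x => add_smul _ _ _) }
    (fun c f => by
      obtain ⟨f, rfl⟩ := (LaurentModule.of A.dualMap).surjective f
      rw [LaurentModule.C_smul_of]
      simp only [AddMonoidHom.coe_mk, ZeroHom.coe_mk, AddEquiv.symm_apply_apply]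
      rw [← map_smul]
      refine congrArg _ (LinearMap.ext fun x => ?_)
      change (c * f x) • (1 : 𝕃) = LaurentPolynomial.C c * (f x • (1 : 𝕃))
      rw [mul_smul, LaurentPolynomial.smul_eq_C_mul])
    (fun f => by
      obtain ⟨f, rfl⟩ := (LaurentModule.of A.dualMap).surjective f
      rw [LaurentModule.T_smul_of]
      simp only [AddMonoidHom.coe_mk, ZeroHom.coe_mk, AddEquiv.symm_apply_apply]
      rw [← map_smul]
      -- The twist sends `f ⊗ t` to `f ∘ A ⊗ 1`, so the difference `f ∘ A ⊗ 1 - t (f ⊗ 1)` is the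
      -- image of `f ⊗ t`.
      refine (Submodule.Quotient.eq _).2 ⟨f.smulRight (LaurentPolynomial.T 1), ?_⟩
      rw [LinearMap.sub_apply, homTwist_smulRight, ← LaurentPolynomial.T_add]
      refine congrArg₂ _ ?_ (LinearMap.ext fun x => ?_)
      · rw [neg_add_cancel, LaurentPolynomial.T_zero]
        rfl
      · change f x • (LaurentPolynomial.T 1 : 𝕃) = (LaurentPolynomial.T 1 : 𝕃) • (f x • (1 : 𝕃))
        rw [smul_comm, smul_eq_mul, mul_one])

theorem toHomCokernel_smul_of (f : Module.Dual ℂ N) (p : 𝕃) :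
    toHomCokernel A (p • LaurentModule.of A.dualMap f) = Submodule.mkQ _ (f.smulRight p) := by
  rw [map_smul]
  change p • Submodule.mkQ _ (f.smulRight (1 : 𝕃)) = _
  rw [← map_smul]
  refine congrArg _ (LinearMap.ext fun x => ?_)
  change p • (f x • (1 : 𝕃)) = f x • p
  rw [smul_comm, smul_eq_mul, mul_one]

variable [FiniteDimensional ℂ N]

/-- Because `N` has a finite basis, every map to Laurent polynomials is a finite sum of maps `f ⊗ a`
of rank at most one. -/
theorem hom_induction {p : (N →ₗ[ℂ] 𝕃) → Prop} (zero : p 0) (add : ∀ F G, p F → p G → p (F + G))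
    (smulRight : ∀ (f : Module.Dual ℂ N) (a : 𝕃), p (f.smulRight a)) (F : N →ₗ[ℂ] 𝕃) : p F := by
  let b := Module.finBasis ℂ N
  have h : F = ∑ i, (b.coord i).smulRight (F (b i)) := by
    refine b.ext fun j => ?_
    rw [LinearMap.sum_apply, Finset.sum_eq_single j]
    · simp
    · intro i _ hij
      simp [Finsupp.single_eq_of_ne hij]
    · simp
  rw [h]
  exact Finset.sum_induction _ p add zero fun i _ => smulRight _ _

theorem exists_coeff_bound (F : N →ₗ[ℂ] 𝕃) : ∃ B : ℤ, ∀ x, ∀ j ≥ B, (F x).coeff j = 0 := by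
  induction F using hom_induction with
  | zero => exact ⟨0, fun _ _ _ => rfl⟩
  | add F G hF hG =>
    obtain ⟨B, hB⟩ := hF
    obtain ⟨B', hB'⟩ := hG
    refine ⟨max B B', fun x j hj => ?_⟩
    rw [LinearMap.add_apply, AddMonoidAlgebra.coeff_add, Finsupp.add_apply,
      hB x j (le_of_max_le_left hj), hB' x j (le_of_max_le_right hj), add_zero]
  | smulRight f a =>
    obtain ⟨B, hB⟩ := a.coeff.support.bddAbove
    refine ⟨B + 1, fun x j hj => ?_⟩
    have h0 : a.coeff j = 0 := by
      by_contra h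
      have := hB (Finsupp.mem_support_iff.2 h)
      omega
    rw [LinearMap.smulRight_apply, AddMonoidAlgebra.coeff_smul_apply, h0, smul_zero]

/-- For a fixed `F` the coefficient of `F x` in degree `j` equals that of `F (A ^ m x)` in degree `j
+ m`, for every `m`. The degrees of all values of `F` have a common upper bound, since `N` is
finite-dimensional, so the coefficient is zero. -/
theorem homTwist_sub_id_injective :
    Function.Injective (homTwist A - LinearMap.id : (N →ₗ[ℂ] 𝕃) →ₗ[𝕃] (N →ₗ[ℂ] 𝕃)) := by
  refine (injective_iff_map_eq_zero _).2 fun F hF => ?_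
  have h (x : N) (j : ℤ) : (F x).coeff j = (F (A x)).coeff (j + 1) := by
    have h1 : (LaurentPolynomial.T (-1) : 𝕃) * F (A x) = F x :=
      LinearMap.congr_fun (sub_eq_zero.1 hF) x
    rw [← h1, LaurentPolynomial.T, AddMonoidAlgebra.coeff_single_mul_apply, one_mul, neg_neg,
      add_comm]
  have h' (m : ℕ) (x : N) (j : ℤ) : (F x).coeff j = (F ((A ^ m) x)).coeff (j + m) := by
    induction m with
    | zero => simp
    | succ m ih =>
      rw [ih, h, pow_succ']
      push_cast
      rw [add_assoc]
      rfl
  obtain ⟨B, hB⟩ := exists_coeff_bound F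
  refine LinearMap.ext fun x => LaurentPolynomial.ext fun j => ?_
  refine (h' (B - j).toNat x j).trans (hB _ _ ?_)
  have := Int.self_le_toNat (B - j)
  omega

/-- The map `Hom(N, ℂ[t, t⁻¹]) → N*` that sends `f ⊗ p` to `p f`, where `t` acts on `N*` by the
transpose of `A`. -/
def homEval : (N →ₗ[ℂ] 𝕃) →ₗ[𝕃] LaurentModule A.dualMap where
  toFun F := ∑ i, F (Module.finBasis ℂ N i) •
    LaurentModule.of A.dualMap ((Module.finBasis ℂ N).coord i)
  map_add' F G := by simp only [LinearMap.add_apply, add_smul, Finset.sum_add_distrib]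
  map_smul' p F := by
    simp only [LinearMap.smul_apply, smul_eq_mul, mul_smul, Finset.smul_sum, RingHom.id_apply]

theorem homEval_smulRight (f : Module.Dual ℂ N) (p : 𝕃) :
    homEval A (f.smulRight p) = p • LaurentModule.of A.dualMap f := by
  have h (c : ℂ) (g : Module.Dual ℂ N) : (c • p) • LaurentModule.of A.dualMap g =
      p • LaurentModule.of A.dualMap (c • g) := by
    rw [← LaurentModule.C_smul_of, ← mul_smul, mul_comm, LaurentPolynomial.smul_eq_C_mul]
  change ∑ i, (f (Module.finBasis ℂ N i) • p) • LaurentModule.of A.dualMap _ = _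
  simp only [h]
  rw [← Finset.smul_sum, ← map_sum, (Module.finBasis ℂ N).sum_dual_apply_smul_coord f]

theorem homEval_homTwist (F : N →ₗ[ℂ] 𝕃) : homEval A (homTwist A F) = homEval A F := by
  induction F using hom_induction with
  | zero => simp
  | add F G hF hG => rw [map_add, map_add, hF, hG, map_add]
  | smulRight f p =>
    have h : LaurentModule.of A.dualMap (f ∘ₗ A.toLinearMap) =
        (LaurentPolynomial.T 1 : 𝕃) • LaurentModule.of A.dualMap f :=
      (LaurentModule.T_smul_of A.dualMap f).symm
    rw [homTwist_smulRight, homEval_smulRight, homEval_smulRight, h, ← mul_smul, mul_right_comm,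
      ← LaurentPolynomial.T_add, neg_add_cancel, LaurentPolynomial.T_zero, one_mul]

/-- The cokernel of `F ↦ t⁻¹ F ∘ A - F` on `Hom(N, ℂ[t, t⁻¹])`. -/
def homCokernelEquiv : ((N →ₗ[ℂ] 𝕃) ⧸ LinearMap.range (homTwist A - LinearMap.id)) ≃ₗ[𝕃]
    LaurentModule A.dualMap :=
  LinearEquiv.ofLinearMap (Submodule.liftQ _ (homEval A) (by
      rintro _ ⟨F, rfl⟩
      rw [LinearMap.mem_ker, LinearMap.sub_apply, map_sub, homEval_homTwist]
      exact sub_self _)) (toHomCokernel A)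
    (by
      refine LinearMap.ext fun f => ?_
      obtain ⟨f, rfl⟩ := (LaurentModule.of A.dualMap).surjective f
      have h := toHomCokernel_smul_of A f 1
      rw [one_smul] at h
      rw [LinearMap.comp_apply, h, Submodule.mkQ_apply, Submodule.liftQ_apply, homEval_smulRight,
        one_smul, LinearMap.id_apply])
    (by
      refine Submodule.linearMap_qext _ (LinearMap.ext fun F => ?_)
      change toHomCokernel A (homEval A F) = Submodule.mkQ _ F
      induction F using hom_induction with
      | zero => simp
      | add F F' hF hF' => rw [map_add, map_add, hF, hF', map_add]
      | smulRight f p => rw [homEval_smulRight, toHomCokernel_smul_of])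

/-- Suppose that a module `P` over `ℂ[t, t⁻¹]` with an endomorphism `U` maps onto
`Hom(N, ℂ[t, t⁻¹])` with the endomorphism `F ↦ t⁻¹ F ∘ A`, and that the kernel is in the image of
`U - 1`. Then the cokernel of `U - 1` is isomorphic to `N`, on which `t` acts by `A`. -/
theorem nonempty_equiv_of_conj {P P' : Type*} [AddCommGroup P] [Module 𝕃 P]
    [AddCommGroup P'] [Module 𝕃 P'] {U : P →ₗ[𝕃] P} {κ : P →ₗ[𝕃] (N →ₗ[ℂ] 𝕃)}
    (hκ : ∀ x, κ (U x) = homTwist A (κ x)) (hκs : Function.Surjective κ)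
    (hκ0 : ∀ x, κ x = 0 → ∃ y, U y - y = x) (δ : P →ₗ[𝕃] P') (hδ : Function.Surjective δ)
    (hker : ∀ x, δ x = 0 ↔ ∃ y, U y - y = x) : Nonempty (P' ≃ₗ[𝕃] LaurentModule A) := by
  -- The cokernel is computed with the transpose of `A`; this conjugation brings back `A`.
  obtain ⟨e, he⟩ := exists_equiv_dual A.toLinearMap
  let R := LinearMap.range (homTwist A - LinearMap.id)
  let ψ : P →ₗ[𝕃] ((N →ₗ[ℂ] 𝕃) ⧸ R) := R.mkQ ∘ₗ κ
  have hψ : Function.Surjective ψ := R.mkQ_surjective.comp hκs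
  have h : LinearMap.ker δ = LinearMap.ker ψ := by
    ext x
    rw [LinearMap.mem_ker, hker, LinearMap.mem_ker, LinearMap.comp_apply, Submodule.mkQ_apply,
      Submodule.Quotient.mk_eq_zero]
    constructor
    · rintro ⟨y, rfl⟩
      exact ⟨κ y, by simp [hκ]⟩
    · rintro ⟨G, hG⟩
      obtain ⟨y, rfl⟩ := hκs G
      -- After subtracting `U y - y`, where `y` lifts `G`, the image under `κ` is zero, so the
      -- hypothesis on the kernel of `κ` applies.
      obtain ⟨y', hy'⟩ := hκ0 (x - (U y - y)) (by
        rw [map_sub, map_sub, hκ, ← hG]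
        simp)
      refine ⟨y' + y, ?_⟩
      rw [map_add, add_sub_add_comm, hy', sub_add_cancel]
  exact ⟨((δ.quotKerEquivOfSurjective hδ).symm.trans (Submodule.quotEquivOfEq _ _ h)).trans
    ((ψ.quotKerEquivOfSurjective hψ).trans
      ((homCokernelEquiv A).trans (LaurentModule.congr e fun f => he f)))⟩

theorem eq_zero_of_homTwist_eq {F : N →ₗ[ℂ] 𝕃} (hF : homTwist A F = F) : F = 0 := by
  refine (homTwist_sub_id_injective A).eq_iff.1 ?_
  rw [LinearMap.sub_apply, hF]
  simp

end Laurent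

/-! ### Cochains with values in `ℂ[t, t⁻¹] ⊗ V` and chains with values in the dual of `V` -/

section Pairing

local notation "𝕃" => LaurentPolynomial ℂ

variable {V : Type w} [AddCommGroup V] [Module ℂ V]

/-- The functional on `ℂ[t, t⁻¹] ⊗ V` given by a functional on `V`. -/
def evalDual : Module.Dual ℂ V →ₗ[ℂ] (𝕃 ⊗[ℂ] V →ₗ[𝕃] 𝕃) := Module.Dual.baseChange 𝕃

theorem evalDual_tmul (v : Module.Dual ℂ V) (p : 𝕃) (x : V) :
    evalDual v (p ⊗ₜ[ℂ] x) = v x • p := by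
  simp [evalDual]

theorem evalDual_baseChange (v : Module.Dual ℂ V) (f : V →ₗ[ℂ] V) (x : 𝕃 ⊗[ℂ] V) :
    evalDual v (f.baseChange 𝕃 x) = evalDual (v ∘ₗ f) x := by
  induction x using TensorProduct.induction_on with
  | zero => simp
  | tmul p x => rw [LinearMap.baseChange_tmul, evalDual_tmul, evalDual_tmul]; rfl
  | add x y hx hy => rw [map_add, map_add, hx, hy, map_add]

theorem sum_evalDual_tmul [FiniteDimensional ℂ V] (x : 𝕃 ⊗[ℂ] V) :
    ∑ i, evalDual ((Module.finBasis ℂ V).coord i) x ⊗ₜ[ℂ] Module.finBasis ℂ V i = x := by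
  induction x using TensorProduct.induction_on with
  | zero => simp
  | tmul p x =>
    simp only [evalDual_tmul, TensorProduct.smul_tmul]
    rw [← TensorProduct.tmul_sum]
    exact congrArg _ ((Module.finBasis ℂ V).sum_repr x)
  | add x y hx hy =>
    simp only [map_add, TensorProduct.add_tmul, Finset.sum_add_distrib, hx, hy]

theorem evalDual_ext [FiniteDimensional ℂ V] {x y : 𝕃 ⊗[ℂ] V}
    (h : ∀ v, evalDual v x = evalDual v y) : x = y := by
  rw [← sum_evalDual_tmul x, ← sum_evalDual_tmul y]
  simp only [h]

variable {Y : Type u} [TopologicalSpace Y] {y₀ : Y}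

/-- A representation on `ℂ[t, t⁻¹] ⊗ V` and an antirepresentation on the dual of `V` are adjoint. -/
def IsAdjoint (σ : Representation 𝕃 (PiOne Y y₀) (𝕃 ⊗[ℂ] V))
    (β : Representation ℂ (PiOne Y y₀)ᵐᵒᵖ (Module.Dual ℂ V)) : Prop :=
  ∀ g v x, evalDual v (σ g x) = evalDual (β (MulOpposite.op g) v) x

variable {σ : Representation 𝕃 (PiOne Y y₀) (𝕃 ⊗[ℂ] V)}
  {β : Representation ℂ (PiOne Y y₀)ᵐᵒᵖ (Module.Dual ℂ V)} (h : IsAdjoint σ β)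

/-- The pairing of cochains with `v ⊗ c`. -/
def pairingAux {n : ℕ} (f : (singularChains (UniversalCover Y y₀)).X n →ₗ[ℤ] 𝕃 ⊗[ℂ] V) :
    (Module.Dual ℂ V) ⊗[ℤ] (singularChains (UniversalCover Y y₀)).X n →ₗ[ℂ] 𝕃 :=
  TensorProduct.AlgebraTensorModule.lift
    { toFun := fun v => ((evalDual v).restrictScalars ℤ) ∘ₗ f
      map_add' := fun v v' => by ext; simp
      map_smul' := fun c v => by ext; simp }

theorem pairingAux_tmul {n : ℕ}
    (f : (singularChains (UniversalCover Y y₀)).X n →ₗ[ℤ] 𝕃 ⊗[ℂ] V)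
    (v : Module.Dual ℂ V) (c : (singularChains (UniversalCover Y y₀)).X n) :
    pairingAux f (v ⊗ₜ[ℤ] c) = evalDual v (f c) := rfl

/-- The pairing of twisted cochains and twisted chains. -/
def pairing (n : ℕ) : twistedCochains σ n →ₗ[𝕃] (twistedChains β n →ₗ[ℂ] 𝕃) where
  toFun f := Submodule.liftQ _ (pairingAux f.1) (by
    refine Submodule.span_le.2 ?_
    rintro _ ⟨v, g, c, rfl⟩
    rw [SetLike.mem_coe, LinearMap.mem_ker, map_sub, pairingAux_tmul, pairingAux_tmul, f.2, h]
    exact sub_self _)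
  map_add' _ _ := twistedChains_ext fun v c => map_add (evalDual v) _ _
  map_smul' p _ := twistedChains_ext fun v c => map_smul (evalDual v) p _

theorem pairing_mk {n : ℕ} (f : twistedCochains σ n) (v : Module.Dual ℂ V)
    (c : (singularChains (UniversalCover Y y₀)).X n) :
    pairing h n f (twistedMk β v c) = evalDual v (f.1 c) := rfl

theorem pairing_coboundary {i j : ℕ} (f : twistedCochains σ i) (z : twistedChains β j) :
    pairing h j (coboundary σ i j f) z = pairing h i f (twistedBoundary β j i z) := by
  suffices e : pairing h j (coboundary σ i j f) = pairing h i f ∘ₗ twistedBoundary β j i from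
    LinearMap.congr_fun e z
  exact twistedChains_ext fun v c => rfl

/-! ### Cohomology classes as functionals on homology -/

theorem exists_section (k : ℕ) : ∃ s : twistedHomology β k →ₗ[ℂ]
    cyclesSubmodule (twistedChainComplex β) k,
      homologyClass (twistedChainComplex β) k ∘ₗ s = LinearMap.id :=
  LinearMap.exists_rightInverse_of_surjective _
    (LinearMap.range_eq_top.2 (homologyClass_surjective _ k))

/-- The functional on the homology given by a cochain; it is canonical for cocycles. -/
def cohomologyEval (k : ℕ) : twistedCochains σ k →ₗ[𝕃] (twistedHomology β k →ₗ[ℂ] 𝕃) where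
  toFun f := (show (twistedChainComplex β).X k →ₗ[ℂ] 𝕃 from pairing h k f) ∘ₗ
    (cyclesSubmodule (twistedChainComplex β) k).subtype ∘ₗ (exists_section k).choose
  map_add' f f' := by rw [map_add]; rfl
  map_smul' p f := by rw [map_smul]; rfl

/-- The chosen section and `z` represent the same class, so they differ by a boundary, on which a
cocycle vanishes. -/
theorem cohomologyEval_homologyClass {k : ℕ} {f : twistedCochains σ k}
    (hf : ∀ j, coboundary σ k j f = 0) (z : cyclesSubmodule (twistedChainComplex β) k) :
    cohomologyEval h k f (homologyClass (twistedChainComplex β) k z) =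
      pairing h k f (show twistedChains β k from z.1) := by
  let s := (exists_section (β := β) k).choose
  have hs := LinearMap.congr_fun (exists_section (β := β) k).choose_spec
    (homologyClass (twistedChainComplex β) k z)
  have h1 : homologyClass (twistedChainComplex β) k
      (s (homologyClass (twistedChainComplex β) k z) - z) = 0 := by
    rw [map_sub]
    exact sub_eq_zero.2 hs
  obtain ⟨j, w, hw⟩ := (homologyClass_eq_zero _).1 h1
  have h2 := pairing_coboundary h f (show twistedChains β j from w)
  rw [hf, map_zero] at h2
  have h3 : pairing h k f (show twistedChains β k from
      ((s (homologyClass (twistedChainComplex β) k z) - z :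
        cyclesSubmodule (twistedChainComplex β) k) : (twistedChainComplex β).X k)) = 0 :=
    (congrArg (pairing h k f) hw).symm.trans h2.symm
  exact sub_eq_zero.1 ((map_sub (pairing h k f) _ _).symm.trans h3)

variable [FiniteDimensional ℂ V]

theorem pairing_injective (n : ℕ) : Function.Injective (pairing h n) := fun _ _ e =>
  Subtype.ext (LinearMap.ext fun c => evalDual_ext fun v => LinearMap.congr_fun e (twistedMk β v c))

/-- In a basis of `V` the cochain is `c ↦ ∑ F(bᵢ* ⊗ c) ⊗ bᵢ`; its equivariance is dual to the
relations of the tensor product. Together with `pairing_injective`, this identifies twisted cochains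
with functionals on twisted chains, so that universal coefficients over `ℂ` apply. -/
theorem pairing_surjective (n : ℕ) : Function.Surjective (pairing h n) := fun F => by
  let b := Module.finBasis ℂ V
  let f' : (singularChains (UniversalCover Y y₀)).X n →+ 𝕃 ⊗[ℂ] V :=
    { toFun := fun c => ∑ i, F (twistedMk β (b.coord i) c) ⊗ₜ[ℂ] b i
      map_zero' := by simp only [twistedMk_zero, map_zero, TensorProduct.zero_tmul,
        Finset.sum_const_zero]
      map_add' := fun c c' => by simp only [twistedMk_add, map_add, TensorProduct.add_tmul,
        Finset.sum_add_distrib] }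
  let f : (singularChains (UniversalCover Y y₀)).X n →ₗ[ℤ] 𝕃 ⊗[ℂ] V :=
    { f' with map_smul' := fun m c => by simpa using map_intCast_smul f' ℤ ℤ m c }
  have hf (v : Module.Dual ℂ V) (c : (singularChains (UniversalCover Y y₀)).X n) :
      evalDual v (f c) = F (twistedMk β v c) := by
    let T : Module.Dual ℂ V →ₗ[ℂ] twistedChains β n :=
      (Submodule.mkQ _) ∘ₗ ((TensorProduct.AlgebraTensorModule.mk ℤ ℂ _ _).flip c)
    have hT (v) : F (twistedMk β v c) = F (T v) := rfl
    change evalDual v (∑ i, F (twistedMk β (b.coord i) c) ⊗ₜ[ℂ] b i) = _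
    simp only [map_sum, evalDual_tmul, hT]
    conv_rhs => rw [← b.sum_dual_apply_smul_coord v]
    simp only [map_sum, map_smul]
  refine ⟨⟨f, fun g c => evalDual_ext fun v => ?_⟩, twistedChains_ext fun v c => hf v c⟩
  rw [hf, h, hf, twistedMk_act]

/-- Pull the functional back to cycles and extend it linearly to all chains, which is possible over
a field; it kills boundaries, so the corresponding cochain is a cocycle. -/
theorem cohomologyEval_surjective (k : ℕ) (F : twistedHomology β k →ₗ[ℂ] 𝕃) :
    ∃ f : twistedCochains σ k, (∀ j, coboundary σ k j f = 0) ∧ cohomologyEval h k f = F := by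
  obtain ⟨Φ, hΦ⟩ := LinearMap.exists_extend
    (F ∘ₗ homologyClass (twistedChainComplex β) k)
  obtain ⟨f, hf⟩ := pairing_surjective h k (show twistedChains β k →ₗ[ℂ] 𝕃 from Φ)
  have hΦ' (z : cyclesSubmodule (twistedChainComplex β) k) :
      Φ z = F (homologyClass (twistedChainComplex β) k z) := LinearMap.congr_fun hΦ z
  have hc (j : ℕ) : coboundary σ k j f = 0 := by
    refine pairing_injective h j (LinearMap.ext fun w => ?_)
    rw [pairing_coboundary, hf, map_zero]
    have hz : (show (twistedChainComplex β).X k from twistedBoundary β j k w) ∈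
        cyclesSubmodule (twistedChainComplex β) k :=
      mem_cyclesSubmodule.2 fun i => twistedBoundary_twistedBoundary j k i w
    refine (hΦ' ⟨_, hz⟩).trans ?_
    rw [(homologyClass_eq_zero _).2 ⟨j, w, rfl⟩, map_zero]
    rfl
  refine ⟨f, hc, LinearMap.ext fun x => ?_⟩
  obtain ⟨z, rfl⟩ := homologyClass_surjective _ _ x
  rw [cohomologyEval_homologyClass h hc, hf]
  exact hΦ' z

theorem exists_comp_eq {A B C : Type*} [AddCommGroup A] [AddCommGroup B] [AddCommGroup C]
    [Module ℂ A] [Module ℂ B] [Module ℂ C] (f : A →ₗ[ℂ] B) (g : A →ₗ[ℂ] C)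
    (hfg : ∀ x, f x = 0 → g x = 0) : ∃ e : B →ₗ[ℂ] C, e ∘ₗ f = g := by
  obtain ⟨e, he⟩ := LinearMap.exists_extend
    ((LinearMap.ker f).liftQ g (fun x hx => hfg x hx) ∘ₗ f.quotKerEquivRange.symm.toLinearMap)
  refine ⟨e, LinearMap.ext fun x => ?_⟩
  have h1 := LinearMap.congr_fun he (f.quotKerEquivRange (Submodule.Quotient.mk x))
  rw [LinearMap.comp_apply, LinearMap.comp_apply, LinearEquiv.coe_coe,
    LinearEquiv.symm_apply_apply] at h1
  exact h1

/-- The functional of `f` vanishes on cycles, hence factors through the boundary map, and the factor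
extends from the image to all chains. In degree `0` every chain is a cycle, so `f` itself is zero.
-/
theorem exists_coboundary_of_cohomologyEval_eq_zero {k : ℕ} {f : twistedCochains σ k}
    (hf : ∀ j, coboundary σ k j f = 0) (h0 : cohomologyEval h k f = 0) :
    ∃ j, ∃ g : twistedCochains σ j, coboundary σ j k g = f := by
  have h1 (z : twistedChains β k) (hz : ∀ j, twistedBoundary β k j z = 0) :
      pairing h k f z = 0 := by
    have h2 := cohomologyEval_homologyClass h hf ⟨z, mem_cyclesSubmodule.2 hz⟩
    rw [h0] at h2
    exact h2.symm
  cases k with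
  | zero =>
    refine ⟨0, 0, ?_⟩
    rw [map_zero]
    refine (pairing_injective h 0 (LinearMap.ext fun z => ?_)).symm
    rw [h1 z fun j => twistedBoundary_shape (by simp) z, map_zero]
    rfl
  | succ k =>
    obtain ⟨G, hG⟩ := exists_comp_eq (twistedBoundary β (k + 1) k) (pairing h (k + 1) f)
      fun z hz => h1 z fun j => by
        by_cases hj : j = k
        · rw [hj, hz]
        · exact twistedBoundary_shape (by simpa using hj) z
    obtain ⟨g, hg⟩ := pairing_surjective h k G
    refine ⟨k, g, pairing_injective h _ (LinearMap.ext fun z => ?_)⟩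
    rw [pairing_coboundary, hg]
    exact LinearMap.congr_fun hG z

end Pairing

/-! ### Cochains of an infinite cyclic covering -/

section RunningSum

variable {K : Type*} [AddCommGroup K]

/-- The sum `a 1 + ... + a n`, extended to negative `n`. -/
def runningSum (a : ℤ → K) (n : ℤ) : K :=
  ∑ m ∈ Finset.Ioc 0 n, a m - ∑ m ∈ Finset.Ioc n 0, a m

theorem runningSum_zero (a : ℤ → K) : runningSum a 0 = 0 := by simp [runningSum]

theorem runningSum_add_one (a : ℤ → K) (n : ℤ) :
    runningSum a (n + 1) = runningSum a n + a (n + 1) := by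
  unfold runningSum
  rcases le_or_gt 0 n with h | h
  · have e1 : Finset.Ioc 0 (n + 1) = insert (n + 1) (Finset.Ioc 0 n) := by
      ext m
      simp only [Finset.mem_Ioc, Finset.mem_insert]
      omega
    have e2 : Finset.Ioc (n + 1) 0 = ∅ := Finset.Ioc_eq_empty (by omega)
    have e3 : Finset.Ioc n 0 = ∅ := Finset.Ioc_eq_empty (by omega)
    rw [e1, Finset.sum_insert (by simp), e2, e3]
    simp [add_comm]
  · have e1 : Finset.Ioc n 0 = insert (n + 1) (Finset.Ioc (n + 1) 0) := by
      ext m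
      simp only [Finset.mem_Ioc, Finset.mem_insert]
      omega
    have e2 : Finset.Ioc 0 (n + 1) = ∅ := Finset.Ioc_eq_empty (by omega)
    have e3 : Finset.Ioc 0 n = ∅ := Finset.Ioc_eq_empty (by omega)
    rw [e1, Finset.sum_insert (by simp), e2, e3]
    simp

/-- For `n ≥ 0` reindexing prepends the term `a 0`. This extra term is what makes the antidifference
invert `U - 1`. -/
theorem runningSum_shift (a : ℤ → K) (n : ℤ) :
    runningSum (fun m => a (m - 1)) (n + 1) = runningSum a n + a 0 := by
  induction n using Int.induction_on with
  | zero => rw [runningSum_add_one, runningSum_zero, runningSum_zero]; simp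
  | succ n ih => rw [runningSum_add_one, ih, runningSum_add_one]; simp; abel
  | pred n ih =>
    have h1 := runningSum_add_one (fun m => a (m - 1)) (-(n : ℤ) - 1 + 1)
    have h2 := runningSum_add_one a (-(n : ℤ) - 1)
    rw [sub_add_cancel] at h1 h2 ⊢
    rw [ih, h2, add_sub_cancel_right, add_right_comm] at h1
    exact (add_right_cancel h1).symm

theorem map_runningSum {K' : Type*} [AddCommGroup K'] (f : K →+ K') (a : ℤ → K) (n : ℤ) :
    f (runningSum a n) = runningSum (fun m => f (a m)) n := by
  simp [runningSum]

end RunningSum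

/-! ### Invariant cochains and the connecting map. -/

section CyclicCovering

variable {Y : Type u} [TopologicalSpace Y] {y₀ : Y}
variable {R : Type v} [CommRing R] {K : Type w} [AddCommGroup K] [Module R K]

theorem chainsMap_act_mul (g h : PiOne Y y₀) (n : ℕ)
    (c : (singularChains (UniversalCover Y y₀)).X n) :
    chainsMap (UniversalCover.act (g * h)) n c =
      chainsMap (UniversalCover.act g) n (chainsMap (UniversalCover.act h) n c) := by
  have e : UniversalCover.act (g * h) = (UniversalCover.act g).comp (UniversalCover.act h) :=
    ContinuousMap.ext fun z => mul_smul g h z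
  rw [e, chainsMap_comp]
  rfl

theorem chainsMap_act_one (n : ℕ) (c : (singularChains (UniversalCover Y y₀)).X n) :
    chainsMap (UniversalCover.act (1 : PiOne Y y₀)) n c = c := by
  have e : UniversalCover.act (1 : PiOne Y y₀) = ContinuousMap.id _ :=
    ContinuousMap.ext fun z => one_smul _ z
  rw [e, chainsMap_id]
  rfl

variable (ρ : Representation R (PiOne Y y₀) K)

/-- The cochain `c ↦ g⁻¹ f(g c)`. -/
def translate (g : PiOne Y y₀) (n : ℕ) :
    ((singularChains (UniversalCover Y y₀)).X n →ₗ[ℤ] K) →ₗ[R]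
      ((singularChains (UniversalCover Y y₀)).X n →ₗ[ℤ] K) where
  toFun f := ((ρ g⁻¹).restrictScalars ℤ) ∘ₗ f ∘ₗ chainsMap (UniversalCover.act g) n
  map_add' _ _ := LinearMap.ext fun _ => map_add (ρ g⁻¹) _ _
  map_smul' r _ := LinearMap.ext fun _ => map_smul (ρ g⁻¹) r _

theorem translate_apply (g : PiOne Y y₀) {n : ℕ}
    (f : (singularChains (UniversalCover Y y₀)).X n →ₗ[ℤ] K)
    (c : (singularChains (UniversalCover Y y₀)).X n) :
    translate ρ g n f c = ρ g⁻¹ (f (chainsMap (UniversalCover.act g) n c)) := rfl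

theorem translate_translate (g h : PiOne Y y₀) {n : ℕ}
    (f : (singularChains (UniversalCover Y y₀)).X n →ₗ[ℤ] K) :
    translate ρ g n (translate ρ h n f) = translate ρ (h * g) n f := by
  refine LinearMap.ext fun c => ?_
  rw [translate_apply, translate_apply, translate_apply, chainsMap_act_mul, mul_inv_rev, map_mul]
  rfl

theorem translate_one {n : ℕ} (f : (singularChains (UniversalCover Y y₀)).X n →ₗ[ℤ] K) :
    translate ρ 1 n f = f := by
  refine LinearMap.ext fun c => ?_
  rw [translate_apply, chainsMap_act_one, inv_one, map_one]
  rfl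

theorem translate_boundary (g : PiOne Y y₀) {i j : ℕ}
    (f : (singularChains (UniversalCover Y y₀)).X j →ₗ[ℤ] K) :
    translate ρ g i (f ∘ₗ boundary _ i j) = translate ρ g j f ∘ₗ boundary _ i j := by
  refine LinearMap.ext fun c => congrArg (fun x => ρ g⁻¹ (f x)) ?_
  exact LinearMap.congr_fun (boundary_chainsMap (UniversalCover.act g) i j) c

theorem translate_eq_self_iff {g : PiOne Y y₀} {n : ℕ}
    {f : (singularChains (UniversalCover Y y₀)).X n →ₗ[ℤ] K} : translate ρ g n f = f ↔
      ∀ c, f (chainsMap (UniversalCover.act g) n c) = ρ g (f c) := by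
  refine ⟨fun h c => ?_, fun h => LinearMap.ext fun c => ?_⟩
  · conv_rhs => rw [← h]
    rw [translate_apply, Representation.self_inv_apply]
  · rw [translate_apply, h, Representation.inv_self_apply]

/-- The cochains that are equivariant under a subgroup. -/
def invariantCochains (N : Subgroup (PiOne Y y₀)) (n : ℕ) :
    Submodule R ((singularChains (UniversalCover Y y₀)).X n →ₗ[ℤ] K) :=
  ⨅ g ∈ N, LinearMap.eqLocus (translate ρ g n) LinearMap.id

variable {ρ} {N : Subgroup (PiOne Y y₀)}

theorem mem_invariantCochains {n : ℕ}
    {f : (singularChains (UniversalCover Y y₀)).X n →ₗ[ℤ] K} :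
    f ∈ invariantCochains ρ N n ↔ ∀ g ∈ N, translate ρ g n f = f := by
  simp [invariantCochains, Submodule.mem_iInf]

theorem translate_mem_invariantCochains [N.Normal] (g : PiOne Y y₀) {n : ℕ}
    {f : (singularChains (UniversalCover Y y₀)).X n →ₗ[ℤ] K} (hf : f ∈ invariantCochains ρ N n) :
    translate ρ g n f ∈ invariantCochains ρ N n := mem_invariantCochains.2 fun h hh => by
  have e : g * h = (g * h * g⁻¹) * g := by group
  rw [translate_translate, e, ← translate_translate, mem_invariantCochains.1 hf _
    (Subgroup.Normal.conj_mem inferInstance h hh g)]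

theorem boundary_mem_invariantCochains {i j : ℕ}
    {f : (singularChains (UniversalCover Y y₀)).X j →ₗ[ℤ] K} (hf : f ∈ invariantCochains ρ N j) :
    f ∘ₗ boundary _ i j ∈ invariantCochains ρ N i := mem_invariantCochains.2 fun g hg => by
  rw [translate_boundary, mem_invariantCochains.1 hf g hg]

variable (ρ N) in
/-- The cocycles among the cochains that are equivariant under a subgroup. -/
def invariantCocycles (n : ℕ) :
    Submodule R ((singularChains (UniversalCover Y y₀)).X n →ₗ[ℤ] K) where
  carrier := {f | f ∈ invariantCochains ρ N n ∧ ∀ j, f ∘ₗ boundary _ j n = 0}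
  add_mem' {f f'} hf hf' := ⟨add_mem hf.1 hf'.1, fun j => by
    rw [LinearMap.add_comp, hf.2, hf'.2, add_zero]⟩
  zero_mem' := ⟨zero_mem _, fun j => LinearMap.zero_comp _⟩
  smul_mem' r f hf := ⟨Submodule.smul_mem _ r hf.1, fun j => by
    rw [LinearMap.smul_comp, hf.2, smul_zero]⟩

theorem comp_boundary_mem_invariantCocycles {i j : ℕ}
    {f : (singularChains (UniversalCover Y y₀)).X j →ₗ[ℤ] K} (hf : f ∈ invariantCochains ρ N j) :
    f ∘ₗ boundary _ i j ∈ invariantCocycles ρ N i :=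
  ⟨boundary_mem_invariantCochains hf, fun k => by
    rw [LinearMap.comp_assoc, boundary_comp, LinearMap.comp_zero]⟩

variable (ρ N) in
/-- Translation of cocycles. -/
def translateCocycles [N.Normal] (g : PiOne Y y₀) (n : ℕ) :
    invariantCocycles ρ N n →ₗ[R] invariantCocycles ρ N n :=
  (translate ρ g n).restrict fun f hf => ⟨translate_mem_invariantCochains g hf.1, fun j => by
    rw [← translate_boundary, hf.2, map_zero]⟩

variable (ρ) (u : PiOne Y y₀) (η : C(UniversalCover Y y₀, ℝ))

/-- A right inverse of `f ↦ (c ↦ u⁻¹ f(u c) - f(c))`, given by a height function. -/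
def antidifference (n : ℕ) : ((singularChains (UniversalCover Y y₀)).X n →ₗ[ℤ] K) →ₗ[R]
    ((singularChains (UniversalCover Y y₀)).X n →ₗ[ℤ] K) where
  -- The height of a simplex is read off at one fixed point of the simplex. This is not compatible
  -- with faces, so the operator does not commute with the coboundary; the defect is what yields the
  -- connecting map.
  toFun b := chainsLift fun σ => runningSum
    (fun m => translate ρ (u ^ (-m)) n b (ofSimplex σ)) ⌊η (σ (Classical.arbitrary _))⌋
  map_add' b b' := chains_hom_ext fun σ => by
    rw [LinearMap.add_apply, chainsLift_ofSimplex, chainsLift_ofSimplex, chainsLift_ofSimplex]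
    simp only [runningSum, map_add, LinearMap.add_apply, Finset.sum_add_distrib]
    abel
  map_smul' r b := chains_hom_ext fun σ => by
    rw [RingHom.id_apply, LinearMap.smul_apply, chainsLift_ofSimplex, chainsLift_ofSimplex]
    simp only [runningSum, map_smul, LinearMap.smul_apply, Finset.smul_sum, smul_sub]

theorem antidifference_ofSimplex {n : ℕ} (b : (singularChains (UniversalCover Y y₀)).X n →ₗ[ℤ] K)
    (σ : C(Simplex n, UniversalCover Y y₀)) : antidifference ρ u η n b (ofSimplex σ) = runningSum
      (fun m => translate ρ (u ^ (-m)) n b (ofSimplex σ)) ⌊η (σ (Classical.arbitrary _))⌋ :=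
  chainsLift_ofSimplex _ _

variable {u η}

/-- Applying `u` raises the integer part of the height by one and shifts the index of the translates
by one; by `runningSum_shift` the change is the term with `m = 0`, which is `b`. -/
theorem translate_antidifference (hu : ∀ z, η (u • z) = η z + 1) {n : ℕ}
    (b : (singularChains (UniversalCover Y y₀)).X n →ₗ[ℤ] K) :
    translate ρ u n (antidifference ρ u η n b) = antidifference ρ u η n b + b := by
  refine chains_hom_ext fun σ => ?_
  have h1 : ⌊η (((UniversalCover.act u).comp σ) (Classical.arbitrary _))⌋ =
      ⌊η (σ (Classical.arbitrary _))⌋ + 1 := by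
    change ⌊η (u • _)⌋ = _
    rw [hu, Int.floor_add_one]
  have h2 (m : ℤ) : ρ u⁻¹ (translate ρ (u ^ (-m)) n b (ofSimplex ((UniversalCover.act u).comp σ))) =
      translate ρ (u ^ (-(m - 1))) n b (ofSimplex σ) := by
    have e : u ^ (-(m - 1)) = u ^ (-m) * u := by rw [neg_sub, sub_eq_neg_add, zpow_add_one]
    rw [e, ← translate_translate, ← chainsMap_ofSimplex]
    rfl
  rw [translate_apply, chainsMap_ofSimplex, LinearMap.add_apply, antidifference_ofSimplex,
    antidifference_ofSimplex, h1]
  refine (map_runningSum (ρ u⁻¹ : K →+ K) _ _).trans ?_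
  change runningSum (fun m => ρ u⁻¹ _) _ = _
  simp only [h2]
  rw [runningSum_shift (fun m => translate ρ (u ^ (-m)) n b (ofSimplex σ)), neg_zero, zpow_zero,
    translate_one]

variable {ρ}

/-- Elements of `N` preserve heights, hence the range of summation, and each summand is invariant
because `N` is normal. -/
theorem antidifference_mem_invariantCochains [N.Normal] (hN : ∀ g ∈ N, ∀ z, η (g • z) = η z)
    {n : ℕ} {b : (singularChains (UniversalCover Y y₀)).X n →ₗ[ℤ] K}
    (hb : b ∈ invariantCochains ρ N n) :
    antidifference ρ u η n b ∈ invariantCochains ρ N n := mem_invariantCochains.2 fun g hg => by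
  refine chains_hom_ext fun σ => ?_
  have h1 : ⌊η (((UniversalCover.act g).comp σ) (Classical.arbitrary _))⌋ =
      ⌊η (σ (Classical.arbitrary _))⌋ := by
    change ⌊η (g • _)⌋ = _
    rw [hN g hg]
  have h2 (m : ℤ) : ρ g⁻¹ (translate ρ (u ^ (-m)) n b (ofSimplex ((UniversalCover.act g).comp σ))) =
      translate ρ (u ^ (-m)) n b (ofSimplex σ) := by
    have h3 := mem_invariantCochains.1 (translate_mem_invariantCochains (u ^ (-m)) hb) g hg
    conv_rhs => rw [← h3, translate_apply, chainsMap_ofSimplex]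
  rw [translate_apply, chainsMap_ofSimplex, antidifference_ofSimplex,
    antidifference_ofSimplex, h1]
  refine (map_runningSum (ρ g⁻¹ : K →+ K) _ _).trans ?_
  change runningSum (fun m => ρ g⁻¹ _) _ = _
  simp only [h2]

theorem translate_zpow_eq_self {n : ℕ} {f : (singularChains (UniversalCover Y y₀)).X n →ₗ[ℤ] K}
    (h : translate ρ u n f = f) (m : ℤ) : translate ρ (u ^ m) n f = f := by
  induction m using Int.induction_on with
  | zero => rw [zpow_zero, translate_one]
  | succ m ih => rw [zpow_add_one, ← translate_translate, ih, h]
  | pred m ih =>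
    conv_lhs => rw [← h]
    rw [translate_translate, ← zpow_one_add, add_sub_cancel]
    exact ih

theorem mem_twistedCochains (hgen : ∀ g, ∃ m : ℤ, ∃ h ∈ N, g = u ^ m * h) {n : ℕ}
    {f : (singularChains (UniversalCover Y y₀)).X n →ₗ[ℤ] K} (hf : f ∈ invariantCochains ρ N n)
    (hu : translate ρ u n f = f) : f ∈ twistedCochains ρ n := fun g => by
  rw [← translate_eq_self_iff]
  obtain ⟨m, h, hh, rfl⟩ := hgen g
  rw [← translate_translate, translate_zpow_eq_self hu, mem_invariantCochains.1 hf h hh]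

theorem twistedCochains_translate {n : ℕ} (f : twistedCochains ρ n) (g : PiOne Y y₀) :
    translate ρ g n f.1 = f.1 := (translate_eq_self_iff ρ).2 (f.2 g)

variable (ρ N) in
/-- The cochains that are coboundaries of cochains equivariant under a subgroup. -/
def IsInvariantCoboundary : ∀ k : ℕ, ((singularChains (UniversalCover Y y₀)).X k →ₗ[ℤ] K) → Prop
  | 0, f => f = 0
  | k + 1, f => ∃ g ∈ invariantCochains ρ N k, g ∘ₗ boundary _ (k + 1) k = f

theorem isInvariantCoboundary_comp {j k : ℕ}
    {g : (singularChains (UniversalCover Y y₀)).X j →ₗ[ℤ] K} (hg : g ∈ invariantCochains ρ N j) :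
    IsInvariantCoboundary ρ N k (g ∘ₗ boundary _ k j) := by
  cases k with
  | zero =>
    change g ∘ₗ _ = 0
    rw [boundary_shape _ _ _ (by simp), LinearMap.comp_zero]
  | succ k =>
    by_cases hj : j = k
    · subst hj
      exact ⟨g, hg, rfl⟩
    · refine ⟨0, zero_mem _, ?_⟩
      rw [LinearMap.zero_comp, boundary_shape _ _ _ (by simpa using hj), LinearMap.comp_zero]

theorem IsInvariantCoboundary.exists_comp {k : ℕ}
    {f : (singularChains (UniversalCover Y y₀)).X k →ₗ[ℤ] K} (hf : IsInvariantCoboundary ρ N k f) :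
    ∃ j, ∃ g ∈ invariantCochains ρ N j, g ∘ₗ boundary _ k j = f := by
  cases k with
  | zero => exact ⟨0, 0, zero_mem _, (LinearMap.zero_comp _).trans hf.symm⟩
  | succ k => exact ⟨k, hf⟩

theorem IsInvariantCoboundary.add {k : ℕ}
    {f f' : (singularChains (UniversalCover Y y₀)).X k →ₗ[ℤ] K}
    (hf : IsInvariantCoboundary ρ N k f) (hf' : IsInvariantCoboundary ρ N k f') :
    IsInvariantCoboundary ρ N k (f + f') := by
  cases k with
  | zero =>
    change f + f' = 0
    rw [show f = 0 from hf, show f' = 0 from hf', add_zero]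
  | succ k =>
    obtain ⟨g, hg, rfl⟩ := hf
    obtain ⟨g', hg', rfl⟩ := hf'
    exact ⟨g + g', add_mem hg hg', LinearMap.add_comp _ _ _⟩

/-- If `f` is the coboundary of `g`, the coboundary of the antidifference of `g` is the required
cocycle, since translation commutes with the coboundary. -/
theorem IsInvariantCoboundary.exists_translate_sub [N.Normal]
    (hN : ∀ g ∈ N, ∀ z, η (g • z) = η z) (hu : ∀ z, η (u • z) = η z + 1) {k : ℕ}
    {f : invariantCocycles ρ N k} (hf : IsInvariantCoboundary ρ N k f.1) :
    ∃ y, translateCocycles ρ N u k y - y = f := by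
  obtain ⟨j, g, hg, e⟩ := hf.exists_comp
  refine ⟨⟨antidifference ρ u η j g ∘ₗ boundary _ k j,
    comp_boundary_mem_invariantCocycles (antidifference_mem_invariantCochains hN hg)⟩,
    Subtype.ext ?_⟩
  change translate ρ u k (antidifference ρ u η j g ∘ₗ _) - antidifference ρ u η j g ∘ₗ _ = f.1
  rw [translate_boundary, translate_antidifference ρ hu, LinearMap.add_comp, add_sub_cancel_left, e]

variable (u η ρ) in
/-- The coboundary of the antidifference of a cocycle. -/
def connecting [N.Normal] (hN : ∀ g ∈ N, ∀ z, η (g • z) = η z) (hu : ∀ z, η (u • z) = η z + 1)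
    (hgen : ∀ g, ∃ m : ℤ, ∃ h ∈ N, g = u ^ m * h) (k : ℕ) :
    invariantCocycles ρ N k →ₗ[R] twistedCohomology ρ (k + 1) :=
  homologyClass (twistedCochainComplex ρ) (k + 1) ∘ₗ
    { toFun := fun b => ⟨⟨antidifference ρ u η k b.1 ∘ₗ boundary _ (k + 1) k, by
        refine mem_twistedCochains hgen (boundary_mem_invariantCochains
          (antidifference_mem_invariantCochains hN b.2.1)) ?_
        rw [translate_boundary, translate_antidifference ρ hu, LinearMap.add_comp, b.2.2,
          add_zero]⟩, mem_cyclesSubmodule.2 fun j => Subtype.ext (by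
            change (antidifference ρ u η k b.1 ∘ₗ boundary _ (k + 1) k) ∘ₗ boundary _ j (k + 1) = 0
            rw [LinearMap.comp_assoc, boundary_comp, LinearMap.comp_zero])⟩
      map_add' := fun b b' => Subtype.ext (Subtype.ext (by
        change antidifference ρ u η k (b.1 + b'.1) ∘ₗ _ = _
        rw [map_add, LinearMap.add_comp]
        rfl))
      map_smul' := fun r b => Subtype.ext (Subtype.ext (by
        change antidifference ρ u η k (r • b.1) ∘ₗ _ = _
        rw [map_smul, LinearMap.smul_comp]
        rfl)) }

variable [N.Normal] (hN : ∀ g ∈ N, ∀ z, η (g • z) = η z) (hu : ∀ z, η (u • z) = η z + 1)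
    (hgen : ∀ g, ∃ m : ℤ, ∃ h ∈ N, g = u ^ m * h) (k : ℕ)

theorem homologyClass_eq_zero_iff {k : ℕ} (z : cyclesSubmodule (twistedCochainComplex ρ) (k + 1)) :
    homologyClass (twistedCochainComplex ρ) (k + 1) z = 0 ↔
      ∃ f : twistedCochains ρ k, f.1 ∘ₗ boundary _ (k + 1) k =
        (show twistedCochains ρ (k + 1) from z.1).1 := by
  rw [homologyClass_eq_zero]
  constructor
  · rintro ⟨j, w, hw⟩
    by_cases hj : j = k
    · subst hj
      exact ⟨w, congrArg Subtype.val hw⟩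
    · refine ⟨0, ?_⟩
      have h := (twistedCochainComplex ρ).shape j (k + 1) (by simpa using hj)
      rw [h] at hw
      exact (LinearMap.zero_comp _).trans (congrArg Subtype.val hw)
  · rintro ⟨f, hf⟩
    exact ⟨k, f, Subtype.ext hf⟩

/-- Let `S b` be the antidifference. The class is zero when `S b` has the same coboundary as some
twisted cochain `f`; then `y = S b - f` is a cocycle, and `U y - y = b` because `U f = f`.
Conversely, a solution `y` makes `S b - y` a twisted cochain with the coboundary of `S b`. -/
theorem connecting_eq_zero_iff (b : invariantCocycles ρ N k) :
    connecting ρ u η hN hu hgen k b = 0 ↔ ∃ y, translateCocycles ρ N u k y - y = b := by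
  refine (homologyClass_eq_zero_iff _).trans ?_
  constructor
  · rintro ⟨f, hf⟩
    replace hf : f.1 ∘ₗ boundary _ (k + 1) k =
      antidifference ρ u η k b.1 ∘ₗ boundary _ (k + 1) k := hf
    have hfN : f.1 ∈ invariantCochains ρ N k :=
      mem_invariantCochains.2 fun g _ => twistedCochains_translate f g
    refine ⟨⟨antidifference ρ u η k b.1 - f.1, sub_mem
      (antidifference_mem_invariantCochains hN b.2.1) hfN, fun j => ?_⟩, Subtype.ext ?_⟩
    · by_cases hj : k + 1 = j
      · subst hj
        rw [LinearMap.sub_comp, hf, sub_self]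
      · rw [boundary_shape _ _ _ (by simpa using hj), LinearMap.comp_zero]
    · change translate ρ u k (antidifference ρ u η k b.1 - f.1) -
        (antidifference ρ u η k b.1 - f.1) = b.1
      rw [map_sub, translate_antidifference ρ hu, twistedCochains_translate]
      abel
  · rintro ⟨y, rfl⟩
    -- The cochains `S (U y - y)` and `y` have the same image under `U - 1`, so their difference is
    -- fixed by `U`.
    have hz : translate ρ u k (antidifference ρ u η k (translate ρ u k y.1 - y.1) - y.1) =
        antidifference ρ u η k (translate ρ u k y.1 - y.1) - y.1 := by
      rw [map_sub, translate_antidifference ρ hu]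
      abel
    refine ⟨⟨antidifference ρ u η k (translate ρ u k y.1 - y.1) - y.1,
      mem_twistedCochains hgen (sub_mem (antidifference_mem_invariantCochains hN
        (sub_mem (translate_mem_invariantCochains u y.2.1) y.2.1)) y.2.1) hz⟩, ?_⟩
    change (antidifference ρ u η k (translate ρ u k y.1 - y.1) - y.1) ∘ₗ _ =
      antidifference ρ u η k (translate ρ u k y.1 - y.1) ∘ₗ _
    rw [LinearMap.sub_comp, y.2.2, sub_zero]

/-- Write the twisted cocycle `p` as the coboundary of an invariant cochain `f`. Since `U p = p`,
the cochain `b = U f - f` is a cocycle. Its antidifference minus `f` is fixed by `U`, hence is a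
twisted cochain, and its coboundary is the difference between the image of `b` and `p`. -/
theorem connecting_surjective (hvan : ∀ p ∈ invariantCocycles ρ N (k + 1),
    translate ρ u (k + 1) p = p → IsInvariantCoboundary ρ N (k + 1) p) :
    Function.Surjective (connecting ρ u η hN hu hgen k) := by
  intro x
  obtain ⟨z, rfl⟩ := homologyClass_surjective _ _ x
  let p : twistedCochains ρ (k + 1) := z.1
  have hp (j : ℕ) : p.1 ∘ₗ boundary _ j (k + 1) = 0 :=
    congrArg Subtype.val (mem_cyclesSubmodule.1 z.2 j)
  obtain ⟨f, hf, hfp⟩ := hvan p.1 ⟨mem_invariantCochains.2 fun g _ =>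
    twistedCochains_translate p g, hp⟩ (twistedCochains_translate p u)
  have hb : translate ρ u k f - f ∈ invariantCocycles ρ N k := by
    refine ⟨sub_mem (translate_mem_invariantCochains u hf) hf, fun j => ?_⟩
    by_cases hj : k + 1 = j
    · subst hj
      rw [LinearMap.sub_comp, ← translate_boundary, hfp, twistedCochains_translate, sub_self]
    · rw [boundary_shape _ _ _ (by simpa using hj), LinearMap.comp_zero]
  refine ⟨⟨_, hb⟩, sub_eq_zero.1 ?_⟩
  refine (map_sub (homologyClass (twistedCochainComplex ρ) (k + 1)) _ _).symm.trans
    ((homologyClass_eq_zero_iff _).2 ?_)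
  have hz : translate ρ u k (antidifference ρ u η k (translate ρ u k f - f) - f) =
      antidifference ρ u η k (translate ρ u k f - f) - f := by
    rw [map_sub, translate_antidifference ρ hu]
    abel
  refine ⟨⟨antidifference ρ u η k (translate ρ u k f - f) - f,
    mem_twistedCochains hgen (sub_mem (antidifference_mem_invariantCochains hN hb.1) hf) hz⟩, ?_⟩
  change (antidifference ρ u η k (translate ρ u k f - f) - f) ∘ₗ _ =
    antidifference ρ u η k (translate ρ u k f - f) ∘ₗ _ - p.1
  rw [LinearMap.sub_comp, hfp]

/-- In degree `0` being an invariant coboundary means being zero, so the hypothesis kills every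
cocycle. -/
theorem subsingleton_twistedCohomology_zero (N : Subgroup (PiOne Y y₀)) (u : PiOne Y y₀)
    (hvan : ∀ p ∈ invariantCocycles ρ N 0, translate ρ u 0 p = p →
      IsInvariantCoboundary ρ N 0 p) :
    Subsingleton (twistedCohomology ρ 0) := by
  refine subsingleton_of_forall_eq 0 fun x => ?_
  obtain ⟨z, rfl⟩ := homologyClass_surjective _ _ x
  let p : twistedCochains ρ 0 := z.1
  have hp (j : ℕ) : p.1 ∘ₗ boundary _ j 0 = 0 :=
    congrArg Subtype.val (mem_cyclesSubmodule.1 z.2 j)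
  have h0 := hvan p.1 ⟨mem_invariantCochains.2 fun g _ =>
    twistedCochains_translate p g, hp⟩ (twistedCochains_translate p u)
  exact (homologyClass_eq_zero _).2 ⟨0, 0, (map_zero _).trans (Subtype.ext h0.symm)⟩

end CyclicCovering

/-! ### The cohomology of the mapping torus -/

theorem homotopyOperator_chainsMap {E F E' F' : Type u} [TopologicalSpace E] [TopologicalSpace F]
    [TopologicalSpace E'] [TopologicalSpace F'] (h : C(unitInterval × E, F))
    (h' : C(unitInterval × E', F')) (a : C(E, E')) (b : C(F, F'))
    (hab : ∀ s x, h' (s, a x) = b (h (s, x))) {n : ℕ} (c : (singularChains E).X n) :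
    homotopyOperator h' n (chainsMap a n c) = chainsMap b (n + 1) (homotopyOperator h n c) := by
  suffices e : homotopyOperator h' n ∘ₗ chainsMap a n =
      chainsMap b (n + 1) ∘ₗ homotopyOperator h n from LinearMap.congr_fun e c
  refine chains_hom_ext fun σ => ?_
  rw [LinearMap.comp_apply, LinearMap.comp_apply, chainsMap_ofSimplex, homotopyOperator_ofSimplex,
    homotopyOperator_ofSimplex, chainsMap_prismChain]
  exact congrArg prismChain (ContinuousMap.ext fun p => hab p.1 (σ p.2))

section Assembly

local notation "𝕃" => LaurentPolynomial ℂ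

variable {M : Type u} [TopologicalSpace M] (φ : M ≃ₜ M) {x₀ : M} (τ : Path x₀ (φ x₀))
variable {V : Type v} [AddCommGroup V] [Module ℂ V]
  (ρ : Representation ℂ (PiOne (MappingTorus φ) (MappingTorus.incl φ x₀)) V)

open MappingTorus

theorem evalDual_rhoBar (g : PiOne (MappingTorus φ) (incl φ x₀)) (v : Module.Dual ℂ V)
    (x : 𝕃 ⊗[ℂ] V) : evalDual v (rhoBar ρ (xi φ x₀) g x) =
      (LaurentPolynomial.T (xi φ x₀ g).toAdd : 𝕃) • evalDual (v ∘ₗ ρ g) x := by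
  change evalDual v ((LaurentPolynomial.T (xi φ x₀ g).toAdd : 𝕃) • (ρ g).baseChange 𝕃 x) = _
  rw [map_smul, evalDual_baseChange]

/-- The restriction of `ρ̄` to the fundamental group of the fibre. -/
def rhoBarFibre : Representation 𝕃 (PiOne M x₀) (𝕃 ⊗[ℂ] V) :=
  (rhoBar ρ (xi φ x₀)).comp (PiOne.map (incl φ) x₀)

/-- Loops in the fibre have winding number zero, so no power of `t` enters and only the transpose of
`ρ` remains. -/
theorem isAdjoint_rhoBarFibre :
    IsAdjoint (rhoBarFibre φ ρ) (restrictToFibre φ (conjugateAntirep ρ)) := fun g v x => by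
  refine (evalDual_rhoBar φ ρ (PiOne.map (incl φ) x₀ g) v x).trans ?_
  rw [xi_map_incl, toAdd_one, LaurentPolynomial.T_zero, one_smul]
  rfl

theorem chainsMap_fibreIncl_act (h : PiOne M x₀) {n : ℕ}
    (c : (singularChains (UniversalCover M x₀)).X n) :
    chainsMap (fibreIncl φ) n (chainsMap (UniversalCover.act h) n c) =
      chainsMap (UniversalCover.act (PiOne.map (incl φ) x₀ h)) n
        (chainsMap (fibreIncl φ) n c) := by
  rw [← LinearMap.comp_apply, ← LinearMap.comp_apply, ← chainsMap_comp, ← chainsMap_comp]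
  exact LinearMap.congr_fun (congrArg (fun f => chainsMap f n)
    (ContinuousMap.ext fun x => fibreIncl_smul φ h x)) c

theorem chainsMap_fibreProj_act (h : PiOne M x₀) {n : ℕ}
    (c : (singularChains (UniversalCover (MappingTorus φ) (incl φ x₀))).X n) :
    chainsMap (fibreProj φ) n (chainsMap (UniversalCover.act (PiOne.map (incl φ) x₀ h)) n c) =
      chainsMap (UniversalCover.act h) n (chainsMap (fibreProj φ) n c) := by
  rw [← LinearMap.comp_apply, ← LinearMap.comp_apply, ← chainsMap_comp, ← chainsMap_comp]
  exact LinearMap.congr_fun (congrArg (fun f => chainsMap f n)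
    (ContinuousMap.ext fun x => fibreProj_map_incl_smul φ h x)) c

theorem chainsMap_fibreProj_fibreIncl {n : ℕ}
    (c : (singularChains (UniversalCover M x₀)).X n) :
    chainsMap (fibreProj φ) n (chainsMap (fibreIncl φ) n c) = c := by
  have e : (fibreProj φ).comp (fibreIncl φ) = ContinuousMap.id (UniversalCover M x₀) :=
    ContinuousMap.ext fun x => fibreProj_fibreIncl φ x
  rw [← LinearMap.comp_apply, ← chainsMap_comp, e, chainsMap_id]
  rfl

theorem chainsMap_fibreProj_act_uElt {n : ℕ}
    (c : (singularChains (UniversalCover M x₀)).X n) :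
    chainsMap (fibreProj φ) n (chainsMap (UniversalCover.act (uElt φ τ)) n
      (chainsMap (fibreIncl φ) n c)) = chainsMap (phiLift φ τ) n c := by
  have e : ((fibreProj φ).comp (UniversalCover.act (uElt φ τ))).comp (fibreIncl φ) =
      phiLift φ τ := ContinuousMap.ext fun x => by
    change fibreProj φ (uElt φ τ • fibreIncl φ x) = _
    rw [fibreProj_uElt_smul, fibreProj_fibreIncl]
  rw [← e, chainsMap_comp, chainsMap_comp]
  rfl

/-- Restriction of cochains to the fibre. -/
def restrictCochains (n : ℕ) : invariantCocycles (rhoBar ρ (xi φ x₀)) (xi φ x₀).ker n →ₗ[𝕃]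
    twistedCochains (rhoBarFibre φ ρ) n where
  toFun f := ⟨f.1 ∘ₗ chainsMap (fibreIncl φ) n, fun h c => by
    rw [LinearMap.comp_apply, chainsMap_fibreIncl_act, (translate_eq_self_iff _).1
      (mem_invariantCochains.1 f.2.1 _ (MonoidHom.mem_ker.2 (xi_map_incl φ h)))]
    rfl⟩
  map_add' _ _ := rfl
  map_smul' _ _ := rfl

theorem coboundary_restrictCochains {n : ℕ}
    (f : invariantCocycles (rhoBar ρ (xi φ x₀)) (xi φ x₀).ker n) (j : ℕ) :
    coboundary (rhoBarFibre φ ρ) n j (restrictCochains φ ρ n f) = 0 := by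
  refine Subtype.ext ?_
  change (f.1 ∘ₗ chainsMap (fibreIncl φ) n) ∘ₗ boundary _ j n = 0
  rw [LinearMap.comp_assoc, ← boundary_chainsMap, ← LinearMap.comp_assoc, f.2.2,
    LinearMap.zero_comp]

include τ in
theorem comp_fibreProj_mem {n : ℕ} (f : twistedCochains (rhoBarFibre φ ρ) n) :
    f.1 ∘ₗ chainsMap (fibreProj φ) n ∈
      invariantCochains (rhoBar ρ (xi φ x₀)) (xi φ x₀).ker n :=
  mem_invariantCochains.2 fun g hg => (translate_eq_self_iff _).2 fun c => by
    obtain ⟨h, rfl⟩ := exists_map_incl_eq φ τ (MonoidHom.mem_ker.1 hg)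
    rw [LinearMap.comp_apply, chainsMap_fibreProj_act, f.2]
    rfl

include τ in
/-- A cocycle is homologous to the pull-back of its restriction to the fibre. -/
theorem isInvariantCoboundary_sub {n : ℕ}
    (f : invariantCocycles (rhoBar ρ (xi φ x₀)) (xi φ x₀).ker n) :
    IsInvariantCoboundary (rhoBar ρ (xi φ x₀)) (xi φ x₀).ker n
      (f.1 - (restrictCochains φ ρ n f).1 ∘ₗ chainsMap (fibreProj φ) n) := by
  have hc (c : (singularChains (UniversalCover (MappingTorus φ) (incl φ x₀))).X n) :
      chainsMap ((fibreIncl φ).comp (fibreProj φ)) n c =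
        chainsMap (fibreIncl φ) n (chainsMap (fibreProj φ) n c) := by
    rw [chainsMap_comp]
    rfl
  have hz (c : (singularChains (UniversalCover (MappingTorus φ) (incl φ x₀))).X (n + 1)) :
      f.1 (boundary _ (n + 1) n c) = 0 := LinearMap.congr_fun (f.2.2 (n + 1)) c
  cases n with
  | zero =>
    refine LinearMap.ext fun c => ?_
    have h := hz (homotopyOperator (fibreHomotopy φ).toContinuousMap 0 c)
    rw [boundary_homotopyOperator_zero, hc, chainsMap_id, map_sub] at h
    exact h
  | succ n =>
    -- The primitive is `f` composed with the prism operator of the deformation; it is equivariant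
    -- because the deformation commutes with the group of the fibre.
    refine ⟨f.1 ∘ₗ homotopyOperator (fibreHomotopy φ).toContinuousMap n,
      mem_invariantCochains.2 fun g hg => (translate_eq_self_iff _).2 fun c => ?_,
      LinearMap.ext fun c => ?_⟩
    · rw [LinearMap.comp_apply, LinearMap.comp_apply, ← (translate_eq_self_iff _).1
        (mem_invariantCochains.1 f.2.1 _ hg)]
      obtain ⟨h, rfl⟩ := exists_map_incl_eq φ τ (MonoidHom.mem_ker.1 hg)
      refine congrArg f.1 (homotopyOperator_chainsMap _ _ _ _ (fun s x => ?_) c)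
      exact fibreHomotopy_map_incl_smul φ h s x
    · have h := hz (homotopyOperator (fibreHomotopy φ).toContinuousMap (n + 1) c)
      rw [boundary_homotopyOperator_succ, hc, chainsMap_id, map_sub, map_sub, sub_eq_zero] at h
      exact h.symm

/-- The functional on the homology of the fibre given by a cocycle. -/
def fibreEval (k : ℕ) : invariantCocycles (rhoBar ρ (xi φ x₀)) (xi φ x₀).ker k →ₗ[𝕃]
    (twistedHomology (restrictToFibre φ (conjugateAntirep ρ)) k →ₗ[ℂ] 𝕃) :=
  cohomologyEval (isAdjoint_rhoBarFibre φ ρ) k ∘ₗ restrictCochains φ ρ k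

theorem fibreEval_homologyClass {k : ℕ}
    (f : invariantCocycles (rhoBar ρ (xi φ x₀)) (xi φ x₀).ker k)
    (z : cyclesSubmodule (twistedChainComplex (restrictToFibre φ (conjugateAntirep ρ))) k) :
    fibreEval φ ρ k f (homologyClass _ k z) =
      pairing (isAdjoint_rhoBarFibre φ ρ) k (restrictCochains φ ρ k f)
        (show twistedChains _ k from z.1) :=
  cohomologyEval_homologyClass _ (coboundary_restrictCochains φ ρ f) z

include τ in
theorem fibreEval_surjective [FiniteDimensional ℂ V] (k : ℕ) :
    Function.Surjective (fibreEval (x₀ := x₀) φ ρ k) := by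
  intro F
  obtain ⟨f, hf, rfl⟩ := cohomologyEval_surjective (isAdjoint_rhoBarFibre φ ρ) k F
  refine ⟨⟨f.1 ∘ₗ chainsMap (fibreProj φ) k, comp_fibreProj_mem φ τ ρ f, fun j => ?_⟩, ?_⟩
  · have h : f.1 ∘ₗ boundary _ j k = 0 := congrArg Subtype.val (hf j)
    rw [LinearMap.comp_assoc, ← boundary_chainsMap, ← LinearMap.comp_assoc, h, LinearMap.zero_comp]
  · refine congrArg (cohomologyEval (isAdjoint_rhoBarFibre φ ρ) k) (Subtype.ext ?_)
    exact LinearMap.ext fun c => congrArg f.1 (chainsMap_fibreProj_fibreIncl φ c)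

theorem fibreEval_eq_zero_of_isInvariantCoboundary {k : ℕ}
    {f : invariantCocycles (rhoBar ρ (xi φ x₀)) (xi φ x₀).ker k}
    (hf : IsInvariantCoboundary (rhoBar ρ (xi φ x₀)) (xi φ x₀).ker k f.1) :
    fibreEval φ ρ k f = 0 := by
  refine LinearMap.ext fun x => ?_
  obtain ⟨z, rfl⟩ := homologyClass_surjective _ _ x
  obtain ⟨j, g, hg, e⟩ := hf.exists_comp
  let g' : twistedCochains (rhoBarFibre φ ρ) j := ⟨g ∘ₗ chainsMap (fibreIncl φ) j, fun h c => by
    rw [LinearMap.comp_apply, chainsMap_fibreIncl_act, (translate_eq_self_iff _).1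
      (mem_invariantCochains.1 hg _ (MonoidHom.mem_ker.2 (xi_map_incl φ h)))]
    rfl⟩
  have h1 : restrictCochains φ ρ k f = coboundary (rhoBarFibre φ ρ) j k g' := by
    refine Subtype.ext ?_
    change f.1 ∘ₗ chainsMap (fibreIncl φ) k = (g ∘ₗ chainsMap (fibreIncl φ) j) ∘ₗ boundary _ k j
    rw [← e, LinearMap.comp_assoc, boundary_chainsMap, LinearMap.comp_assoc]
  rw [fibreEval_homologyClass, h1, pairing_coboundary]
  exact (congrArg _ (mem_cyclesSubmodule.1 z.2 j)).trans (map_zero _)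

include τ in
-- The restriction to the fibre is a coboundary by universal coefficients, its pull-back along
-- `fibreProj` is an invariant coboundary, and `f` differs from that pull-back by another one.
theorem isInvariantCoboundary_of_fibreEval_eq_zero [FiniteDimensional ℂ V] {k : ℕ}
    {f : invariantCocycles (rhoBar ρ (xi φ x₀)) (xi φ x₀).ker k} (hf : fibreEval φ ρ k f = 0) :
    IsInvariantCoboundary (rhoBar ρ (xi φ x₀)) (xi φ x₀).ker k f.1 := by
  obtain ⟨j, g, hg⟩ := exists_coboundary_of_cohomologyEval_eq_zero (isAdjoint_rhoBarFibre φ ρ)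
    (coboundary_restrictCochains φ ρ f) hf
  have h1 := isInvariantCoboundary_comp (k := k) (comp_fibreProj_mem φ τ ρ g)
  have h2 := (isInvariantCoboundary_sub φ τ ρ f).add h1
  have h3 : (g.1 ∘ₗ chainsMap (fibreProj φ) j) ∘ₗ boundary _ k j =
      (restrictCochains φ ρ k f).1 ∘ₗ chainsMap (fibreProj φ) k := by
    rw [← hg, LinearMap.comp_assoc, ← boundary_chainsMap]
    rfl
  rwa [h3, sub_add_cancel] at h2

/-- As `ξ(u) = 1`, the operator `ρ̄(u)⁻¹` contributes the factor `t⁻¹` and the transpose of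
`ρ(u)⁻¹`; the latter, together with `φ̃` on simplices, is the chain map defining the monodromy. -/
theorem pairing_translate {k : ℕ} (f f' : twistedCochains (rhoBarFibre φ ρ) k)
    (h : ∀ c, f'.1 c = rhoBar ρ (xi φ x₀) (uElt φ τ)⁻¹ (f.1 (chainsMap (phiLift φ τ) k c)))
    (z : (twistedChainComplex (restrictToFibre φ (conjugateAntirep ρ))).X k) :
    pairing (isAdjoint_rhoBarFibre φ ρ) k f' z = (LaurentPolynomial.T (-1) : 𝕃) •
      pairing (isAdjoint_rhoBarFibre φ ρ) k f
        (((twistedChainsMap (compatible_phi φ τ (conjugateAntirep ρ))).f k).hom z) := by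
  let A : twistedChains (restrictToFibre φ (conjugateAntirep ρ)) k →ₗ[ℂ]
      twistedChains (restrictToFibre φ (conjugateAntirep ρ)) k :=
    ((twistedChainsMap (compatible_phi φ τ (conjugateAntirep ρ))).f k).hom
  suffices e : pairing (isAdjoint_rhoBarFibre φ ρ) k f' = (LaurentPolynomial.T (-1) : 𝕃) •
      (pairing (isAdjoint_rhoBarFibre φ ρ) k f ∘ₗ A) from LinearMap.congr_fun e z
  refine twistedChains_ext fun v c => ?_
  refine (pairing_mk (isAdjoint_rhoBarFibre φ ρ) f' v c).trans ?_
  rw [h, evalDual_rhoBar, map_inv, xi_uElt]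
  rfl

/-- The element `u` moves the fibre from height `0` to height `1`. For a cochain pulled back along
`fibreProj` this is invisible, and the induced map of `M̃` is `φ̃`. -/
theorem restrictCochains_translate {k : ℕ}
    (f : invariantCocycles (rhoBar ρ (xi φ x₀)) (xi φ x₀).ker k)
    {f' : twistedCochains (rhoBarFibre φ ρ) k} (hf : f.1 = f'.1 ∘ₗ chainsMap (fibreProj φ) k)
    (c : (singularChains (UniversalCover M x₀)).X k) :
    (restrictCochains φ ρ k
      (translateCocycles (rhoBar ρ (xi φ x₀)) (xi φ x₀).ker (uElt φ τ) k f)).1 c =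
      rhoBar ρ (xi φ x₀) (uElt φ τ)⁻¹ (f'.1 (chainsMap (phiLift φ τ) k c)) := by
  rw [← chainsMap_fibreProj_act_uElt, ← LinearMap.comp_apply f'.1, ← hf]
  rfl

/-- Replace `f` by the pull-back `f₁` of its restriction to the fibre. The difference and its
translate are invariant coboundaries, which the evaluation ignores, and for `f₁` the translate can
be computed on the fibre. -/
theorem fibreEval_translate (k : ℕ)
    (f : invariantCocycles (rhoBar ρ (xi φ x₀)) (xi φ x₀).ker k) :
    fibreEval φ ρ k (translateCocycles (rhoBar ρ (xi φ x₀)) (xi φ x₀).ker (uElt φ τ) k f) =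
      homTwist (twistedMonodromy φ τ (conjugateAntirep ρ) k) (fibreEval φ ρ k f) := by
  obtain ⟨f₁, hf₁, hb⟩ : ∃ f₁ : invariantCocycles (rhoBar ρ (xi φ x₀)) (xi φ x₀).ker k,
      f₁.1 = (restrictCochains φ ρ k f).1 ∘ₗ chainsMap (fibreProj φ) k ∧
        IsInvariantCoboundary (rhoBar ρ (xi φ x₀)) (xi φ x₀).ker k (f - f₁).1 := by
    refine ⟨⟨_, comp_fibreProj_mem φ τ ρ (restrictCochains φ ρ k f), fun j => ?_⟩, rfl,
      isInvariantCoboundary_sub φ τ ρ f⟩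
    have h : (restrictCochains φ ρ k f).1 ∘ₗ boundary _ j k = 0 :=
      congrArg Subtype.val (coboundary_restrictCochains φ ρ f j)
    rw [LinearMap.comp_assoc, ← boundary_chainsMap, ← LinearMap.comp_assoc, h, LinearMap.zero_comp]
  have hb' : IsInvariantCoboundary (rhoBar ρ (xi φ x₀)) (xi φ x₀).ker k
      (translateCocycles (rhoBar ρ (xi φ x₀)) (xi φ x₀).ker (uElt φ τ) k (f - f₁)).1 := by
    obtain ⟨j, g, hg, e⟩ := hb.exists_comp
    change IsInvariantCoboundary _ _ k (translate _ (uElt φ τ) k (f - f₁).1)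
    rw [← e, translate_boundary]
    exact isInvariantCoboundary_comp (translate_mem_invariantCochains _ hg)
  have e1 := fibreEval_eq_zero_of_isInvariantCoboundary φ ρ hb
  have e2 := fibreEval_eq_zero_of_isInvariantCoboundary φ ρ hb'
  rw [map_sub, sub_eq_zero] at e1
  rw [map_sub, map_sub, sub_eq_zero] at e2
  rw [e2]
  refine LinearMap.ext fun x => ?_
  obtain ⟨z, rfl⟩ := homologyClass_surjective _ _ x
  refine (fibreEval_homologyClass φ ρ _ z).trans ?_
  refine (pairing_translate φ τ ρ (restrictCochains φ ρ k f) _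
    (restrictCochains_translate φ τ ρ f₁ hf₁) z.1).trans ?_
  change _ = (LaurentPolynomial.T (-1) : 𝕃) • fibreEval φ ρ k f
    ((HomologicalComplex.homologyMap (twistedChainsMap (compatible_phi φ τ _)) k).hom
      (homologyClass _ k z))
  rw [homologyMap_homologyClass]
  exact congrArg _ (fibreEval_homologyClass φ ρ f
    ⟨_, map_mem_cyclesSubmodule (twistedChainsMap (compatible_phi φ τ _)) z.2⟩).symm

end Assembly

/-! ### Vanishing of fixed classes on the fibre. -/

section Main

open MappingTorus

variable {M : Type u} [TopologicalSpace M] (φ : M ≃ₜ M) {x₀ : M} (τ : Path x₀ (φ x₀))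

include τ in
theorem height_smul_of_mem_ker {g : PiOne (MappingTorus φ) (incl φ x₀)} (hg : g ∈ (xi φ x₀).ker)
    (z : UniversalCover (MappingTorus φ) (incl φ x₀)) : height φ (g • z) = height φ z := by
  obtain ⟨h, rfl⟩ := exists_map_incl_eq φ τ (MonoidHom.mem_ker.1 hg)
  exact height_map_incl_smul φ h z

theorem exists_eq_zpow_uElt_mul (g : PiOne (MappingTorus φ) (incl φ x₀)) :
    ∃ m : ℤ, ∃ h ∈ (xi φ x₀).ker, g = uElt φ τ ^ m * h := by
  refine ⟨(xi φ x₀ g).toAdd, uElt φ τ ^ (-(xi φ x₀ g).toAdd) * g, ?_, by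
    rw [zpow_neg, mul_inv_cancel_left]⟩
  rw [MonoidHom.mem_ker, map_mul, map_zpow, xi_uElt, ← ofAdd_zsmul, zsmul_one, Int.cast_id,
    ofAdd_neg, ofAdd_toAdd, inv_mul_cancel]

variable {V : Type v} [AddCommGroup V] [Module ℂ V] [FiniteDimensional ℂ V]
  (ρ : Representation ℂ (PiOne (MappingTorus φ) (incl φ x₀)) V)

/-- The functional of a cocycle fixed by `U` is fixed by `F ↦ t⁻¹ F ∘ A`, hence zero, because the
homology of the fibre is finite-dimensional. -/
theorem isInvariantCoboundary_of_translate_eq {k : ℕ}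
    [FiniteDimensional ℂ (twistedHomology (restrictToFibre φ (conjugateAntirep ρ)) k)]
    {p} (hp : p ∈ invariantCocycles (rhoBar ρ (xi φ x₀)) (xi φ x₀).ker k)
    (h : translate (rhoBar ρ (xi φ x₀)) (uElt φ τ) k p = p) :
    IsInvariantCoboundary (rhoBar ρ (xi φ x₀)) (xi φ x₀).ker k p := by
  refine isInvariantCoboundary_of_fibreEval_eq_zero φ τ ρ (f := ⟨p, hp⟩)
    (eq_zero_of_homTwist_eq (twistedMonodromy φ τ (conjugateAntirep ρ) k) ?_)
  rw [← fibreEval_translate]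
  exact congrArg _ (Subtype.ext h)

end Main

end TwistedMonodromy

end

/-- Let `M` be a compact connected smooth manifold, `φ` a homeomorphism of `M`, `X` its mapping
torus, `ρ` a finite-dimensional complex representation of `π₁(X, x₀)` and `τ` a path in `M` from `x₀`
to `φ x₀` (used to define the twisted monodromy `φ_*`). Then `H^k(X, ρ̄) ≅ H_{k-1}(M, ρ₀*)` as
modules over `ℂ[t, t⁻¹]`, where `t` acts on the right by `φ_*`; for `k = 0` the right-hand side
is zero. -/
theorem mainTheorem6 {d : ℕ} {M : Type*} [TopologicalSpace M] [T2Space M] [CompactSpace M]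
    [ConnectedSpace M] [ChartedSpace (EuclideanSpace ℝ (Fin d)) M] [IsManifold (𝓡 d) ∞ M]
    (φ : M ≃ₜ M) (x₀ : M) (τ : Path x₀ (φ x₀))
    {V : Type*} [AddCommGroup V] [Module ℂ V] [FiniteDimensional ℂ V]
    (ρ : Representation ℂ (PiOne (MappingTorus φ) (MappingTorus.incl φ x₀)) V) :
    Subsingleton (twistedCohomology (rhoBar ρ (MappingTorus.xi φ x₀)) 0) ∧
      ∀ k : ℕ, Nonempty
        (twistedCohomology (rhoBar ρ (MappingTorus.xi φ x₀)) (k + 1) ≃ₗ[LaurentPolynomial ℂ]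
          LaurentModule (twistedMonodromy φ τ (conjugateAntirep ρ) k)) := by
  have hfin (k : ℕ) : FiniteDimensional ℂ
      (twistedHomology (restrictToFibre φ (conjugateAntirep ρ)) k) :=
    twistedHomology_finite (d := d) _ k
  have hN := fun g hg z => height_smul_of_mem_ker φ τ (g := g) hg z
  have hu := MappingTorus.height_uElt_smul φ τ
  have hgen := exists_eq_zpow_uElt_mul φ τ
  refine ⟨subsingleton_twistedCohomology_zero (MappingTorus.xi φ x₀).ker
    (MappingTorus.uElt φ τ) fun p hp h => isInvariantCoboundary_of_translate_eq φ τ ρ hp h,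
    fun k => ?_⟩
  -- Here `U` is translation of invariant cocycles by `u`, `κ` is evaluation on the homology of the
  -- fibre, and `δ` is the connecting map. Cocycles on which `κ` vanishes are invariant
  -- coboundaries, on which `U y - y = x` can be solved by a cocycle `y`.
  exact nonempty_equiv_of_conj (twistedMonodromy φ τ (conjugateAntirep ρ) k)
    (fibreEval_translate φ τ ρ k) (fibreEval_surjective φ τ ρ k)
    (fun x hx => (isInvariantCoboundary_of_fibreEval_eq_zero φ τ ρ hx).exists_translate_sub hN hu)
    (connecting _ _ _ hN hu hgen k)
    (connecting_surjective hN hu hgen k fun p hp h =>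
      isInvariantCoboundary_of_translate_eq φ τ ρ hp h)
    (connecting_eq_zero_iff hN hu hgen k)
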